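/- Let $n\ge 2$, let $\omega\subset\mathbb{R}^{n-1}$ be a bounded domain (for instance one with Lipschitz boundary), and let $H\in C^2(\overline\omega)$, i.e. $H$ is $C^2$ in $\omega$ and its derivatives of order at most $2$ extend continuously to $\overline\omega$. For an open set $\Omega$ and a part $S$ of $\partial\Omega$ let $\mathring H^1(\Omega;S)$ be the space of functions of $H^1(\Omega)$ that vanish on $S$, i.e. the closure in $H^1(\Omega)$ of the (restrictions to $\Omega$ of) smooth compactly supported functions vanishing near $\overline S$. Let $\mu_1$ be the first eigenvalue of the Dirichlet problem in $\omega$ and $\varphi_1\not\equiv 0$ a corresponding eigenfunction: $\varphi_1\in\mathring H^1(\omega;\partial\omega)$ and $(\nabla\varphi_1,\nabla\psi)_\omega=\mu_1(\varphi_1,\psi)_\omega$ for all $\psi\in\mathring H^1(\omega;\partial\omega)$. Let $$\Pi=\{(\eta,\zeta):\eta\in\omega,\ \zeta>-H(\eta)\},\qquad \Gamma=\{(\eta,\zeta):\eta\in\omega,\ \zeta=-H(\eta)\},\qquad \Sigma=\partial\Pi\setminus\overline\Gamma .$$ (i) If $$\int_\omega\varphi_1(\eta)^2\,\Delta H(\eta)\,d\eta<0,\qquad(*)$$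 then the mixed problem $-\Delta U=\Lambda U$ in $\Pi$, $U=0$ on $\Sigma$, $\partial_\nu U=0$ on $\Gamma$, has an eigenvalue $\Lambda\in(0,\mu_1)$; that is, there is $U\in\mathring H^1(\Pi;\Sigma)$, $U\not\equiv0$, with $(\nabla U,\nabla V)_\Pi=\Lambda(U,V)_\Pi$ for all $V\in\mathring H^1(\Pi;\Sigma)$. (ii) Condition $(*)$ is equivalent to $$\int_\omega H(\eta)\left(|\nabla\varphi_1(\eta)|^2-\mu_1\varphi_1(\eta)^2\right)d\eta<0 .$$ (iii) Condition $(*)$ holds whenever $\Delta H\le 0$ in $\omega$ and $\Delta H\not\equiv0$ (that is, $H$ is superharmonic, in the usual terminology, but not harmonic). -/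

import Mathlib

open MeasureTheory Filter Topology Set
open scoped ContDiff ENNReal Gradient Laplacian RealInnerProductSpace

namespace MixedCylinder

section Sobolev

variable {F : Type*} [NormedAddCommGroup F] [InnerProductSpace ℝ F] [CompleteSpace F]
  [MeasureSpace F]

/-- `u` belongs to the Sobolev space `H¹(Ω)` of the open set `Ω` and `G` is its weak gradient:
`u` and `G` are square integrable on `Ω`, and `∫_Ω u ∇ψ = -∫_Ω ψ G` for all test functions
`ψ ∈ C_c^∞(Ω)`. Only the values on `Ω` matter; `G` is determined by `u` almost everywhere
on `Ω`. -/
structure IsH1 (Ω : Set F) (u : F → ℝ) (G : F → F) : Prop where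
  memLp : MemLp u 2 (volume.restrict Ω)
  memLp_grad : MemLp G 2 (volume.restrict Ω)
  weak_grad : ∀ ψ : F → ℝ, ContDiff ℝ ∞ ψ → HasCompactSupport ψ → tsupport ψ ⊆ Ω →
    ∫ x in Ω, u x • ∇ ψ x = -∫ x in Ω, ψ x • G x

/-- `u` belongs to the space of functions in `H¹(Ω)` that vanish on the part `S` of the boundary
(and `G` is its weak gradient): the closure, in the norm of `H¹(Ω)`, of the restrictions to `Ω` of
the smooth compactly supported functions on the whole space that vanish in a neighbourhood of
`closure S`. For `Ω` bounded and `S = frontier Ω` this is the usual space `H¹₀(Ω)`. -/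
structure IsH1Zero (Ω S : Set F) (u : F → ℝ) (G : F → F) : Prop extends IsH1 Ω u G where
  approx : ∃ f : ℕ → F → ℝ,
    (∀ k, ContDiff ℝ ∞ (f k) ∧ HasCompactSupport (f k) ∧ Disjoint (tsupport (f k)) (closure S)) ∧
    Tendsto (fun k => eLpNorm (fun x => f k x - u x) 2 (volume.restrict Ω)) atTop (𝓝 0) ∧
    Tendsto (fun k => eLpNorm (fun x => ∇ (f k) x - G x) 2 (volume.restrict Ω)) atTop (𝓝 0)

/-- `u` (with weak gradient `G`) is an eigenfunction, for the eigenvalue `Λ`, of `-Δ` in `Ω` with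
the Dirichlet condition on the part `S` of the boundary and the Neumann condition on the rest of
the boundary, in the variational sense: `u ≠ 0` and `(∇u, ∇v)_Ω = Λ (u, v)_Ω` for all functions
`v` of `H¹(Ω)` that vanish on `S`. -/
structure IsEigenpair (Ω S : Set F) (Λ : ℝ) (u : F → ℝ) (G : F → F) : Prop where
  mem : IsH1Zero Ω S u G
  ne_zero : ¬ u =ᵐ[volume.restrict Ω] 0
  eigen : ∀ (v : F → ℝ) (Gv : F → F), IsH1Zero Ω S v Gv →
    ∫ x in Ω, ⟪G x, Gv x⟫ = Λ * ∫ x in Ω, u x * v x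

/-- `Λ` is an eigenvalue of the mixed problem in `Ω` with the Dirichlet condition on `S`. -/
def IsEigenvalue (Ω S : Set F) (Λ : ℝ) : Prop :=
  ∃ (u : F → ℝ) (G : F → F), IsEigenpair Ω S Λ u G

/-- `μ` is the first (smallest) eigenvalue of the Dirichlet problem in `Ω`, and `φ` is an
eigenfunction for it, with weak gradient `Dφ`. -/
structure IsFirstDirichletEigenpair (Ω : Set F) (μ : ℝ) (φ : F → ℝ) (Dφ : F → F) : Prop where
  eigenpair : IsEigenpair Ω (frontier Ω) μ φ Dφ
  first : ∀ Λ : ℝ, IsEigenvalue Ω (frontier Ω) Λ → μ ≤ Λ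

/-- `H ∈ C²(closure D)` for an open set `D`: `H` is twice continuously differentiable in `D`, and
its derivatives of order `0`, `1`, `2` have continuous extensions from `D` to `closure D`. -/
def IsC2Closure (D : Set F) (H : F → ℝ) : Prop :=
  ContDiffOn ℝ 2 H D ∧ ∀ k : ℕ, k ≤ 2 →
    ∃ g : F → F [×k]→L[ℝ] ℝ, ContinuousOn g (closure D) ∧ EqOn (iteratedFDeriv ℝ k H) g D

end Sobolev

/-- The space `ℝᵈ × ℝ` of the points `ξ = (η, ζ)`, with its Euclidean norm and Lebesgue measure;
`ξ.fst = η` and `ξ.snd = ζ`. -/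
abbrev Cyl (d : ℕ) : Type := WithLp 2 (EuclideanSpace ℝ (Fin d) × ℝ)

/-- The semi-infinite cylinder `{(η, ζ) : η ∈ D, ζ > -H(η)}` with a curved end. -/
def semiCylinder {d : ℕ} (D : Set (EuclideanSpace ℝ (Fin d)))
    (H : EuclideanSpace ℝ (Fin d) → ℝ) : Set (Cyl d) :=
  {ξ | ξ.fst ∈ D ∧ -H ξ.fst < ξ.snd}

/-- The curved end `{(η, ζ) : η ∈ D, ζ = -H(η)}`. -/
def curvedEnd {d : ℕ} (D : Set (EuclideanSpace ℝ (Fin d)))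
    (H : EuclideanSpace ℝ (Fin d) → ℝ) : Set (Cyl d) :=
  {ξ | ξ.fst ∈ D ∧ ξ.snd = -H ξ.fst}

/-- The lateral side of the semi-infinite cylinder: its boundary without the closure of the curved
end. -/
def lateralSide {d : ℕ} (D : Set (EuclideanSpace ℝ (Fin d)))
    (H : EuclideanSpace ℝ (Fin d) → ℝ) : Set (Cyl d) :=
  frontier (semiCylinder D H) \ closure (curvedEnd D H)

end MixedCylinder

/-!
# Trapped modes in a semi-infinite cylinder with a curved end

Let `Π = {(η, ζ) : η ∈ D, ζ > -H η}` and let `μ` be the first Dirichlet eigenvalue of the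
cross-section `D`, with eigenfunction `φ`.

**Existence of a trapped mode.** The trial functions `φ(η) q(ζ)`, where `q` is a plateau function
equal to `1` near the curved end, have
`∫_Π |∇U|² - μ ∫_Π U² ≤ ∫_D (a + H)(|∇φ|² - μ φ²) + δ ∫_D φ²`, where `a = ∫_{ζ > 0} q²` and
`δ = ∫ q'²` is as small as desired. The term with the constant `a` is zero by the equation of `φ`,
so the Rayleigh quotient takes values below `μ` as soon as `∫_D H (|∇φ|² - μ φ²) < 0`
(`exists_trial`). On the other hand the spectrum below `μ` is discrete. This is expressed without
spectral theory: for every `c < μ` the form `∫_Π |∇U|² - c ∫_Π U²` is nonnegative up to a form of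
finite rank (`cylinder_finite_rank`). Indeed, far from the end, on the slices `ζ = const`, the
Dirichlet form is at least `μ` times the square of the `L²` norm (`rayleigh_flatCylinder`), and on
the bounded remaining part Poincaré's inequality on small cubes controls the `L²` norm by a small
multiple of the Dirichlet integral and finitely many mean values (`nearEnd_finite_rank`). No
regularity of `∂D` is available, so the cubes live in the straightened cylinder `ζ > 0`, where
functions that vanish on the lateral side extend by zero to the half-space (`pullback`). For a form
with this property a normalized minimizing sequence of the Rayleigh quotient has a convergent
subsequence (`exists_eigenvector_of_finite_rank`, `exists_eigenvalue_lt`), and the minimum is an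
eigenvalue `Λ < μ`. It is positive by the Friedrichs inequality (`exists_friedrichs`).

**The two forms of the condition.** The equation of `φ` tested with `H φ` reads
`∫ H (|∇φ|² - μ φ²) = -∫ φ ⟪∇φ, ∇H⟫`, and Green's formula for `φ²` and `H` gives
`2 ∫ φ ⟪∇φ, ∇H⟫ = -∫ φ² ΔH`, hence `∫ φ² ΔH = 2 ∫ H (|∇φ|² - μ φ²)`
(`IsEigenpair.integral_sq_mul_laplacian`). Both are carried out for smooth functions approximating
`φ`.

**Superharmonic `H`.** If `ΔH ≤ 0` and `ΔH ≠ 0` somewhere, the integral of `φ² ΔH` is negative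
unless `φ` vanishes on a ball. It does not: `|φ|` minimizes the Rayleigh quotient too, hence
`-Δ|φ| = μ |φ| ≥ 0` in the sense of distributions (`IsFirstDirichletEigenpair.integral_abs_mul`),
and tests with a radial barrier propagate a zero from a small ball to every concentric ball in `D`,
hence to all of the connected set `D` (`IsFirstDirichletEigenpair.not_ae_eq_zero_ball`).
-/

set_option linter.unusedSectionVars false

namespace MixedCylinder

/-! ### Eigenvalues below a finite rank perturbation -/

section Abstract

variable {V X Y : Type*} [NormedAddCommGroup V] [InnerProductSpace ℝ V]
  [NormedAddCommGroup X] [InnerProductSpace ℝ X] [NormedAddCommGroup Y] [InnerProductSpace ℝ Y]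

/-- The Cauchy–Schwarz inequality for the positive semidefinite form `‖A v‖² - c ‖J v‖²`. -/
theorem form_cauchy_schwarz (J : V →L[ℝ] X) (A : V →L[ℝ] Y) {c : ℝ}
    (h : ∀ v, c * ‖J v‖ ^ 2 ≤ ‖A v‖ ^ 2) (v w : V) :
    (⟪A v, A w⟫ - c * ⟪J v, J w⟫) ^ 2 ≤
      (‖A v‖ ^ 2 - c * ‖J v‖ ^ 2) * (‖A w‖ ^ 2 - c * ‖J w‖ ^ 2) := by
  have key : ∀ t : ℝ, 0 ≤ (‖A w‖ ^ 2 - c * ‖J w‖ ^ 2) * (t * t) +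
      (2 * (⟪A v, A w⟫ - c * ⟪J v, J w⟫)) * t + (‖A v‖ ^ 2 - c * ‖J v‖ ^ 2) := by
    intro t
    have h1 := h (v + t • w)
    simp only [map_add, map_smul, norm_add_sq_real, norm_smul, inner_smul_right, mul_pow,
      Real.norm_eq_abs, sq_abs] at h1
    nlinarith
  have := discrim_le_zero key
  unfold discrim at this
  nlinarith

/-- If the quadratic form `‖A v‖²` dominates `μ ‖J v‖²` up to a form of finite rank, then values
of the Rayleigh quotient below `μ` force an eigenvalue below `μ`: a minimizing sequence is a Cauchy
sequence along any subsequence on which its finite rank part converges. -/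
theorem exists_eigenvector_of_finite_rank [CompleteSpace V]
    (J : V →L[ℝ] X) (A : V →L[ℝ] Y) {ι : Type*} [Fintype ι] (T : V →L[ℝ] EuclideanSpace ℝ ι)
    (hnorm : ∀ v, ‖v‖ ^ 2 = ‖J v‖ ^ 2 + ‖A v‖ ^ 2) {μ : ℝ}
    (hT : ∀ v, μ * ‖J v‖ ^ 2 ≤ ‖A v‖ ^ 2 + ‖T v‖ ^ 2)
    (hv : ∃ v, ‖A v‖ ^ 2 < μ * ‖J v‖ ^ 2) :
    ∃ c < μ, ∃ v ≠ 0, ∀ w, ⟪A v, A w⟫ = c * ⟪J v, J w⟫ := by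
  obtain ⟨v₀, hv₀⟩ := hv
  have hpos : ∀ v, 0 < ‖J v‖ ^ 2 ∨ ‖J v‖ ^ 2 = 0 := fun v => by
    rcases (sq_nonneg ‖J v‖).lt_or_eq with h | h
    · exact Or.inl h
    · exact Or.inr h.symm
  have hJ₀ : 0 < ‖J v₀‖ ^ 2 := by
    rcases hpos v₀ with h | h
    · exact h
    · rw [h] at hv₀; nlinarith [sq_nonneg ‖A v₀‖]
  set R : Set ℝ := {r | ∃ v, 0 < ‖J v‖ ^ 2 ∧ r = ‖A v‖ ^ 2 / ‖J v‖ ^ 2} with hR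
  have hRne : R.Nonempty := ⟨_, v₀, hJ₀, rfl⟩
  have hRbdd : BddBelow R := ⟨0, by rintro r ⟨v, hv, rfl⟩; positivity⟩
  set c := sInf R with hc
  have hc0 : 0 ≤ c := Real.sInf_nonneg (by rintro r ⟨v, hv, rfl⟩; positivity)
  have hcμ : c < μ := by
    refine lt_of_le_of_lt (csInf_le hRbdd ⟨v₀, hJ₀, rfl⟩) ?_
    rwa [div_lt_iff₀ hJ₀]
  have hμ : 0 < μ := lt_of_le_of_lt hc0 hcμ
  have hform : ∀ v, c * ‖J v‖ ^ 2 ≤ ‖A v‖ ^ 2 := by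
    intro v
    rcases hpos v with h | h
    · rw [← le_div_iff₀ h]
      exact csInf_le hRbdd ⟨v, h, rfl⟩
    · rw [h]; simp
  -- a normalized minimizing sequence
  have hseq : ∀ k : ℕ, ∃ v, ‖v‖ = 1 ∧ ‖A v‖ ^ 2 - c * ‖J v‖ ^ 2 ≤ 1 / ((k : ℝ) + 1) := by
    intro k
    have hk : 0 < 1 / ((k : ℝ) + 1) := by positivity
    obtain ⟨r, ⟨v, hJv, rfl⟩, hr⟩ := exists_lt_of_csInf_lt hRne (lt_add_of_pos_right c hk)
    rw [div_lt_iff₀ hJv] at hr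
    have hvn : 0 < ‖v‖ ^ 2 := by rw [hnorm]; positivity
    have hvn' : ‖v‖ ≠ 0 := fun h => by simp [h] at hvn
    refine ⟨‖v‖⁻¹ • v, by rw [norm_smul, norm_inv, norm_norm, inv_mul_cancel₀ hvn'], ?_⟩
    have h1 : ‖J v‖ ^ 2 / ‖v‖ ^ 2 ≤ 1 := by
      rw [div_le_one hvn, hnorm]; nlinarith [sq_nonneg ‖A v‖]
    have h2 : ‖A (‖v‖⁻¹ • v)‖ ^ 2 - c * ‖J (‖v‖⁻¹ • v)‖ ^ 2
        = (‖A v‖ ^ 2 - c * ‖J v‖ ^ 2) / ‖v‖ ^ 2 := by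
      simp only [map_smul, norm_smul, norm_inv, norm_norm]
      field_simp
    rw [h2]
    calc (‖A v‖ ^ 2 - c * ‖J v‖ ^ 2) / ‖v‖ ^ 2
        ≤ (1 / ((k : ℝ) + 1) * ‖J v‖ ^ 2) / ‖v‖ ^ 2 := by
          gcongr; linarith
      _ = 1 / ((k : ℝ) + 1) * (‖J v‖ ^ 2 / ‖v‖ ^ 2) := by ring
      _ ≤ 1 / ((k : ℝ) + 1) * 1 := by gcongr
      _ = _ := mul_one _
  choose v hv1 hvlim using hseq
  have hlim0 : Tendsto (fun k => ‖A (v k)‖ ^ 2 - c * ‖J (v k)‖ ^ 2) atTop (𝓝 0) :=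
    squeeze_zero (fun k => sub_nonneg.2 (hform _)) hvlim tendsto_one_div_add_atTop_nhds_zero_nat
  have hbT : ∀ k, T (v k) ∈ Metric.closedBall (0 : EuclideanSpace ℝ ι) ‖T‖ := by
    intro k
    rw [mem_closedBall_zero_iff]
    simpa [hv1 k] using T.le_opNorm (v k)
  obtain ⟨z, -, σ, hσ, hz⟩ := (isCompact_closedBall _ _).tendsto_subseq hbT
  have hσ' := hσ.tendsto_atTop
  -- coercivity, because `c < μ`, of the form perturbed by the finite rank part
  obtain ⟨κ, hκ, hco⟩ : ∃ κ > 0, ∀ w, κ * ‖w‖ ^ 2 ≤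
      ‖A w‖ ^ 2 - c * ‖J w‖ ^ 2 + ‖T w‖ ^ 2 := by
    refine ⟨(1 - c / μ) / 2 * min 1 μ, ?_, fun w => ?_⟩
    · have : c / μ < 1 := (div_lt_one hμ).2 hcμ
      have : 0 < min 1 μ := lt_min one_pos hμ
      apply mul_pos <;> linarith
    · have h1 : 0 < 1 - c / μ := by linarith [(div_lt_one hμ).2 hcμ]
      have h2 := hT w
      have h3 : c * ‖J w‖ ^ 2 ≤ c / μ * (‖A w‖ ^ 2 + ‖T w‖ ^ 2) := by
        have := mul_le_mul_of_nonneg_left h2 (div_nonneg hc0 hμ.le)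
        rwa [← mul_assoc, div_mul_cancel₀ _ hμ.ne'] at this
      have h4 : min 1 μ * ‖w‖ ^ 2 ≤ 2 * (‖A w‖ ^ 2 + ‖T w‖ ^ 2) := by
        rw [hnorm]
        have e1 : min 1 μ * ‖J w‖ ^ 2 ≤ μ * ‖J w‖ ^ 2 := by
          gcongr; exact min_le_right _ _
        have e2 : min 1 μ * ‖A w‖ ^ 2 ≤ 1 * ‖A w‖ ^ 2 := by
          gcongr; exact min_le_left _ _
        nlinarith [sq_nonneg ‖T w‖]
      have h5 := mul_le_mul_of_nonneg_left h4 h1.le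
      nlinarith
  -- the parallelogram law bounds the form at `x - y` by twice its sum at `x` and `y`
  have hcau : CauchySeq (v ∘ σ) := by
    rw [Metric.cauchySeq_iff']
    intro ε hε
    set δ := κ * ε ^ 2 / 8 with hδ
    have hδ0 : 0 < δ := by positivity
    have ev1 := (hlim0.comp hσ').eventually (gt_mem_nhds hδ0)
    have hTc : CauchySeq (fun k => T (v (σ k))) := hz.cauchySeq
    obtain ⟨N₁, hN₁⟩ := eventually_atTop.1 ev1
    obtain ⟨N₂, hN₂⟩ := (Metric.cauchySeq_iff.1 hTc) (Real.sqrt δ) (Real.sqrt_pos.2 hδ0)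
    refine ⟨max N₁ N₂, fun k hk => ?_⟩
    have a1 := hN₁ k (le_trans (le_max_left _ _) hk)
    have a2 := hN₁ (max N₁ N₂) (le_max_left _ _)
    have a3 := hN₂ k (le_trans (le_max_right _ _) hk) (max N₁ N₂) (le_max_right _ _)
    simp only [Function.comp_apply] at a1 a2 ⊢
    set x := v (σ k)
    set y := v (σ (max N₁ N₂))
    rw [dist_eq_norm, ← map_sub] at a3
    have a4 : ‖T (x - y)‖ ^ 2 < δ := by
      have := pow_lt_pow_left₀ a3 (norm_nonneg _) two_ne_zero
      rwa [Real.sq_sqrt hδ0.le] at this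
    have a5 := hform (x + y)
    have a6 := hco (x - y)
    have p1 := parallelogram_law_with_norm ℝ (A x) (A y)
    have p2 := parallelogram_law_with_norm ℝ (J x) (J y)
    simp only [map_add, map_sub] at a4 a5 a6
    have a7 : κ * ‖x - y‖ ^ 2 < 5 * δ := by nlinarith
    have a8 : ‖x - y‖ ^ 2 < ε ^ 2 := by
      by_contra hcon
      push Not at hcon
      have := mul_le_mul_of_nonneg_left hcon hκ.le
      have : 5 * δ < κ * ε ^ 2 := by rw [hδ]; nlinarith [mul_pos hκ (pow_pos hε 2)]
      linarith
    rw [dist_eq_norm]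
    exact lt_of_pow_lt_pow_left₀ 2 hε.le a8
  obtain ⟨u, hu⟩ := cauchySeq_tendsto_of_complete hcau
  have hu1 : ‖u‖ = 1 :=
    tendsto_nhds_unique hu.norm (by simp [hv1])
  have hu0 : ‖A u‖ ^ 2 - c * ‖J u‖ ^ 2 = 0 := by
    refine tendsto_nhds_unique ?_ (hlim0.comp hσ')
    exact (((A.continuous.tendsto u).comp hu).norm.pow 2).sub
      ((((J.continuous.tendsto u).comp hu).norm.pow 2).const_mul c)
  refine ⟨c, hcμ, u, fun h => by simp [h] at hu1, fun w => ?_⟩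
  -- the form is nonnegative and vanishes at `u`, so `u` is in its kernel
  have := form_cauchy_schwarz J A hform u w
  rw [hu0, zero_mul] at this
  have h0 := pow_eq_zero_iff two_ne_zero |>.1 (le_antisymm this (sq_nonneg _))
  linarith

end Abstract

/-! ### Convergence in `L²` -/

section L2

variable {α E : Type*} [MeasurableSpace α] {ν : Measure α} [NormedAddCommGroup E]
  [InnerProductSpace ℝ E]

/-- `f k → g` in `L²(ν)`. -/
def L2Tendsto (ν : Measure α) (f : ℕ → α → E) (g : α → E) : Prop :=
  Tendsto (fun k => eLpNorm (fun x => f k x - g x) 2 ν) atTop (𝓝 0)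

theorem L2Tendsto.toLp {f : ℕ → α → E} {g : α → E} (h : L2Tendsto ν f g)
    (hf : ∀ k, MemLp (f k) 2 ν) (hg : MemLp g 2 ν) :
    Tendsto (fun k => (hf k).toLp (f k)) atTop (𝓝 (hg.toLp g)) :=
  (Lp.tendsto_Lp_iff_tendsto_eLpNorm'' f hf g hg).2 h

theorem inner_toLp {f g : α → E} (hf : MemLp f 2 ν) (hg : MemLp g 2 ν) :
    ⟪hf.toLp f, hg.toLp g⟫ = ∫ x, ⟪f x, g x⟫ ∂ν := by
  rw [L2.inner_def]
  refine integral_congr_ae ?_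
  filter_upwards [hf.coeFn_toLp, hg.coeFn_toLp] with x h1 h2
  rw [h1, h2]

theorem integrable_inner_of_memLp {f g : α → E} (hf : MemLp f 2 ν) (hg : MemLp g 2 ν) :
    Integrable (fun x => ⟪f x, g x⟫) ν := by
  refine (L2.integrable_inner (𝕜 := ℝ) (hf.toLp f) (hg.toLp g)).congr ?_
  filter_upwards [hf.coeFn_toLp, hg.coeFn_toLp] with x h1 h2
  rw [h1, h2]

theorem norm_sq_toLp {f : α → E} (hf : MemLp f 2 ν) :
    ‖hf.toLp f‖ ^ 2 = ∫ x, ‖f x‖ ^ 2 ∂ν := by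
  rw [← real_inner_self_eq_norm_sq, inner_toLp]
  simp only [real_inner_self_eq_norm_sq]

theorem L2Tendsto.integral_inner {f : ℕ → α → E} {g : α → E} {f' : ℕ → α → E} {g' : α → E}
    (h : L2Tendsto ν f g) (h' : L2Tendsto ν f' g')
    (hf : ∀ k, MemLp (f k) 2 ν) (hg : MemLp g 2 ν)
    (hf' : ∀ k, MemLp (f' k) 2 ν) (hg' : MemLp g' 2 ν) :
    Tendsto (fun k => ∫ x, ⟪f k x, f' k x⟫ ∂ν) atTop (𝓝 (∫ x, ⟪g x, g' x⟫ ∂ν)) := by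
  simp only [← inner_toLp (hf _) (hf' _), ← inner_toLp hg hg']
  exact (h.toLp hf hg).inner (h'.toLp hf' hg')

theorem L2Tendsto.integral_mul {f : ℕ → α → ℝ} {g : α → ℝ} {f' : ℕ → α → ℝ} {g' : α → ℝ}
    (h : L2Tendsto ν f g) (h' : L2Tendsto ν f' g')
    (hf : ∀ k, MemLp (f k) 2 ν) (hg : MemLp g 2 ν)
    (hf' : ∀ k, MemLp (f' k) 2 ν) (hg' : MemLp g' 2 ν) :
    Tendsto (fun k => ∫ x, f k x * f' k x ∂ν) atTop (𝓝 (∫ x, g x * g' x ∂ν)) := by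
  have := h'.integral_inner h hf' hg' hf hg
  simpa [real_inner_comm] using this

theorem l2Tendsto_const (f : α → E) : L2Tendsto ν (fun _ => f) f := by
  simp [L2Tendsto]

/-- Multiplication by a bounded function preserves convergence in `L²`. -/
theorem L2Tendsto.bdd_smul {f : ℕ → α → ℝ} {g : α → ℝ} (h : L2Tendsto ν f g) {b : α → E} {C : ℝ}
    (hb : ∀ᵐ x ∂ν, ‖b x‖ ≤ C) :
    L2Tendsto ν (fun k x => f k x • b x) (fun x => g x • b x) := by
  have hlim : Tendsto (fun k => ENNReal.ofReal C * eLpNorm (fun x => f k x - g x) 2 ν) atTop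
      (𝓝 0) := by
    simpa using ENNReal.Tendsto.const_mul h (Or.inr ENNReal.ofReal_ne_top)
  refine tendsto_of_tendsto_of_tendsto_of_le_of_le tendsto_const_nhds hlim (fun _ => zero_le)
    (fun k => ?_)
  refine eLpNorm_le_mul_eLpNorm_of_ae_le_mul ?_ 2
  filter_upwards [hb] with x hx
  rw [← sub_smul, norm_smul, mul_comm]
  gcongr

theorem L2Tendsto.smul_bdd {f : ℕ → α → E} {g : α → E} (h : L2Tendsto ν f g) {b : α → ℝ} {C : ℝ}
    (hb : ∀ᵐ x ∂ν, ‖b x‖ ≤ C) :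
    L2Tendsto ν (fun k x => b x • f k x) (fun x => b x • g x) := by
  have hlim : Tendsto (fun k => ENNReal.ofReal C * eLpNorm (fun x => f k x - g x) 2 ν) atTop
      (𝓝 0) := by
    simpa using ENNReal.Tendsto.const_mul h (Or.inr ENNReal.ofReal_ne_top)
  refine tendsto_of_tendsto_of_tendsto_of_le_of_le tendsto_const_nhds hlim (fun _ => zero_le)
    (fun k => ?_)
  refine eLpNorm_le_mul_eLpNorm_of_ae_le_mul ?_ 2
  filter_upwards [hb] with x hx
  rw [← smul_sub, norm_smul]
  gcongr

theorem L2Tendsto.add {f f' : ℕ → α → E} {g g' : α → E} (h : L2Tendsto ν f g)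
    (h' : L2Tendsto ν f' g') (hf : ∀ k, MemLp (f k) 2 ν) (hg : MemLp g 2 ν)
    (hf' : ∀ k, MemLp (f' k) 2 ν) (hg' : MemLp g' 2 ν) :
    L2Tendsto ν (fun k x => f k x + f' k x) (fun x => g x + g' x) := by
  have hlim := Tendsto.add h h'
  rw [add_zero] at hlim
  refine tendsto_of_tendsto_of_tendsto_of_le_of_le tendsto_const_nhds hlim (fun _ => zero_le)
    (fun k => ?_)
  have : (fun x => f k x + f' k x - (g x + g' x)) =
      (fun x => f k x - g x) + fun x => f' k x - g' x := by
    ext x; simp only [Pi.add_apply]; abel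
  dsimp only
  rw [this]
  exact eLpNorm_add_le ((hf k).sub hg).1 ((hf' k).sub hg').1 one_le_two

theorem memLp_bdd_smul {g : α → ℝ} (h : MemLp g 2 ν) {b : α → E} {C : ℝ}
    (hb : ∀ᵐ x ∂ν, ‖b x‖ ≤ C) (hbm : AEStronglyMeasurable b ν) :
    MemLp (fun x => g x • b x) 2 ν := by
  refine h.of_le_mul (c := C) (h.1.smul hbm) ?_
  filter_upwards [hb] with x hx
  rw [norm_smul, mul_comm]
  gcongr

theorem memLp_smul_bdd {g : α → E} (h : MemLp g 2 ν) {b : α → ℝ} {C : ℝ}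
    (hb : ∀ᵐ x ∂ν, ‖b x‖ ≤ C) (hbm : AEStronglyMeasurable b ν) :
    MemLp (fun x => b x • g x) 2 ν := by
  refine h.of_le_mul (c := C) (hbm.smul h.1) ?_
  filter_upwards [hb] with x hx
  rw [norm_smul]
  gcongr

/-- Uniform convergence on a set of finite measure implies convergence in `L²`. -/
theorem l2Tendsto_of_uniform [IsFiniteMeasure ν] {f : ℕ → α → E} {g : α → E} {ε : ℕ → ℝ}
    (hε : Tendsto ε atTop (𝓝 0)) (h : ∀ k, ∀ᵐ x ∂ν, ‖f k x - g x‖ ≤ ε k) :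
    L2Tendsto ν f g := by
  have hlim : Tendsto (fun k => ν univ ^ (2 : ℝ≥0∞).toReal⁻¹ * ENNReal.ofReal (ε k)) atTop
      (𝓝 0) := by
    have h1 : Tendsto (fun k => ENNReal.ofReal (ε k)) atTop (𝓝 0) := by
      simpa [Function.comp_def] using (ENNReal.continuous_ofReal.tendsto 0).comp hε
    have := ENNReal.Tendsto.const_mul (a := ν univ ^ (2 : ℝ≥0∞).toReal⁻¹) h1
      (Or.inr (ENNReal.rpow_ne_top_of_nonneg (by simp) (measure_ne_top ν _)))
    simpa using this
  exact tendsto_of_tendsto_of_tendsto_of_le_of_le tendsto_const_nhds hlim (fun _ => zero_le)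
    (fun k => eLpNorm_le_of_ae_bound (h k))

end L2

/-! ### Test functions -/

section Sobolev

variable {F : Type*} [NormedAddCommGroup F] [InnerProductSpace ℝ F] [FiniteDimensional ℝ F]
  [CompleteSpace F] [MeasurableSpace F] [BorelSpace F]

/-- The smooth compactly supported functions on the whole space that vanish in a neighbourhood of
`closure S`. -/
structure IsTest (S : Set F) (f : F → ℝ) : Prop where
  contDiff : ContDiff ℝ ∞ f
  compact : HasCompactSupport f
  disj : Disjoint (tsupport f) (closure S)

theorem inner_gradient_left {f : F → ℝ} (x v : F) : ⟪∇ f x, v⟫ = fderiv ℝ f x v := by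
  simp [gradient]

theorem inner_gradient_right {f : F → ℝ} (x v : F) : ⟪v, ∇ f x⟫ = fderiv ℝ f x v := by
  rw [real_inner_comm, inner_gradient_left]

theorem norm_gradient (f : F → ℝ) (x : F) : ‖∇ f x‖ = ‖fderiv ℝ f x‖ := by
  simp [gradient]

theorem continuous_gradient {f : F → ℝ} (h : ContDiff ℝ 1 f) : Continuous (∇ f) :=
  (InnerProductSpace.toDual ℝ F).symm.continuous.comp (h.continuous_fderiv one_ne_zero)

theorem hasCompactSupport_gradient {f : F → ℝ} (h : HasCompactSupport f) :
    HasCompactSupport (∇ f) :=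
  (h.fderiv (𝕜 := ℝ)).comp_left (g := (InnerProductSpace.toDual ℝ F).symm) (by simp)

theorem tsupport_gradient_subset (f : F → ℝ) : tsupport (∇ f) ⊆ tsupport f := by
  refine (closure_mono ?_).trans (tsupport_fderiv_subset ℝ (f := f))
  intro x hx
  simp only [Function.mem_support, gradient] at hx ⊢
  intro h
  simp [h] at hx

theorem memLp_of_compactSupport {E : Type*} [NormedAddCommGroup E] {g : F → E}
    (hg : Continuous g) (hc : HasCompactSupport g) (Ω : Set F) :
    MemLp g 2 (volume.restrict Ω) :=
  (hg.memLp_of_hasCompactSupport hc).restrict Ω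

theorem IsTest.memLp {S : Set F} {f : F → ℝ} (h : IsTest S f) (Ω : Set F) :
    MemLp f 2 (volume.restrict Ω) :=
  memLp_of_compactSupport h.contDiff.continuous h.compact Ω

theorem IsTest.continuous_gradient {S : Set F} {f : F → ℝ} (h : IsTest S f) :
    Continuous (∇ f) := MixedCylinder.continuous_gradient (h.contDiff.of_le (by simp))

theorem IsTest.memLp_gradient {S : Set F} {f : F → ℝ} (h : IsTest S f) (Ω : Set F) :
    MemLp (∇ f) 2 (volume.restrict Ω) :=
  memLp_of_compactSupport h.continuous_gradient (hasCompactSupport_gradient h.compact) Ω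

/-- Integration by parts of a `C¹` function against a test function. -/
theorem integral_smul_gradient {Ω : Set F} {f ψ : F → ℝ} (hf : ContDiff ℝ 1 f)
    (hψ : ContDiff ℝ 1 ψ) (hc : HasCompactSupport ψ) (hs : tsupport ψ ⊆ Ω) :
    ∫ x in Ω, f x • ∇ ψ x = -∫ x in Ω, ψ x • ∇ f x := by
  have e1 : ∫ x in Ω, f x • ∇ ψ x = ∫ x, f x • ∇ ψ x := by
    refine setIntegral_eq_integral_of_forall_compl_eq_zero fun x hx => ?_
    have : ∇ ψ x = 0 := image_eq_zero_of_notMem_tsupport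
      fun h => hx (hs (tsupport_gradient_subset ψ h))
    simp [this]
  have e2 : ∫ x in Ω, ψ x • ∇ f x = ∫ x, ψ x • ∇ f x := by
    refine setIntegral_eq_integral_of_forall_compl_eq_zero fun x hx => ?_
    have : ψ x = 0 := image_eq_zero_of_notMem_tsupport fun h => hx (hs h)
    simp [this]
  have i1 : Integrable (fun x => f x • ∇ ψ x) :=
    (hf.continuous.smul (continuous_gradient hψ)).integrable_of_hasCompactSupport
      ((hasCompactSupport_gradient hc).smul_left)
  have i2 : Integrable (fun x => ψ x • ∇ f x) :=
    (hψ.continuous.smul (continuous_gradient hf)).integrable_of_hasCompactSupport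
      (hc.smul_right)
  rw [e1, e2]
  refine ext_inner_left ℝ fun v => ?_
  rw [inner_neg_right, ← integral_inner i1, ← integral_inner i2]
  simp only [real_inner_smul_right, inner_gradient_right]
  have := integral_mul_fderiv_eq_neg_fderiv_mul_of_integrable (μ := (volume : Measure F))
    (f := f) (g := ψ) (v := v) ?_ ?_ ?_
    (fun x _ => (hf.differentiable one_ne_zero) x) (fun x _ => (hψ.differentiable one_ne_zero) x)
  · rw [this]; simp only [mul_comm]
  · have := i2.inner_const (𝕜 := ℝ) v
    simpa [real_inner_smul_left, inner_gradient_left, mul_comm] using this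
  · have := i1.inner_const (𝕜 := ℝ) v
    simpa [real_inner_smul_left, inner_gradient_left] using this
  · exact (hf.continuous.mul hψ.continuous).integrable_of_hasCompactSupport hc.mul_left

end Sobolev

/-! ### The Hilbert space of functions vanishing on part of the boundary -/

theorem integrable_smul_of_memLp {α E : Type*} [MeasurableSpace α] {ν : Measure α}
    [NormedAddCommGroup E] [NormedSpace ℝ E] {f : α → ℝ} {g : α → E} (hf : MemLp f 2 ν)
    (hg : MemLp g 2 ν) : Integrable (fun x => f x • g x) ν :=
  memLp_one_iff_integrable.1 (hg.smul hf)

section Sobolev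

variable {F : Type*} [NormedAddCommGroup F] [InnerProductSpace ℝ F] [FiniteDimensional ℝ F]
  [CompleteSpace F] [MeasurableSpace F] [BorelSpace F]

theorem gradient_add {f g : F → ℝ} {x : F} (hf : DifferentiableAt ℝ f x)
    (hg : DifferentiableAt ℝ g x) : ∇ (f + g) x = ∇ f x + ∇ g x := by
  simp [gradient, fderiv_add hf hg]

theorem gradient_const_smul {f : F → ℝ} {x : F} (c : ℝ) (hf : DifferentiableAt ℝ f x) :
    ∇ (c • f) x = c • ∇ f x := by
  simp [gradient, fderiv_const_smul hf]

theorem gradient_mul {f g : F → ℝ} {x : F} (hf : DifferentiableAt ℝ f x)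
    (hg : DifferentiableAt ℝ g x) :
    ∇ (fun y => f y * g y) x = f x • ∇ g x + g x • ∇ f x := by
  simp [gradient, fderiv_fun_mul hf hg]

theorem IsTest.zero {S : Set F} : IsTest S (0 : F → ℝ) where
  contDiff := contDiff_const
  compact := HasCompactSupport.zero
  disj := by simp [tsupport]

theorem IsTest.add {S : Set F} {f g : F → ℝ} (hf : IsTest S f) (hg : IsTest S g) :
    IsTest S (f + g) where
  contDiff := hf.contDiff.add hg.contDiff
  compact := hf.compact.add hg.compact
  disj := (hf.disj.union_left hg.disj).mono_left
    (tsupport_add f g)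

theorem IsTest.const_smul {S : Set F} {f : F → ℝ} (hf : IsTest S f) (c : ℝ) :
    IsTest S (c • f) where
  contDiff := hf.contDiff.const_smul c
  compact := hf.compact.smul_left (f := fun _ => c)
  disj := hf.disj.mono_left (closure_mono fun x hx => by
    simp only [Function.mem_support, Pi.smul_apply] at hx ⊢
    intro h; simp [h] at hx)

theorem IsTest.differentiable {S : Set F} {f : F → ℝ} (hf : IsTest S f) : Differentiable ℝ f :=
  hf.contDiff.differentiable (by simp)

/-- The Hilbert space of pairs (function, vector field) of class `L²` on `Ω`; `H¹(Ω)` embeds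
isometrically by `u ↦ (u, ∇u)`. -/
abbrev PairSpace (Ω : Set F) : Type _ :=
  WithLp 2 (Lp ℝ 2 (volume.restrict Ω) × Lp F 2 (volume.restrict Ω))

/-- The pair of classes of `u` and `G` in `L²`. -/
noncomputable def toPair {Ω : Set F} {u : F → ℝ} {G : F → F} (hu : MemLp u 2 (volume.restrict Ω))
    (hG : MemLp G 2 (volume.restrict Ω)) : PairSpace Ω :=
  WithLp.toLp 2 (hu.toLp u, hG.toLp G)

/-- The pairs `(f, ∇f)` for test functions `f`. -/
def testPairs (Ω S : Set F) : Submodule ℝ (PairSpace Ω) where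
  carrier := {p | ∃ f, ∃ hf : IsTest S f, p = toPair (hf.memLp Ω) (hf.memLp_gradient Ω)}
  zero_mem' := by
    refine ⟨0, IsTest.zero, ?_⟩
    have h : ∇ (0 : F → ℝ) = 0 := by ext1 x; simp [gradient]
    simp only [toPair, h]
    rfl
  add_mem' := by
    rintro p q ⟨f, hf, rfl⟩ ⟨g, hg, rfl⟩
    refine ⟨f + g, hf.add hg, ?_⟩
    have h : ∇ (f + g) = ∇ f + ∇ g := by
      ext1 x; exact gradient_add (hf.differentiable x) (hg.differentiable x)
    simp only [toPair, h]
    rfl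
  smul_mem' := by
    rintro c p ⟨f, hf, rfl⟩
    refine ⟨c • f, hf.const_smul c, ?_⟩
    have h : ∇ (c • f) = c • ∇ f := by
      ext1 x; exact gradient_const_smul c (hf.differentiable x)
    simp only [toPair, h]
    rfl

/-- The closed subspace of `PairSpace Ω` formed by the functions of `H¹(Ω)` that vanish on `S`,
paired with their weak gradients. -/
noncomputable def zeroSpace (Ω S : Set F) : Submodule ℝ (PairSpace Ω) :=
  (testPairs Ω S).topologicalClosure

noncomputable instance (Ω S : Set F) : CompleteSpace (zeroSpace Ω S) :=
  Submodule.topologicalClosure.completeSpace _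

theorem tendsto_toPair {Ω : Set F} {f : ℕ → F → ℝ} {f' : ℕ → F → F} {u : F → ℝ} {G : F → F}
    (hf : ∀ k, MemLp (f k) 2 (volume.restrict Ω)) (hf' : ∀ k, MemLp (f' k) 2 (volume.restrict Ω))
    (hu : MemLp u 2 (volume.restrict Ω)) (hG : MemLp G 2 (volume.restrict Ω)) :
    Tendsto (fun k => toPair (hf k) (hf' k)) atTop (𝓝 (toPair hu hG)) ↔
      L2Tendsto (volume.restrict Ω) f u ∧ L2Tendsto (volume.restrict Ω) f' G := by
  have h1 := Lp.tendsto_Lp_iff_tendsto_eLpNorm'' (fi := atTop) f hf u hu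
  have h2 := Lp.tendsto_Lp_iff_tendsto_eLpNorm'' (fi := atTop) f' hf' G hG
  unfold L2Tendsto
  refine Iff.trans ?_ (and_congr h1 h2)
  constructor
  · intro h
    exact ⟨((WithLp.prod_continuous_ofLp 2 _ _).fst.tendsto _).comp h,
      ((WithLp.prod_continuous_ofLp 2 _ _).snd.tendsto _).comp h⟩
  · rintro ⟨h, h'⟩
    exact ((WithLp.prod_continuous_toLp 2 _ _).tendsto _).comp (h.prodMk_nhds h')

/-- Weak gradients pass to the limit in `L²`. -/
theorem weak_grad_of_tendsto {Ω S : Set F} {f : ℕ → F → ℝ} {u : F → ℝ} {G : F → F}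
    (hf : ∀ k, IsTest S (f k))
    (hu : MemLp u 2 (volume.restrict Ω)) (hG : MemLp G 2 (volume.restrict Ω))
    (h1 : L2Tendsto (volume.restrict Ω) f u)
    (h2 : L2Tendsto (volume.restrict Ω) (fun k => ∇ (f k)) G) {ψ : F → ℝ}
    (hψ : ContDiff ℝ 1 ψ) (hc : HasCompactSupport ψ) (hs : tsupport ψ ⊆ Ω) :
    ∫ x in Ω, u x • ∇ ψ x = -∫ x in Ω, ψ x • G x := by
  have mψ : MemLp ψ 2 (volume.restrict Ω) := memLp_of_compactSupport hψ.continuous hc Ω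
  have mψ' : MemLp (∇ ψ) 2 (volume.restrict Ω) :=
    memLp_of_compactSupport (continuous_gradient hψ) (hasCompactSupport_gradient hc) Ω
  refine ext_inner_left ℝ fun v => ?_
  have i1 : Integrable (fun x => u x • ∇ ψ x) (volume.restrict Ω) := by
    exact integrable_smul_of_memLp hu mψ'
  have i2 : Integrable (fun x => ψ x • G x) (volume.restrict Ω) := integrable_smul_of_memLp mψ hG
  rw [inner_neg_right, ← integral_inner i1, ← integral_inner i2]
  simp only [real_inner_smul_right]
  have mv : MemLp (fun x => ⟪v, ∇ ψ x⟫) 2 (volume.restrict Ω) := mψ'.const_inner v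
  have t1 := h1.integral_mul (l2Tendsto_const _) (fun k => (hf k).memLp Ω) hu (fun _ => mv) mv
  have mψv : MemLp (fun x => ψ x • v) 2 (volume.restrict Ω) :=
    memLp_of_compactSupport (hψ.continuous.smul continuous_const) (hc.smul_right) Ω
  have t2 := (l2Tendsto_const (ν := volume.restrict Ω) (fun x => ψ x • v)).integral_inner h2
    (fun _ => mψv) mψv (fun k => (hf k).memLp_gradient Ω) hG
  simp only [real_inner_smul_left] at t2
  refine tendsto_nhds_unique t1 (t2.neg.congr fun k => ?_)
  have hk := integral_smul_gradient ((hf k).contDiff.of_le (by simp)) hψ hc hs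
  have hk' := congrArg (fun w => ⟪v, w⟫) hk
  have j1 : Integrable (fun x => f k x • ∇ ψ x) (volume.restrict Ω) :=
    integrable_smul_of_memLp ((hf k).memLp Ω) mψ'
  have j2 : Integrable (fun x => ψ x • ∇ (f k) x) (volume.restrict Ω) :=
    integrable_smul_of_memLp mψ ((hf k).memLp_gradient Ω)
  rw [inner_neg_right, ← integral_inner j1, ← integral_inner j2] at hk'
  simp only [real_inner_smul_right] at hk'
  exact hk'.symm

theorem isH1Zero_of_tendsto {Ω S : Set F} {f : ℕ → F → ℝ} {u : F → ℝ} {G : F → F}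
    (hf : ∀ k, IsTest S (f k))
    (hu : MemLp u 2 (volume.restrict Ω)) (hG : MemLp G 2 (volume.restrict Ω))
    (h1 : L2Tendsto (volume.restrict Ω) f u)
    (h2 : L2Tendsto (volume.restrict Ω) (fun k => ∇ (f k)) G) : IsH1Zero Ω S u G where
  memLp := hu
  memLp_grad := hG
  weak_grad ψ hψ hc hs := weak_grad_of_tendsto hf hu hG h1 h2 (hψ.of_le (by simp)) hc hs
  approx := ⟨f, fun k => ⟨(hf k).contDiff, (hf k).compact, (hf k).disj⟩, h1, h2⟩

theorem IsH1Zero.exists_tendsto {Ω S : Set F} {u : F → ℝ} {G : F → F} (h : IsH1Zero Ω S u G) :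
    ∃ f : ℕ → F → ℝ, (∀ k, IsTest S (f k)) ∧ L2Tendsto (volume.restrict Ω) f u ∧
      L2Tendsto (volume.restrict Ω) (fun k => ∇ (f k)) G := by
  obtain ⟨f, hf, h1, h2⟩ := h.approx
  exact ⟨f, fun k => ⟨(hf k).1, (hf k).2.1, (hf k).2.2⟩, h1, h2⟩

theorem IsTest.isH1Zero {S : Set F} {f : F → ℝ} (hf : IsTest S f) (Ω : Set F) :
    IsH1Zero Ω S f (∇ f) :=
  isH1Zero_of_tendsto (fun _ => hf) (hf.memLp Ω) (hf.memLp_gradient Ω) (l2Tendsto_const _)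
    (l2Tendsto_const _)

theorem toPair_mem_zeroSpace {Ω S : Set F} {u : F → ℝ} {G : F → F}
    (hu : MemLp u 2 (volume.restrict Ω)) (hG : MemLp G 2 (volume.restrict Ω)) :
    toPair hu hG ∈ zeroSpace Ω S ↔ IsH1Zero Ω S u G := by
  constructor
  · intro h
    obtain ⟨p, hp, hlim⟩ := mem_closure_iff_seq_limit.1 h
    choose f hf hpf using hp
    rw [funext hpf, tendsto_toPair] at hlim
    exact isH1Zero_of_tendsto hf hu hG hlim.1 hlim.2
  · intro h
    obtain ⟨f, hf, h1, h2⟩ := h.exists_tendsto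
    refine mem_closure_iff_seq_limit.2 ⟨_, fun k => ⟨f k, hf k, rfl⟩, ?_⟩
    exact (tendsto_toPair _ _ hu hG).2 ⟨h1, h2⟩

theorem toPair_coeFn {Ω : Set F} (p : PairSpace Ω) :
    toPair (Lp.memLp p.fst) (Lp.memLp p.snd) = p := by
  simp only [toPair, Lp.toLp_coeFn]
  rfl

/-- The function component on `zeroSpace Ω S`. -/
noncomputable def zeroSpace.val (Ω S : Set F) :
    zeroSpace Ω S →L[ℝ] Lp ℝ 2 ((volume : Measure F).restrict Ω) :=
  (WithLp.fstL 2 ℝ _ _).comp (zeroSpace Ω S).subtypeL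

/-- The gradient component on `zeroSpace Ω S`. -/
noncomputable def zeroSpace.grad (Ω S : Set F) :
    zeroSpace Ω S →L[ℝ] Lp F 2 ((volume : Measure F).restrict Ω) :=
  (WithLp.sndL 2 ℝ _ _).comp (zeroSpace Ω S).subtypeL

theorem zeroSpace.norm_sq {Ω S : Set F} (v : zeroSpace Ω S) :
    ‖v‖ ^ 2 = ‖val Ω S v‖ ^ 2 + ‖grad Ω S v‖ ^ 2 :=
  WithLp.prod_norm_sq_eq_of_L2 (v : PairSpace Ω)

/-- A closed condition on `H¹(Ω)` functions vanishing on `S` holds if it holds for the test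
functions. -/
theorem zeroSpace.induction {Ω S : Set F} {P : zeroSpace Ω S → Prop} (hP : IsClosed {v | P v})
    (h : ∀ f (hf : IsTest S f), P ⟨toPair (hf.memLp Ω) (hf.memLp_gradient Ω),
      (toPair_mem_zeroSpace _ _).2 (hf.isH1Zero Ω)⟩) (v : zeroSpace Ω S) : P v := by
  obtain ⟨v, hv⟩ := v
  obtain ⟨p, hp, hlim⟩ := mem_closure_iff_seq_limit.1 hv
  have hmem : ∀ k, p k ∈ zeroSpace Ω S := fun k => (testPairs Ω S).le_topologicalClosure (hp k)
  refine hP.mem_of_tendsto (f := fun k => (⟨p k, hmem k⟩ : zeroSpace Ω S)) (b := atTop)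
    (tendsto_subtype_rng.2 hlim) (Eventually.of_forall fun k => ?_)
  obtain ⟨f, hf, hpf⟩ := hp k
  have := h f hf
  simp only [← hpf] at this
  exact this

/-- Existence of an eigenvalue below `μ`: it is enough that, on test functions, the Dirichlet form
dominates `μ` times the `L²` form up to finitely many squared linear functionals, represented by
the functions `w i`, and that some test function has a Rayleigh quotient below `μ`. -/
theorem exists_eigenvalue_lt {Ω S : Set F} {μ : ℝ} {ι : Type*} [Fintype ι] (w : ι → F → ℝ)
    (hw : ∀ i, MemLp (w i) 2 (volume.restrict Ω))
    (hineq : ∀ f, IsTest S f → μ * ∫ x in Ω, f x ^ 2 ≤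
      (∫ x in Ω, ‖∇ f x‖ ^ 2) + ∑ i, (∫ x in Ω, w i x * f x) ^ 2)
    (hlt : ∃ f, IsTest S f ∧ ∫ x in Ω, ‖∇ f x‖ ^ 2 < μ * ∫ x in Ω, f x ^ 2) :
    ∃ c < μ, IsEigenvalue Ω S c := by
  classical
  set J := zeroSpace.val Ω S
  set A := zeroSpace.grad Ω S
  set T : zeroSpace Ω S →L[ℝ] EuclideanSpace ℝ ι :=
    (EuclideanSpace.equiv ι ℝ).symm.toContinuousLinearMap.comp
      (ContinuousLinearMap.pi fun i => (innerSL ℝ ((hw i).toLp (w i))).comp J) with hTdef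
  have hTv : ∀ v, ‖T v‖ ^ 2 = ∑ i, ⟪(hw i).toLp (w i), J v⟫ ^ 2 := by
    intro v
    rw [EuclideanSpace.real_norm_sq_eq]
    rfl
  have hsq : ∀ f (hf : IsTest S f), ‖(hf.memLp Ω).toLp f‖ ^ 2 = ∫ x in Ω, f x ^ 2 := by
    intro f hf
    rw [norm_sq_toLp]
    simp
  have hT : ∀ v, μ * ‖J v‖ ^ 2 ≤ ‖A v‖ ^ 2 + ‖T v‖ ^ 2 := by
    intro v
    refine zeroSpace.induction (P := fun v => μ * ‖J v‖ ^ 2 ≤ ‖A v‖ ^ 2 + ‖T v‖ ^ 2)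
      (isClosed_le (by fun_prop) (by fun_prop)) (fun f hf => ?_) v
    change μ * ‖(hf.memLp Ω).toLp f‖ ^ 2 ≤ ‖(hf.memLp_gradient Ω).toLp (∇ f)‖ ^ 2 + _
    rw [hTv, hsq f hf, norm_sq_toLp]
    refine (hineq f hf).trans_eq ?_
    congr 1
    refine Finset.sum_congr (M := ℝ) rfl fun i _ => ?_
    change _ = ⟪(hw i).toLp (w i), (hf.memLp Ω).toLp f⟫ ^ 2
    rw [inner_toLp]
    simp [mul_comm]
  obtain ⟨f, hf, hflt⟩ := hlt
  obtain ⟨c, hc, v, hv0, hv⟩ := exists_eigenvector_of_finite_rank J A T zeroSpace.norm_sq hT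
    ⟨⟨toPair (hf.memLp Ω) (hf.memLp_gradient Ω),
      (toPair_mem_zeroSpace _ _).2 (hf.isH1Zero Ω)⟩, by
      change ‖(hf.memLp_gradient Ω).toLp (∇ f)‖ ^ 2 < μ * ‖(hf.memLp Ω).toLp f‖ ^ 2
      rwa [hsq f hf, norm_sq_toLp]⟩
  refine ⟨c, hc, _, _, ⟨(toPair_mem_zeroSpace (Lp.memLp (J v)) (Lp.memLp (A v))).1 ?_, ?_, ?_⟩⟩
  · change toPair (Lp.memLp (v : PairSpace Ω).fst) (Lp.memLp (v : PairSpace Ω).snd) ∈ _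
    rw [toPair_coeFn]
    exact v.2
  -- a vector with `J v = 0` has `A v = 0` by its equation, so it is zero
  · intro h0
    have hJ : J v = 0 := (Lp.eq_zero_iff_ae_eq_zero).2 h0
    have hA : ‖A v‖ ^ 2 = 0 := by
      rw [← real_inner_self_eq_norm_sq, hv v, hJ]
      simp
    have hn := zeroSpace.norm_sq v
    change ‖v‖ ^ 2 = ‖J v‖ ^ 2 + ‖A v‖ ^ 2 at hn
    rw [hA, hJ] at hn
    simp at hn
    exact hv0 hn
  · intro u G hu
    have hmem := (toPair_mem_zeroSpace hu.memLp hu.memLp_grad).2 hu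
    have := hv ⟨_, hmem⟩
    change ⟪A v, hu.memLp_grad.toLp G⟫ = c * ⟪J v, hu.memLp.toLp u⟫ at this
    rw [L2.inner_def, L2.inner_def] at this
    convert this using 1
    · refine integral_congr_ae ?_
      filter_upwards [hu.memLp_grad.coeFn_toLp] with x hx
      rw [hx]
    · congr 1
      refine integral_congr_ae ?_
      filter_upwards [hu.memLp.coeFn_toLp] with x hx
      rw [hx]
      simp [mul_comm]

end Sobolev

/-! ### Translations and a Poincaré inequality on small cubes -/

section Cells

variable {F : Type*} [NormedAddCommGroup F] [InnerProductSpace ℝ F] [FiniteDimensional ℝ F]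
  [CompleteSpace F] [MeasurableSpace F] [BorelSpace F]

theorem lintegral_Ioc_sq_le {k : ℝ → ℝ≥0∞} (hk : Measurable k) :
    (∫⁻ s in Ioc (0 : ℝ) 1, k s) ^ 2 ≤ ∫⁻ s in Ioc (0 : ℝ) 1, k s ^ 2 := by
  have h := ENNReal.lintegral_mul_le_Lp_mul_Lq (volume.restrict (Ioc (0 : ℝ) 1))
    Real.HolderConjugate.two_two hk.aemeasurable (aemeasurable_const (b := (1 : ℝ≥0∞)))
  simp only [Pi.mul_apply, mul_one, ENNReal.one_rpow, lintegral_const, Measure.restrict_apply_univ,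
    Real.volume_Ioc, sub_zero, ENNReal.ofReal_one, one_div] at h
  calc (∫⁻ s in Ioc (0 : ℝ) 1, k s) ^ 2
      ≤ ((∫⁻ s in Ioc (0 : ℝ) 1, k s ^ (2 : ℝ)) ^ (2 : ℝ)⁻¹) ^ 2 := by gcongr
    _ = _ := by
      rw [← ENNReal.rpow_natCast, ← ENNReal.rpow_mul]
      simp

/-- The `L²` modulus of continuity of a `C¹` function is controlled by its gradient. Only the
translations that keep the points of `Ω` in `Ω` are used. -/
theorem lintegral_translate_sub_sq_le {Ω : Set F} (hΩ : MeasurableSet Ω) {f : F → ℝ} {z : F}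
    (hz : ∀ x ∈ Ω, ∀ s ∈ Icc (0 : ℝ) 1, x + s • z ∈ Ω) (hf : ∀ x ∈ Ω, ContDiffAt ℝ 1 f x) :
    ∫⁻ x in Ω, ‖f (x + z) - f x‖ₑ ^ 2 ≤ ‖z‖ₑ ^ 2 * ∫⁻ x in Ω, ‖fderiv ℝ f x‖ₑ ^ 2 := by
  set κ : F → ℝ≥0∞ := fun x => ‖fderiv ℝ f x‖ₑ ^ 2 with hκ
  have hκm : Measurable κ := ((measurable_fderiv ℝ f).enorm).pow_const 2
  have hpt : ∀ x ∈ Ω, ‖f (x + z) - f x‖ₑ ^ 2 ≤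
      ∫⁻ s in Ioc (0 : ℝ) 1, ‖z‖ₑ ^ 2 * κ (x + s • z) := by
    intro x hx
    have hd : ∀ s ∈ uIcc (0 : ℝ) 1,
        HasDerivAt (fun s : ℝ => f (x + s • z)) (fderiv ℝ f (x + s • z) z) s := by
      intro s hs
      rw [uIcc_of_le zero_le_one] at hs
      have h1 : HasFDerivAt f (fderiv ℝ f (x + s • z)) (x + s • z) :=
        ((hf _ (hz x hx s hs)).differentiableAt one_ne_zero).hasFDerivAt
      have h2 : HasDerivAt (fun s : ℝ => x + s • z) z s := by
        simpa using ((hasDerivAt_id s).smul_const z).const_add x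
      exact h1.comp_hasDerivAt s h2
    have hcont : ContinuousOn (fun s : ℝ => fderiv ℝ f (x + s • z) z) (uIcc (0 : ℝ) 1) := by
      intro s hs
      rw [uIcc_of_le zero_le_one] at hs
      have h1 : ContinuousAt (fderiv ℝ f) (x + s • z) :=
        ((hf _ (hz x hx s hs)).fderiv_right (m := 0) (by simp)).continuousAt
      have h2 : ContinuousAt (fun s : ℝ => x + s • z) s := by fun_prop
      have h3 : ContinuousAt (fun s : ℝ => fderiv ℝ f (x + s • z)) s :=
        ContinuousAt.comp (f := fun s : ℝ => x + s • z) h1 h2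
      exact (h3.clm_apply continuousAt_const).continuousWithinAt
    have hftc := intervalIntegral.integral_eq_sub_of_hasDerivAt hd hcont.intervalIntegrable
    simp only [one_smul, zero_smul, add_zero] at hftc
    rw [← hftc, intervalIntegral.integral_of_le zero_le_one]
    calc ‖∫ s in Ioc (0 : ℝ) 1, fderiv ℝ f (x + s • z) z‖ₑ ^ 2
        ≤ (∫⁻ s in Ioc (0 : ℝ) 1, ‖fderiv ℝ f (x + s • z) z‖ₑ) ^ 2 := by
          gcongr; exact enorm_integral_le_lintegral_enorm _
      _ ≤ ∫⁻ s in Ioc (0 : ℝ) 1, ‖fderiv ℝ f (x + s • z) z‖ₑ ^ 2 := by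
          refine lintegral_Ioc_sq_le ?_
          have h1 : Measurable fun s : ℝ => x + s • z := by fun_prop
          exact ((measurable_fderiv_apply_const ℝ f z).comp h1).enorm
      _ ≤ _ := by
          refine lintegral_mono fun s => ?_
          simp only [hκ]
          rw [← mul_pow, mul_comm]
          gcongr
          exact ContinuousLinearMap.le_opENorm _ _
  have hm : Measurable fun p : F × ℝ => κ (p.1 + p.2 • z) := hκm.comp (by fun_prop)
  have hs : ∀ s ∈ Ioc (0 : ℝ) 1, ∫⁻ x in Ω, κ (x + s • z) ≤ ∫⁻ x in Ω, κ x := by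
    intro s hs
    rw [← lintegral_indicator hΩ, ← lintegral_indicator hΩ,
      ← lintegral_add_right_eq_self (Ω.indicator κ) (s • z)]
    refine lintegral_mono fun x => ?_
    by_cases hx : x ∈ Ω
    · simp [hx, hz x hx s ⟨hs.1.le, hs.2⟩]
    · simp [hx]
  calc ∫⁻ x in Ω, ‖f (x + z) - f x‖ₑ ^ 2
      ≤ ∫⁻ x in Ω, ∫⁻ s in Ioc (0 : ℝ) 1, ‖z‖ₑ ^ 2 * κ (x + s • z) :=
        setLIntegral_mono' hΩ hpt
    _ = ∫⁻ s in Ioc (0 : ℝ) 1, ∫⁻ x in Ω, ‖z‖ₑ ^ 2 * κ (x + s • z) :=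
        lintegral_lintegral_swap (hm.const_mul _).aemeasurable
    _ ≤ ∫⁻ s in Ioc (0 : ℝ) 1, ‖z‖ₑ ^ 2 * ∫⁻ x in Ω, κ x := by
        refine setLIntegral_mono' measurableSet_Ioc fun s hs' => ?_
        have hκs : Measurable fun x : F => κ (x + s • z) := hκm.comp (by fun_prop)
        rw [lintegral_const_mul _ hκs]
        exact mul_le_mul' le_rfl (hs s hs')
    _ = _ := by simp

/-- The sum of squares of the differences over all pairs of points measures the variance. -/
theorem lintegral_sq_eq_mean_add {E : Set F} {m : ℝ} (hm : 0 < m)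
    (hE : volume E = ENNReal.ofReal m) {f : F → ℝ} (hf : MemLp f 2 (volume.restrict E)) :
    ∫⁻ x in E, ‖f x‖ₑ ^ 2 = ENNReal.ofReal ((∫ x in E, f x) ^ 2 / m) +
      ENNReal.ofReal (1 / (2 * m)) * ∫⁻ x in E, ∫⁻ y in E, ‖f y - f x‖ₑ ^ 2 := by
  have hE' : IsFiniteMeasure (volume.restrict E) := ⟨by simp [hE]⟩
  have hreal : volume.real E = m := by simp [Measure.real, hE, hm.le]
  have hen : ∀ t : ℝ, ‖t‖ₑ ^ 2 = ENNReal.ofReal (t ^ 2) := by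
    intro t
    rw [Real.enorm_eq_ofReal_abs, ← ENNReal.ofReal_pow (abs_nonneg _), sq_abs]
  have i1 : Integrable f (volume.restrict E) := hf.integrable one_le_two
  have i2 : Integrable (fun x => f x ^ 2) (volume.restrict E) := hf.integrable_sq
  set I := ∫ x in E, f x with hI
  set Q := ∫ x in E, f x ^ 2 with hQ
  simp only [hen]
  have inner' : ∀ x, ∫ y in E, (f y - f x) ^ 2 = Q - 2 * f x * I + m * f x ^ 2 ∧
      Integrable (fun y => (f y - f x) ^ 2) (volume.restrict E) := by
    intro x
    have e : (fun y => (f y - f x) ^ 2) = fun y => f y ^ 2 - 2 * f x * f y + f x ^ 2 := by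
      ext y; ring
    have i3 : Integrable (fun y => f y ^ 2 - 2 * f x * f y) (volume.restrict E) :=
      i2.sub (i1.const_mul _)
    rw [e]
    refine ⟨?_, i3.add (integrable_const _)⟩
    rw [integral_add i3 (integrable_const _), integral_sub i2 (i1.const_mul _),
      integral_const_mul, integral_const, smul_eq_mul]
    simp [hreal, hQ, hI]
  have inner : ∀ x, ∫⁻ y in E, ENNReal.ofReal ((f y - f x) ^ 2) =
      ENNReal.ofReal (Q - 2 * f x * I + m * f x ^ 2) := by
    intro x
    rw [← ofReal_integral_eq_lintegral_ofReal (inner' x).2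
      (Eventually.of_forall fun y => sq_nonneg _), (inner' x).1]
  have hnn : ∀ x, 0 ≤ Q - 2 * f x * I + m * f x ^ 2 := fun x => by
    rw [← (inner' x).1]
    exact integral_nonneg fun y => sq_nonneg _
  have i4 : Integrable (fun x => Q - 2 * f x * I) (volume.restrict E) := by
    have : (fun x => Q - 2 * f x * I) = fun x => Q - (2 * I) * f x := by ext x; ring
    rw [this]
    exact (integrable_const _).sub (i1.const_mul _)
  have i5 : Integrable (fun x => Q - 2 * f x * I + m * f x ^ 2) (volume.restrict E) :=
    i4.add (i2.const_mul m)
  have e2 : ∫ x in E, (Q - 2 * f x * I + m * f x ^ 2) = m * Q - 2 * I * I + m * Q := by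
    have : (fun x => Q - 2 * f x * I) = fun x => Q - (2 * I) * f x := by ext x; ring
    rw [integral_add i4 (i2.const_mul m), this,
      integral_sub (integrable_const _) (i1.const_mul _), integral_const_mul,
      integral_const_mul, integral_const, ← hQ, ← hI]
    simp [hreal]
  have e3 : 0 ≤ m * Q - 2 * I * I + m * Q := e2 ▸ integral_nonneg hnn
  simp only [inner]
  rw [← ofReal_integral_eq_lintegral_ofReal i2 (Eventually.of_forall fun y => sq_nonneg _),
    ← ofReal_integral_eq_lintegral_ofReal i5 (Eventually.of_forall hnn), e2,
    ← ENNReal.ofReal_mul (by positivity), ← ENNReal.ofReal_add (by positivity) (by positivity)]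
  congr 1
  field_simp
  ring

/-- Poincaré's inequality summed over disjoint sets `E k ⊆ Ω`, each of measure `m`, whose
difference sets lie in `B`. A pair of points of `E k` enters only through the translation in the
set `C` of directions, so `Ω` may be a half-space. -/
theorem lintegral_sq_le_sum_mean {ι : Type*} (K : Finset ι) {E : ι → Set F} {Ω B C : Set F}
    (hEm : ∀ k, MeasurableSet (E k)) (hdisj : Pairwise (Function.onFun Disjoint E))
    (hEΩ : ∀ k ∈ K, E k ⊆ Ω) (hΩ : MeasurableSet Ω) (hC : MeasurableSet C) (hB : MeasurableSet B)
    {m r : ℝ} (hm : 0 < m) (hvol : ∀ k ∈ K, volume (E k) = ENNReal.ofReal m)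
    (hEB : ∀ k, ∀ x ∈ E k, ∀ y ∈ E k, y - x ∈ B) (hBr : ∀ z ∈ B, ‖z‖ ≤ r)
    (hCneg : ∀ z, z ∈ C ∨ -z ∈ C) (hCΩ : ∀ z ∈ C, ∀ x ∈ Ω, ∀ s ∈ Icc (0 : ℝ) 1, x + s • z ∈ Ω)
    {f : F → ℝ} (hfm : Measurable f) (hf : ∀ x ∈ Ω, ContDiffAt ℝ 1 f x)
    (hfL : ∀ k ∈ K, MemLp f 2 (volume.restrict (E k))) :
    ∫⁻ x in ⋃ k ∈ K, E k, ‖f x‖ₑ ^ 2 ≤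
      ∑ k ∈ K, ENNReal.ofReal ((∫ x in E k, f x) ^ 2 / m) +
        ENNReal.ofReal (1 / m) * (volume B * (ENNReal.ofReal r ^ 2 *
          ∫⁻ x in Ω, ‖fderiv ℝ f x‖ₑ ^ 2)) := by
  classical
  set D := ∫⁻ x in Ω, ‖fderiv ℝ f x‖ₑ ^ 2
  set q : F → F → ℝ≥0∞ := fun x y => ‖f y - f x‖ₑ ^ 2 with hq
  have hqm : Measurable fun p : F × F => q p.1 p.2 :=
    (((hfm.comp measurable_snd).sub (hfm.comp measurable_fst)).enorm).pow_const 2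
  -- of the two pairs `(x, y)` and `(y, x)`, at least one has its difference in `C`
  set χ : F → ℝ≥0∞ := C.indicator 1 with hχ
  have hχm : Measurable χ := measurable_one.indicator hC
  set t : F → F → ℝ≥0∞ := fun x y => χ (y - x) * q x y with ht
  have htm : Measurable fun p : F × F => t p.1 p.2 :=
    (hχm.comp (measurable_snd.sub measurable_fst)).mul hqm
  have hqt : ∀ x y, q x y ≤ t x y + t y x := by
    intro x y
    have hsymm : q y x = q x y := by
      simp only [hq]
      rw [← enorm_neg, neg_sub]
    simp only [ht, hχ]
    rcases hCneg (y - x) with h | h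
    · simp [h]
    · rw [neg_sub] at h
      simp [h, hsymm]
  have hpair : ∀ k ∈ K, ∫⁻ x in E k, ∫⁻ y in E k, q x y ≤
      2 * ∫⁻ x in E k, ∫⁻ z in C ∩ B, q x (x + z) := by
    intro k hk
    have h1 : ∫⁻ x in E k, ∫⁻ y in E k, q x y ≤ 2 * ∫⁻ x in E k, ∫⁻ y in E k, t x y := by
      calc ∫⁻ x in E k, ∫⁻ y in E k, q x y
          ≤ ∫⁻ x in E k, ∫⁻ y in E k, (t x y + t y x) :=
            lintegral_mono fun x => lintegral_mono fun y => hqt x y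
        _ = (∫⁻ x in E k, ∫⁻ y in E k, t x y) + ∫⁻ x in E k, ∫⁻ y in E k, t y x := by
            rw [← lintegral_add_left (Measurable.lintegral_prod_right htm)]
            refine lintegral_congr fun x => ?_
            exact lintegral_add_left (htm.comp measurable_prodMk_left) _
        _ = _ := by
            rw [lintegral_lintegral_swap (f := fun x y => t y x)
              (htm.comp measurable_swap).aemeasurable, two_mul]
    refine h1.trans ?_
    gcongr 2 * ?_
    refine setLIntegral_mono' (hEm k) fun x hx => ?_
    rw [← lintegral_indicator (hEm k), ← lintegral_indicator (hC.inter hB),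
      ← lintegral_add_left_eq_self _ x]
    refine lintegral_mono fun z => ?_
    by_cases h2 : x + z ∈ E k
    · have h3 : z ∈ B := by simpa using hEB k x hx _ h2
      by_cases h4 : z ∈ C
      · simp [h2, h3, h4, ht, hχ]
      · simp [h2, h4, ht, hχ]
    · simp [h2]
  have hsum : ∑ k ∈ K, ∫⁻ x in E k, ∫⁻ z in C ∩ B, q x (x + z) ≤
      volume B * (ENNReal.ofReal r ^ 2 * D) := by
    have hgm : Measurable fun p : F × F => q p.1 (p.1 + p.2) :=
      (((hfm.comp (measurable_fst.add measurable_snd)).sub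
        (hfm.comp measurable_fst)).enorm).pow_const 2
    rw [← lintegral_biUnion_finset (fun i _ j _ hij => hdisj hij) (fun k _ => hEm k)]
    calc ∫⁻ x in ⋃ k ∈ K, E k, ∫⁻ z in C ∩ B, q x (x + z)
        ≤ ∫⁻ x in Ω, ∫⁻ z in C ∩ B, q x (x + z) :=
          lintegral_mono_set (iUnion₂_subset hEΩ)
      _ = ∫⁻ z in C ∩ B, ∫⁻ x in Ω, q x (x + z) :=
          lintegral_lintegral_swap hgm.aemeasurable
      _ ≤ ∫⁻ z in C ∩ B, ENNReal.ofReal r ^ 2 * D := by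
          refine setLIntegral_mono' (hC.inter hB) fun z hz => ?_
          refine (lintegral_translate_sub_sq_le hΩ (hCΩ z hz.1) hf).trans ?_
          gcongr
          rw [← ofReal_norm]
          exact ENNReal.ofReal_le_ofReal (hBr z hz.2)
      _ ≤ ∫⁻ z in B, ENNReal.ofReal r ^ 2 * D := lintegral_mono_set inter_subset_right
      _ = _ := by simp [mul_comm]
  rw [lintegral_biUnion_finset (fun i _ j _ hij => hdisj hij) (fun k _ => hEm k)]
  calc ∑ k ∈ K, ∫⁻ x in E k, ‖f x‖ₑ ^ 2
      = ∑ k ∈ K, (ENNReal.ofReal ((∫ x in E k, f x) ^ 2 / m) +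
          ENNReal.ofReal (1 / (2 * m)) * ∫⁻ x in E k, ∫⁻ y in E k, q x y) :=
        Finset.sum_congr rfl fun k hk => lintegral_sq_eq_mean_add hm (hvol k hk) (hfL k hk)
    _ ≤ ∑ k ∈ K, (ENNReal.ofReal ((∫ x in E k, f x) ^ 2 / m) +
          ENNReal.ofReal (1 / (2 * m)) * (2 * ∫⁻ x in E k, ∫⁻ z in C ∩ B, q x (x + z))) := by
        refine Finset.sum_le_sum fun k hk => ?_
        gcongr
        exact hpair k hk
    _ = ∑ k ∈ K, ENNReal.ofReal ((∫ x in E k, f x) ^ 2 / m) +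
          ENNReal.ofReal (1 / m) * ∑ k ∈ K, ∫⁻ x in E k, ∫⁻ z in C ∩ B, q x (x + z) := by
        rw [Finset.sum_add_distrib, Finset.mul_sum]
        congr 1
        refine Finset.sum_congr rfl fun k _ => ?_
        rw [← mul_assoc]
        congr 1
        rw [show (2 : ℝ≥0∞) = ENNReal.ofReal 2 by simp, ← ENNReal.ofReal_mul (by positivity)]
        congr 1
        field_simp
    _ ≤ _ := by gcongr

variable {ι : Type*} [Fintype ι]

/-- The half-open cube with index `k` in the cubic grid of mesh `h` attached to an orthonormal
basis: its `i`-th coordinate ranges over `((k i - 1) h, k i h]`. -/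
def gridCube (b : OrthonormalBasis ι ℝ F) (h : ℝ) (k : ι → ℤ) : Set F :=
  {x | ∀ i, ⌈⟪b i, x⟫ / h⌉ = k i}

theorem measurableSet_gridCube (b : OrthonormalBasis ι ℝ F) (h : ℝ) (k : ι → ℤ) :
    MeasurableSet (gridCube b h k) := by
  have : gridCube b h k = ⋂ i, (fun x => ⌈⟪b i, x⟫ / h⌉) ⁻¹' {k i} := by
    ext x; simp [gridCube]
  rw [this]
  refine MeasurableSet.iInter fun i => ?_
  have : Measurable fun x : F => ⟪b i, x⟫ / h := by
    have : Continuous fun x : F => ⟪b i, x⟫ / h := by fun_prop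
    exact this.measurable
  exact (Int.measurable_ceil.comp this) (measurableSet_singleton _)

theorem pairwise_disjoint_gridCube (b : OrthonormalBasis ι ℝ F) (h : ℝ) :
    Pairwise (Function.onFun Disjoint (gridCube b h)) := by
  intro k l hkl
  refine Set.disjoint_left.2 fun x hk hl => hkl (funext fun i => ?_)
  rw [← hk i, ← hl i]

/-- The volume of a box with edges parallel to the vectors of an orthonormal basis. -/
theorem volume_box (b : OrthonormalBasis ι ℝ F) (s : ι → Set ℝ) (hs : ∀ i, MeasurableSet (s i)) :
    volume {x : F | ∀ i, ⟪b i, x⟫ ∈ s i} = ∏ i, volume (s i) := by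
  have h1 := (PiLp.volume_preserving_ofLp ι).comp b.measurePreserving_repr
  have h2 := h1.measure_preimage (MeasurableSet.univ_pi hs).nullMeasurableSet
  rw [volume_pi_pi] at h2
  rw [← h2]
  congr 1
  ext x
  simp [OrthonormalBasis.repr_apply_apply]

theorem volume_gridCube (b : OrthonormalBasis ι ℝ F) {h : ℝ} (hh : 0 < h) (k : ι → ℤ) :
    volume (gridCube b h k) = ENNReal.ofReal (h ^ Fintype.card ι) := by
  have : gridCube b h k = {x : F | ∀ i, ⟪b i, x⟫ ∈ Ioc (((k i : ℝ) - 1) * h) (k i * h)} := by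
    ext x
    simp only [gridCube, mem_ofPred_eq, mem_Ioc, Int.ceil_eq_iff, lt_div_iff₀ hh, div_le_iff₀ hh]
  rw [this, volume_box b _ fun i => measurableSet_Ioc]
  simp only [Real.volume_Ioc]
  have : ∀ i, (k i : ℝ) * h - (k i - 1) * h = h := fun i => by ring
  simp [this, ENNReal.ofReal_pow hh.le]

theorem sub_mem_of_mem_gridCube (b : OrthonormalBasis ι ℝ F) {h : ℝ} (hh : 0 < h) {k : ι → ℤ}
    {x y : F} (hx : x ∈ gridCube b h k) (hy : y ∈ gridCube b h k) (i : ι) :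
    ⟪b i, y - x⟫ ∈ Ioo (-h) h := by
  have h1 := hx i
  have h2 := hy i
  rw [Int.ceil_eq_iff, lt_div_iff₀ hh, div_le_iff₀ hh] at h1 h2
  rw [inner_sub_right]
  constructor <;> nlinarith

/-- A bounded set is covered by finitely many cubes of the grid. -/
theorem exists_finset_gridCube (b : OrthonormalBasis ι ℝ F) (h : ℝ) {D : Set F}
    (hD : Bornology.IsBounded D) :
    ∃ K : Finset (ι → ℤ), ∀ x ∈ D, (fun i => ⌈⟪b i, x⟫ / h⌉) ∈ K := by
  classical
  obtain ⟨R, hR⟩ := hD.exists_norm_le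
  refine ⟨Fintype.piFinset fun _ => Finset.Icc ⌈-(R / |h|)⌉ ⌈R / |h|⌉, fun x hx => ?_⟩
  simp only [Fintype.mem_piFinset, Finset.mem_Icc]
  intro i
  have h1 : |⟪b i, x⟫ / h| ≤ R / |h| := by
    rw [abs_div]
    gcongr
    refine (abs_real_inner_le_norm _ _).trans ?_
    simpa using hR x hx
  rw [abs_le] at h1
  exact ⟨Int.ceil_mono h1.1, Int.ceil_mono h1.2⟩

/-- Poincaré's inequality on a finite union of cubes of a grid. The cubes lie in a set `Ω` that is
stable under the translations of a half-space `C` of directions; the gradient is integrated over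
`Ω`, not over the cubes. -/
theorem lintegral_sq_le_gridCube (b : OrthonormalBasis ι ℝ F) {h : ℝ} (hh : 0 < h)
    (K : Finset (ι → ℤ)) {Ω C : Set F}
    (hEΩ : ∀ k ∈ K, gridCube b h k ⊆ Ω) (hΩ : MeasurableSet Ω) (hC : MeasurableSet C)
    (hCneg : ∀ z, z ∈ C ∨ -z ∈ C) (hCΩ : ∀ z ∈ C, ∀ x ∈ Ω, ∀ s ∈ Icc (0 : ℝ) 1, x + s • z ∈ Ω)
    {f : F → ℝ} (hfm : Measurable f) (hf : ∀ x ∈ Ω, ContDiffAt ℝ 1 f x)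
    (hfL : ∀ k ∈ K, MemLp f 2 (volume.restrict (gridCube b h k))) :
    ∫⁻ x in ⋃ k ∈ K, gridCube b h k, ‖f x‖ₑ ^ 2 ≤
      ∑ k ∈ K, ENNReal.ofReal ((∫ x in gridCube b h k, f x) ^ 2 / h ^ Fintype.card ι) +
        ENNReal.ofReal (2 ^ Fintype.card ι * (Fintype.card ι * h ^ 2)) *
          ∫⁻ x in Ω, ‖fderiv ℝ f x‖ₑ ^ 2 := by
  have hn : 0 ≤ (Fintype.card ι : ℝ) := Nat.cast_nonneg _
  set B : Set F := {z | ∀ i, ⟪b i, z⟫ ∈ Ioo (-h) h} with hB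
  have hvB : volume B = ENNReal.ofReal ((2 * h) ^ Fintype.card ι) := by
    rw [hB, volume_box b _ fun i => measurableSet_Ioo]
    simp only [Real.volume_Ioo, sub_neg_eq_add, Finset.prod_const, Finset.card_univ]
    rw [← two_mul, ← ENNReal.ofReal_pow (by positivity)]
  have hBm : MeasurableSet B := by
    have : B = ⋂ i, (fun z => ⟪b i, z⟫) ⁻¹' Ioo (-h) h := by ext; simp [hB]
    rw [this]
    exact MeasurableSet.iInter fun i =>
      (isOpen_Ioo.preimage (by fun_prop)).measurableSet
  refine (lintegral_sq_le_sum_mean (r := √(Fintype.card ι * h ^ 2)) K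
    (measurableSet_gridCube b h) (pairwise_disjoint_gridCube b h) hEΩ hΩ hC hBm
    (pow_pos hh _) (fun k _ => volume_gridCube b hh k)
    (fun k x hx y hy => sub_mem_of_mem_gridCube b hh hx hy) (fun z hz => ?_) hCneg hCΩ hfm hf
    hfL).trans_eq ?_
  · refine Real.le_sqrt_of_sq_le ?_
    rw [← b.sum_sq_norm_inner_right z, ← nsmul_eq_mul, ← Finset.card_univ]
    refine Finset.sum_le_card_nsmul _ _ _ fun i _ => ?_
    have h1 := abs_lt.2 (hz i)
    rw [Real.norm_eq_abs]
    gcongr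
  · congr 1
    rw [hvB, ← ENNReal.ofReal_pow (Real.sqrt_nonneg _), Real.sq_sqrt (by positivity),
      ← mul_assoc, ← mul_assoc, ← ENNReal.ofReal_mul (by positivity),
      ← ENNReal.ofReal_mul (by positivity)]
    congr 2
    field_simp
    ring

end Cells

/-! ### The Dirichlet problem in a bounded open set -/

section Dirichlet

variable {F : Type*} [NormedAddCommGroup F] [InnerProductSpace ℝ F] [FiniteDimensional ℝ F]
  [CompleteSpace F] [MeasurableSpace F] [BorelSpace F]

theorem gradient_congr_of_eventuallyEq {f g : F → ℝ} {x : F} (h : f =ᶠ[𝓝 x] g) :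
    ∇ f x = ∇ g x := by
  simp [gradient, h.fderiv_eq]

theorem eventuallyEq_indicator {D : Set F} (hD : IsOpen D) (f : F → ℝ) {x : F} (hx : x ∈ D) :
    D.indicator f =ᶠ[𝓝 x] f := by
  filter_upwards [hD.mem_nhds hx] with y hy
  exact indicator_of_mem hy f

theorem tsupport_indicator_subset {D : Set F} {f : F → ℝ}
    (hd : Disjoint (tsupport f) (frontier D)) : tsupport (D.indicator f) ⊆ tsupport f ∩ D := by
  intro x hx
  have h1 : x ∈ tsupport f := closure_mono (by simp [support_indicator]) hx
  have h2 : x ∈ closure D := closure_mono (by simp [support_indicator]) hx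
  refine ⟨h1, ?_⟩
  by_contra h3
  exact disjoint_left.1 hd h1 ⟨h2, fun h => h3 (interior_subset h)⟩

/-- A test function for the Dirichlet problem may be cut off outside the domain. -/
theorem IsTest.indicator {D : Set F} (hD : IsOpen D) {f : F → ℝ} (hf : IsTest (frontier D) f) :
    ContDiff ℝ ∞ (D.indicator f) ∧ HasCompactSupport (D.indicator f) ∧
      tsupport (D.indicator f) ⊆ D := by
  have hd : Disjoint (tsupport f) (frontier D) := hf.disj.mono_right subset_closure
  have hs := tsupport_indicator_subset hd
  refine ⟨contDiff_iff_contDiffAt.2 fun x => ?_, ?_, hs.trans inter_subset_right⟩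
  · by_cases hx : x ∈ D
    · exact hf.contDiff.contDiffAt.congr_of_eventuallyEq (eventuallyEq_indicator hD f hx)
    · have : x ∉ tsupport (D.indicator f) := fun h => hx (hs h).2
      exact contDiffAt_const.congr_of_eventuallyEq (notMem_tsupport_iff_eventuallyEq.1 this)
  · exact hf.compact.of_isClosed_subset (isClosed_tsupport _) (hs.trans inter_subset_left)

theorem isTest_of_tsupport_subset {D : Set F} (hD : IsOpen D) {f : F → ℝ} (hf : ContDiff ℝ ∞ f)
    (hc : HasCompactSupport f) (hs : tsupport f ⊆ D) : IsTest (frontier D) f where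
  contDiff := hf
  compact := hc
  disj := by
    rw [isClosed_frontier.closure_eq, hD.frontier_eq]
    exact disjoint_left.2 fun x hx h => h.2 (hs hx)

/-- The functions of `H¹₀(D)` are limits of smooth functions with compact support in `D`. -/
theorem IsH1Zero.exists_tendsto_tsupport {D : Set F} (hD : IsOpen D) {u : F → ℝ} {G : F → F}
    (h : IsH1Zero D (frontier D) u G) :
    ∃ f : ℕ → F → ℝ, (∀ k, ContDiff ℝ ∞ (f k)) ∧ (∀ k, HasCompactSupport (f k)) ∧
      (∀ k, tsupport (f k) ⊆ D) ∧ L2Tendsto (volume.restrict D) f u ∧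
      L2Tendsto (volume.restrict D) (fun k => ∇ (f k)) G := by
  obtain ⟨f, hf, h1, h2⟩ := h.exists_tendsto
  refine ⟨fun k => D.indicator (f k), fun k => ((hf k).indicator hD).1,
    fun k => ((hf k).indicator hD).2.1, fun k => ((hf k).indicator hD).2.2, ?_, ?_⟩
  · refine (tendsto_congr fun k => ?_).1 h1
    refine eLpNorm_congr_ae ?_
    filter_upwards [ae_restrict_mem hD.measurableSet] with x hx
    rw [indicator_of_mem hx]
  · refine (tendsto_congr fun k => ?_).1 h2
    refine eLpNorm_congr_ae ?_
    filter_upwards [ae_restrict_mem hD.measurableSet] with x hx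
    rw [gradient_congr_of_eventuallyEq (eventuallyEq_indicator hD (f k) hx)]

theorem enorm_sq_eq_ofReal {E : Type*} [NormedAddCommGroup E] (t : E) :
    ‖t‖ₑ ^ 2 = ENNReal.ofReal (‖t‖ ^ 2) := by
  rw [← ofReal_norm, ENNReal.ofReal_pow (norm_nonneg _)]

theorem lintegral_enorm_sq {α E : Type*} [MeasurableSpace α] {ν : Measure α}
    [NormedAddCommGroup E] {f : α → E} (hf : MemLp f 2 ν) :
    ∫⁻ x, ‖f x‖ₑ ^ 2 ∂ν = ENNReal.ofReal (∫ x, ‖f x‖ ^ 2 ∂ν) := by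
  simp only [enorm_sq_eq_ofReal]
  rw [ofReal_integral_eq_lintegral_ofReal hf.norm.integrable_sq
    (Eventually.of_forall fun x => sq_nonneg _)]

theorem lintegral_enorm_sq_real {α : Type*} [MeasurableSpace α] {ν : Measure α}
    {f : α → ℝ} (hf : MemLp f 2 ν) :
    ∫⁻ x, ‖f x‖ₑ ^ 2 ∂ν = ENNReal.ofReal (∫ x, f x ^ 2 ∂ν) := by
  simp [lintegral_enorm_sq hf]

/-- Grids can be chosen so fine that the constant in Poincaré's inequality is arbitrarily small. -/
theorem exists_mesh (n : ℕ) (M : ℝ) : ∃ h : ℝ, 0 < h ∧ h < 1 ∧ M * (2 ^ n * (n * h ^ 2)) ≤ 1 := by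
  have h1 : Tendsto (fun h : ℝ => M * (2 ^ n * (n * h ^ 2))) (𝓝[>] 0) (𝓝 0) := by
    have : Continuous fun h : ℝ => M * (2 ^ n * (n * h ^ 2)) := by fun_prop
    have := (this.tendsto 0).mono_left (nhdsWithin_le_nhds (s := Ioi 0))
    simpa using this
  obtain ⟨h, h2, h3⟩ := ((h1.eventually (ge_mem_nhds one_pos)).and
    (Ioo_mem_nhdsGT one_pos)).exists
  exact ⟨h, h3.1, h3.2, h2⟩

/-- On a bounded open set, the Dirichlet form dominates any multiple of the `L²` norm, up to a form
of finite rank. -/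
theorem dirichlet_finite_rank {D : Set F} (hD : IsOpen D) (hDb : Bornology.IsBounded D) (μ : ℝ) :
    ∃ (K : Finset (Fin (Module.finrank ℝ F) → ℤ)) (w : K → F → ℝ),
      (∀ i, MemLp (w i) 2 (volume.restrict D)) ∧
      ∀ f, IsTest (frontier D) f → μ * ∫ x in D, f x ^ 2 ≤
        (∫ x in D, ‖∇ f x‖ ^ 2) + ∑ i, (∫ x in D, w i x * f x) ^ 2 := by
  set b := stdOrthonormalBasis ℝ F
  obtain ⟨h, hh, -, hM⟩ := exists_mesh (Module.finrank ℝ F) |μ|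
  obtain ⟨K, hK⟩ := exists_finset_gridCube b h hDb
  have hfin : volume D ≠ ⊤ := hDb.measure_lt_top.ne
  -- the functionals are the mean values over the cubes, with the weight of Poincaré's inequality
  set s : ℝ := √(|μ| / h ^ Module.finrank ℝ F) with hs
  refine ⟨K, fun k => (gridCube b h k.1).indicator fun _ => s, fun k => ?_, fun f hf => ?_⟩
  · exact memLp_indicator_const 2 (measurableSet_gridCube b h _) s
      (Or.inr ((measure_mono (μ := volume.restrict D) (subset_univ _)).trans_lt
        (by simpa using hfin.lt_top)).ne)
  obtain ⟨g1, g2, g3⟩ := hf.indicator hD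
  set g := D.indicator f with hg
  have hgt := isTest_of_tsupport_subset hD g1 g2 g3
  have key := lintegral_sq_le_gridCube b hh K (Ω := univ) (C := univ)
    (fun _ _ => subset_univ _) MeasurableSet.univ MeasurableSet.univ (by simp) (by simp)
    (f := g) g1.continuous.measurable
    (fun x _ => (g1.of_le (by simp)).contDiffAt) (fun k _ => hgt.memLp _)
  simp only [Fintype.card_fin] at key
  have e0 : ∫ x in D, f x ^ 2 = ∫ x in D, g x ^ 2 :=
    setIntegral_congr_fun hD.measurableSet fun x hx => by simp [hg, hx]
  have e1 : ENNReal.ofReal (∫ x in D, g x ^ 2) ≤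
      ∫⁻ x in ⋃ k ∈ K, gridCube b h k, ‖g x‖ₑ ^ 2 := by
    rw [← lintegral_enorm_sq_real (hgt.memLp D)]
    refine lintegral_mono_set fun x hx => ?_
    exact mem_iUnion₂.2 ⟨_, hK x hx, fun i => rfl⟩
  have e2 : ∫⁻ x in univ, ‖fderiv ℝ g x‖ₑ ^ 2 = ENNReal.ofReal (∫ x in D, ‖∇ f x‖ ^ 2) := by
    have : ∀ x, ‖fderiv ℝ g x‖ₑ = ‖∇ g x‖ₑ := fun x => by
      rw [← ofReal_norm, ← ofReal_norm, norm_gradient]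
    simp only [this]
    rw [lintegral_enorm_sq (hgt.memLp_gradient univ)]
    congr 1
    have h3 : ∫ x in D, ‖∇ f x‖ ^ 2 = ∫ x in D, ‖∇ g x‖ ^ 2 :=
      setIntegral_congr_fun hD.measurableSet fun x hx => by
        simp only [hg, gradient_congr_of_eventuallyEq (eventuallyEq_indicator hD f hx)]
    rw [h3, setIntegral_univ]
    refine (setIntegral_eq_integral_of_forall_compl_eq_zero fun x hx => ?_).symm
    have : ∇ g x = 0 := image_eq_zero_of_notMem_tsupport
      fun h => hx (g3 (tsupport_gradient_subset g h))
    simp [this]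
  have hnn : 0 ≤ ∫ x in D, ‖∇ f x‖ ^ 2 := integral_nonneg fun x => sq_nonneg _
  rw [e2, ← ENNReal.ofReal_mul (by positivity),
    ← ENNReal.ofReal_sum_of_nonneg (fun k _ => by positivity),
    ← ENNReal.ofReal_add (Finset.sum_nonneg fun k _ => by positivity) (by positivity)] at key
  have key2 := (ENNReal.ofReal_le_ofReal_iff
    (add_nonneg (Finset.sum_nonneg fun k _ => by positivity) (by positivity))).1 (e1.trans key)
  have e4 : ∀ k : K, (∫ x in D, (gridCube b h k.1).indicator (fun _ => s) x * f x) ^ 2 =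
      |μ| * ((∫ x in gridCube b h k.1, g x) ^ 2 / h ^ Module.finrank ℝ F) := by
    intro k
    have : ∫ x in D, (gridCube b h k.1).indicator (fun _ => s) x * f x =
        s * ∫ x in gridCube b h k.1, g x := by
      rw [← integral_const_mul, ← integral_indicator hD.measurableSet,
        ← integral_indicator (measurableSet_gridCube b h _)]
      congr 1
      ext x
      by_cases h1 : x ∈ D <;> by_cases h2 : x ∈ gridCube b h k.1 <;> simp [h1, h2, hg]
    rw [this, mul_pow, hs, Real.sq_sqrt (by positivity)]
    ring
  rw [Finset.sum_congr rfl fun k _ => e4 k, ← Finset.mul_sum,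
    Finset.sum_coe_sort K fun k => (∫ x in gridCube b h k, g x) ^ 2 / h ^ Module.finrank ℝ F, e0]
  have h5 : μ * ∫ x in D, g x ^ 2 ≤ |μ| * ∫ x in D, g x ^ 2 :=
    mul_le_mul_of_nonneg_right (le_abs_self μ) (integral_nonneg fun x => sq_nonneg _)
  have h6 := mul_le_mul_of_nonneg_left key2 (abs_nonneg μ)
  have h7 := mul_le_mul_of_nonneg_right hM hnn
  linarith

/-- The first Dirichlet eigenvalue is a lower bound of the Rayleigh quotient: otherwise there would
be a smaller eigenvalue. -/
theorem IsFirstDirichletEigenpair.rayleigh {D : Set F} (hD : IsOpen D)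
    (hDb : Bornology.IsBounded D) {μ : ℝ} {φ : F → ℝ} {Dφ : F → F}
    (hφ : IsFirstDirichletEigenpair D μ φ Dφ) {f : F → ℝ} (hf : IsTest (frontier D) f) :
    μ * ∫ x in D, f x ^ 2 ≤ ∫ x in D, ‖∇ f x‖ ^ 2 := by
  by_contra! hlt
  obtain ⟨K, w, hw, hineq⟩ := dirichlet_finite_rank hD hDb μ
  obtain ⟨c, hc, hc'⟩ := exists_eigenvalue_lt w hw hineq ⟨f, hf, hlt⟩
  exact absurd (hφ.first c hc') (not_le.2 hc)

end Dirichlet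

/-! ### Functions of class `C¹` with compact support -/

section Mollify

open scoped Convolution

variable {F : Type*} [NormedAddCommGroup F] [InnerProductSpace ℝ F] [FiniteDimensional ℝ F]
  [CompleteSpace F] [MeasurableSpace F] [BorelSpace F]

/-- Mollification: `C¹` functions with compact support in `D` are limits of smooth ones, uniformly
together with the gradients. -/
theorem exists_smooth_approx {D : Set F} (hD : IsOpen D) {h : F → ℝ} (hh : ContDiff ℝ 1 h)
    (hc : HasCompactSupport h) (hs : tsupport h ⊆ D) {η : ℝ} (hη : 0 < η) :
    ∃ g : F → ℝ, ContDiff ℝ ∞ g ∧ HasCompactSupport g ∧ tsupport g ⊆ D ∧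
      (∀ x, ‖g x - h x‖ ≤ η) ∧ ∀ x, ‖∇ g x - ∇ h x‖ ≤ η := by
  obtain ⟨δ, hδ, hδD⟩ := hc.isCompact.exists_cthickening_subset_open hD hs
  have hcont' : Continuous (fderiv ℝ h) := hh.continuous_fderiv one_ne_zero
  have u1 := hc.uniformContinuous_of_continuous hh.continuous
  have u2 := (hc.fderiv (𝕜 := ℝ)).uniformContinuous_of_continuous hcont'
  obtain ⟨ε₁, hε₁, hu1⟩ := Metric.uniformContinuous_iff.1 u1 η hη
  obtain ⟨ε₂, hε₂, hu2⟩ := Metric.uniformContinuous_iff.1 u2 η hη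
  set ε := min δ (min ε₁ ε₂) with hε
  have hε0 : 0 < ε := lt_min hδ (lt_min hε₁ hε₂)
  let β : ContDiffBump (0 : F) := ⟨ε / 2, ε, by positivity, by linarith⟩
  set ρ : F → ℝ := β.normed volume with hρ
  have hρc : HasCompactSupport ρ := β.hasCompactSupport_normed
  have hρs : ContDiff ℝ ∞ ρ := β.contDiff_normed
  have hli : LocallyIntegrable h volume := hh.continuous.locallyIntegrable
  set g : F → ℝ := ρ ⋆[ContinuousLinearMap.lsmul ℝ ℝ, volume] h with hg
  have hsupp : tsupport g ⊆ Metric.cthickening δ (tsupport h) := by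
    refine closure_minimal ?_ Metric.isClosed_cthickening
    refine (support_convolution_subset _).trans ?_
    rintro x ⟨u, hu, v, hv, rfl⟩
    rw [hρ, β.support_normed_eq] at hu
    refine Metric.mem_cthickening_of_dist_le (u + v) v δ _ (subset_tsupport _ hv) ?_
    have : ‖u‖ < ε := by simpa using hu
    simpa using this.le.trans (min_le_left _ _)
  refine ⟨g, hρc.contDiff_convolution_left _ hρs hli,
    (hc.isCompact.cthickening).of_isClosed_subset (isClosed_tsupport _) hsupp,
    hsupp.trans hδD, fun x => ?_, fun x => ?_⟩
  · rw [← dist_eq_norm]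
    refine β.dist_normed_convolution_le hh.continuous.aestronglyMeasurable fun y hy => ?_
    exact (hu1 (lt_of_lt_of_le hy ((min_le_right _ _).trans (min_le_left _ _)))).le
  · have hd : fderiv ℝ g x =
        (ρ ⋆[ContinuousLinearMap.lsmul ℝ ℝ, volume] fderiv ℝ h) x := by
      have h1 := (hc.hasFDerivAt_convolution_right (ContinuousLinearMap.lsmul ℝ ℝ)
        hρs.continuous.locallyIntegrable hh x (μ := volume)).fderiv
      rw [hg, h1]
      rfl
    have h2 : ∇ g x - ∇ h x =
        (InnerProductSpace.toDual ℝ F).symm (fderiv ℝ g x - fderiv ℝ h x) := by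
      simp [gradient]
    rw [h2, LinearIsometryEquiv.norm_map, hd, ← dist_eq_norm]
    refine β.dist_normed_convolution_le hcont'.aestronglyMeasurable fun y hy => ?_
    exact (hu2 (lt_of_lt_of_le hy ((min_le_right _ _).trans (min_le_right _ _)))).le

/-- The `C¹` functions with compact support in `D` belong to `H¹₀(D)`. They are needed because the
product of a test function and `H` is not smooth. -/
theorem isH1Zero_of_contDiff_one {D : Set F} (hD : IsOpen D) (hDb : Bornology.IsBounded D)
    {h : F → ℝ} (hh : ContDiff ℝ 1 h) (hc : HasCompactSupport h) (hs : tsupport h ⊆ D) :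
    IsH1Zero D (frontier D) h (∇ h) := by
  have hfin : IsFiniteMeasure (volume.restrict D) :=
    ⟨by simpa using hDb.measure_lt_top⟩
  choose g g1 g2 g3 g4 g5 using fun k : ℕ =>
    exists_smooth_approx hD hh hc hs (η := 1 / ((k : ℝ) + 1)) (by positivity)
  refine isH1Zero_of_tendsto (fun k => isTest_of_tsupport_subset hD (g1 k) (g2 k) (g3 k))
    (memLp_of_compactSupport hh.continuous hc D)
    (memLp_of_compactSupport (continuous_gradient hh) (hasCompactSupport_gradient hc) D)
    (l2Tendsto_of_uniform tendsto_one_div_add_atTop_nhds_zero_nat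
      fun k => Eventually.of_forall (g4 k))
    (l2Tendsto_of_uniform tendsto_one_div_add_atTop_nhds_zero_nat
      fun k => Eventually.of_forall (g5 k))

/-- Extending `f W` by zero, for `f` with compact support in `D` and `W` of class `Cⁿ` in `D`. -/
theorem contDiff_mul_of_tsupport {D : Set F} (hD : IsOpen D) {f W : F → ℝ} {n : WithTop ℕ∞}
    (hf : ContDiff ℝ n f) (hs : tsupport f ⊆ D) (hW : ContDiffOn ℝ n W D) :
    ContDiff ℝ n fun x => f x * W x := by
  refine contDiff_iff_contDiffAt.2 fun x => ?_
  by_cases hx : x ∈ D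
  · exact hf.contDiffAt.mul (hW.contDiffAt (hD.mem_nhds hx))
  · have h1 : f =ᶠ[𝓝 x] 0 := notMem_tsupport_iff_eventuallyEq.1 fun h => hx (hs h)
    refine (contDiffAt_const (c := (0 : ℝ))).congr_of_eventuallyEq ?_
    filter_upwards [h1] with y hy
    simp [hy]

theorem tsupport_mul_subset_left' (f W : F → ℝ) : tsupport (fun x => f x * W x) ⊆ tsupport f :=
  closure_mono fun x hx => by
    simp only [Function.mem_support] at hx ⊢
    exact left_ne_zero_of_mul hx

/-- The derivative along `v` of the derivative along `v` is a value of the second derivative. -/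
theorem fderiv_fderiv_apply {D : Set F} (hD : IsOpen D) {W : F → ℝ} (hW : ContDiffOn ℝ 2 W D)
    {x : F} (hx : x ∈ D) (v : F) :
    fderiv ℝ (fun y => fderiv ℝ W y v) x v = iteratedFDeriv ℝ 2 W x ![v, v] := by
  have h1 : ContDiffAt ℝ 2 W x := hW.contDiffAt (hD.mem_nhds hx)
  have h2 : DifferentiableAt ℝ (fderiv ℝ W) x :=
    (h1.fderiv_right (m := 1) (by norm_num)).differentiableAt one_ne_zero
  rw [iteratedFDeriv_two_apply, fderiv_clm_apply h2 (differentiableAt_const _)]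
  simp

/-- Green's formula for a function `f` with compact support in `D` and `W` of class `C²` in `D`. -/
theorem integral_inner_gradient_eq {D : Set F} (hD : IsOpen D) {f W : F → ℝ}
    (hf : ContDiff ℝ 1 f) (hc : HasCompactSupport f) (hs : tsupport f ⊆ D)
    (hW : ContDiffOn ℝ 2 W D) :
    ∫ x in D, ⟪∇ f x, ∇ W x⟫ = -∫ x in D, f x * Δ W x := by
  set b := stdOrthonormalBasis ℝ F
  have hW1 : ∀ v : F, ContDiffOn ℝ 1 (fun y => fderiv ℝ W y v) D := fun v =>
    (hW.fderiv_of_isOpen hD (m := 1) (by norm_num)).clm_apply contDiffOn_const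
  have hW0 : ∀ v : F, ContDiffOn ℝ 0 (fun x => fderiv ℝ (fun y => fderiv ℝ W y v) x v) D :=
    fun v => ((hW1 v).fderiv_of_isOpen hD (m := 0) (by norm_num)).clm_apply contDiffOn_const
  -- each coordinate contributes the integral of a derivative of a compactly supported function
  have hi : ∀ v : F,
      Integrable (fun x => fderiv ℝ f x v * fderiv ℝ W x v) ∧
      Integrable (fun x => f x * fderiv ℝ (fun y => fderiv ℝ W y v) x v) ∧
      ∫ x, fderiv ℝ f x v * fderiv ℝ W x v =
        -∫ x, f x * fderiv ℝ (fun y => fderiv ℝ W y v) x v := by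
    intro v
    have s1 : tsupport (fun x => fderiv ℝ f x v) ⊆ tsupport f :=
      (tsupport_fderiv_apply_subset ℝ v)
    have i1 : Integrable (fun x => fderiv ℝ f x v * fderiv ℝ W x v) := by
      refine (contDiff_mul_of_tsupport (n := 0) hD ?_ (s1.trans hs)
        ((hW1 v).of_le (by simp))).continuous.integrable_of_hasCompactSupport ?_
      · exact contDiff_zero.2 ((hf.continuous_fderiv one_ne_zero).clm_apply continuous_const)
      · exact hc.of_isClosed_subset (isClosed_tsupport _)
          ((tsupport_mul_subset_left' _ _).trans s1)
    have i2 : Integrable (fun x => f x * fderiv ℝ (fun y => fderiv ℝ W y v) x v) := by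
      refine (contDiff_mul_of_tsupport (n := 0) hD (hf.of_le (by simp)) hs
        (hW0 v)).continuous.integrable_of_hasCompactSupport ?_
      exact hc.of_isClosed_subset (isClosed_tsupport _) (tsupport_mul_subset_left' _ _)
    have c3 := contDiff_mul_of_tsupport hD hf hs (hW1 v)
    have s3 : HasCompactSupport fun x => f x * fderiv ℝ W x v :=
      hc.of_isClosed_subset (isClosed_tsupport _) (tsupport_mul_subset_left' _ _)
    have h0 := integral_mul_fderiv_eq_neg_fderiv_mul_of_integrable (μ := (volume : Measure F))
      (f := fun _ : F => (1 : ℝ)) (g := fun x => f x * fderiv ℝ W x v) (v := v)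
      (by simp) (by
        simp only [one_mul]
        exact ((c3.continuous_fderiv one_ne_zero).clm_apply
          continuous_const).integrable_of_hasCompactSupport (s3.fderiv_apply (𝕜 := ℝ) v))
      (by simpa using c3.continuous.integrable_of_hasCompactSupport s3)
      (fun x _ => differentiableAt_const _) (fun x _ => c3.differentiable one_ne_zero x)
    refine ⟨i1, i2, ?_⟩
    have e : ∀ x, fderiv ℝ (fun x => f x * fderiv ℝ W x v) x v =
        f x * fderiv ℝ (fun y => fderiv ℝ W y v) x v + fderiv ℝ f x v * fderiv ℝ W x v := by
      intro x
      by_cases hx : x ∈ D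
      · rw [fderiv_fun_mul (hf.differentiable one_ne_zero x)
          (((hW1 v).contDiffAt (hD.mem_nhds hx)).differentiableAt one_ne_zero)]
        simp [mul_comm]
      · have h1 : f =ᶠ[𝓝 x] 0 := notMem_tsupport_iff_eventuallyEq.1 fun h => hx (hs h)
        have h2 : (fun x => f x * fderiv ℝ W x v) =ᶠ[𝓝 x] 0 := by
          filter_upwards [h1] with y hy
          simp [hy]
        rw [h2.fderiv_eq, h1.fderiv_eq, h1.eq_of_nhds]
        simp
    simp only [one_mul, e] at h0
    rw [integral_add i2 i1] at h0
    simp at h0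
    linarith
  have e1 : ∀ x, ⟪∇ f x, ∇ W x⟫ = ∑ i, fderiv ℝ f x (b i) * fderiv ℝ W x (b i) := by
    intro x
    rw [← b.sum_inner_mul_inner]
    simp
  have e2 : ∀ x ∈ D, f x * Δ W x =
      ∑ i, f x * fderiv ℝ (fun y => fderiv ℝ W y (b i)) x (b i) := by
    intro x hx
    rw [InnerProductSpace.laplacian_eq_iteratedFDeriv_orthonormalBasis W b, Finset.mul_sum]
    simp only [fderiv_fderiv_apply hD hW hx]
  have z1 : ∫ x in D, ⟪∇ f x, ∇ W x⟫ = ∫ x, ∑ i, fderiv ℝ f x (b i) * fderiv ℝ W x (b i) := by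
    simp only [← e1]
    refine setIntegral_eq_integral_of_forall_compl_eq_zero fun x hx => ?_
    have : ∇ f x = 0 := image_eq_zero_of_notMem_tsupport
      fun h => hx (hs (tsupport_gradient_subset f h))
    simp [this]
  have z2 : ∫ x in D, f x * Δ W x =
      ∫ x, ∑ i, f x * fderiv ℝ (fun y => fderiv ℝ W y (b i)) x (b i) := by
    rw [setIntegral_congr_fun hD.measurableSet e2]
    refine setIntegral_eq_integral_of_forall_compl_eq_zero fun x hx => ?_
    have : f x = 0 := image_eq_zero_of_notMem_tsupport fun h => hx (hs h)
    simp [this]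
  rw [z1, z2, integral_finsetSum _ fun i _ => (hi (b i)).1,
    integral_finsetSum _ fun i _ => (hi (b i)).2.1, ← Finset.sum_neg_distrib]
  exact Finset.sum_congr rfl fun i _ => (hi (b i)).2.2

end Mollify

/-! ### The two forms of the condition on the curved end -/

section Identity

variable {F : Type*} [NormedAddCommGroup F] [InnerProductSpace ℝ F] [FiniteDimensional ℝ F]
  [CompleteSpace F] [MeasurableSpace F] [BorelSpace F]

theorem IsC2Closure.exists_extension {D : Set F} {H : F → ℝ} (hH : IsC2Closure D H) :
    ∃ g : F → ℝ, ContinuousOn g (closure D) ∧ EqOn H g D := by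
  obtain ⟨g, hg, he⟩ := hH.2 0 (by norm_num)
  refine ⟨fun x => g x 0, fun x hx => ?_, fun x hx => ?_⟩
  · have h1 := hg x hx
    have h2 : Continuous fun L : F [×0]→L[ℝ] ℝ => L 0 := by fun_prop
    exact (h2.tendsto _).comp h1
  · simp [← he hx]

theorem IsC2Closure.exists_bound {D : Set F} (hDb : Bornology.IsBounded D)
    {H : F → ℝ} (hH : IsC2Closure D H) :
    ∃ C, 0 < C ∧ ∀ x ∈ D, |H x| ≤ C ∧ ‖∇ H x‖ ≤ C ∧ |Δ H x| ≤ C := by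
  have hb : ∀ k : ℕ, k ≤ 2 → ∃ C, 0 < C ∧ ∀ x ∈ D, ‖iteratedFDeriv ℝ k H x‖ ≤ C := by
    intro k hk
    obtain ⟨g, hg, he⟩ := hH.2 k hk
    obtain ⟨C, hC⟩ := (hDb.isCompact_closure).exists_bound_of_continuousOn hg
    refine ⟨max C 1, by positivity, fun x hx => ?_⟩
    rw [he hx]
    exact (hC x (subset_closure hx)).trans (le_max_left _ _)
  obtain ⟨C₀, h0, hC₀⟩ := hb 0 (by norm_num)
  obtain ⟨C₁, h1, hC₁⟩ := hb 1 (by norm_num)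
  obtain ⟨C₂, h2, hC₂⟩ := hb 2 le_rfl
  set b := stdOrthonormalBasis ℝ F
  have hn : 0 ≤ (Module.finrank ℝ F : ℝ) * C₂ := by positivity
  refine ⟨C₀ + C₁ + Module.finrank ℝ F * C₂, by positivity, fun x hx => ⟨?_, ?_, ?_⟩⟩
  · have := hC₀ x hx
    rw [norm_iteratedFDeriv_zero, Real.norm_eq_abs] at this
    linarith
  · have := hC₁ x hx
    rw [norm_iteratedFDeriv_one, ← norm_gradient] at this
    linarith
  · rw [InnerProductSpace.laplacian_eq_iteratedFDeriv_orthonormalBasis H b]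
    have : |∑ i, iteratedFDeriv ℝ 2 H x ![b i, b i]| ≤ Module.finrank ℝ F * C₂ := by
      refine (Finset.abs_sum_le_sum_abs _ _).trans ?_
      refine (Finset.sum_le_card_nsmul _ _ C₂ fun i _ => ?_).trans_eq (by simp)
      rw [← Real.norm_eq_abs]
      refine (ContinuousMultilinearMap.le_opNorm _ _).trans ?_
      simpa [Fin.prod_univ_two] using hC₂ x hx
    linarith

theorem continuousOn_gradient {D : Set F} (hD : IsOpen D) {W : F → ℝ} (hW : ContDiffOn ℝ 1 W D) :
    ContinuousOn (∇ W) D :=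
  (InnerProductSpace.toDual ℝ F).symm.continuous.comp_continuousOn
    (hW.continuousOn_fderiv_of_isOpen hD le_rfl)

theorem continuousOn_laplacian {D : Set F} (hD : IsOpen D) {W : F → ℝ}
    (hW : ContDiffOn ℝ 2 W D) : ContinuousOn (Δ W) D := by
  set b := stdOrthonormalBasis ℝ F
  have hW0 : ∀ v : F, ContinuousOn (fun x => fderiv ℝ (fun y => fderiv ℝ W y v) x v) D := by
    intro v
    have h1 : ContDiffOn ℝ 1 (fun y => fderiv ℝ W y v) D :=
      (hW.fderiv_of_isOpen hD (m := 1) (by norm_num)).clm_apply contDiffOn_const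
    exact (h1.continuousOn_fderiv_of_isOpen hD le_rfl).clm_apply continuousOn_const
  refine (continuousOn_finsetSum Finset.univ fun i _ => hW0 (b i)).congr fun x hx => ?_
  rw [InnerProductSpace.laplacian_eq_iteratedFDeriv_orthonormalBasis W b]
  simp only [fderiv_fderiv_apply hD hW hx]

theorem IsEigenpair.integral_grad_sq {D S : Set F} {μ : ℝ} {φ : F → ℝ} {Dφ : F → F}
    (h : IsEigenpair D S μ φ Dφ) : ∫ x in D, ‖Dφ x‖ ^ 2 = μ * ∫ x in D, φ x ^ 2 := by
  have := h.eigen φ Dφ h.mem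
  simpa [real_inner_self_eq_norm_sq, sq] using this

/-- The equation of `φ` tested with `H φ`, followed by Green's formula for `φ²` and `H`. Both are
written for smooth functions `f k → φ` with compact support in `D`. -/
theorem IsEigenpair.integral_sq_mul_laplacian {D : Set F} (hD : IsOpen D)
    (hDb : Bornology.IsBounded D) {H : F → ℝ} (hH : IsC2Closure D H) {μ : ℝ} {φ : F → ℝ}
    {Dφ : F → F} (hφ : IsEigenpair D (frontier D) μ φ Dφ) :
    ∫ x in D, φ x ^ 2 * Δ H x = 2 * ∫ x in D, H x * (‖Dφ x‖ ^ 2 - μ * φ x ^ 2) := by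
  obtain ⟨C, hC0, hC⟩ := hH.exists_bound hDb
  obtain ⟨f, f1, f2, f3, hf, hf'⟩ := hφ.mem.exists_tendsto_tsupport hD
  have mf : ∀ k, MemLp (f k) 2 (volume.restrict D) := fun k =>
    memLp_of_compactSupport (f1 k).continuous (f2 k) D
  have f1' : ∀ k, ContDiff ℝ 1 (f k) := fun k => (f1 k).of_le (by simp)
  have mf' : ∀ k, MemLp (∇ (f k)) 2 (volume.restrict D) := fun k =>
    memLp_of_compactSupport (continuous_gradient (f1' k)) (hasCompactSupport_gradient (f2 k)) D
  have mφ := hφ.mem.memLp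
  have mφ' := hφ.mem.memLp_grad
  have hH1 : ContDiffOn ℝ 1 H D := hH.1.of_le (by norm_num)
  have bH : ∀ᵐ x ∂(volume.restrict D), ‖H x‖ ≤ C :=
    (ae_restrict_mem hD.measurableSet).mono fun x hx => (hC x hx).1
  have bH' : ∀ᵐ x ∂(volume.restrict D), ‖∇ H x‖ ≤ C :=
    (ae_restrict_mem hD.measurableSet).mono fun x hx => (hC x hx).2.1
  have bL : ∀ᵐ x ∂(volume.restrict D), ‖Δ H x‖ ≤ C :=
    (ae_restrict_mem hD.measurableSet).mono fun x hx => (hC x hx).2.2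
  have sH : AEStronglyMeasurable H (volume.restrict D) :=
    hH1.continuousOn.aestronglyMeasurable hD.measurableSet
  have sH' : AEStronglyMeasurable (∇ H) (volume.restrict D) :=
    (continuousOn_gradient hD hH1).aestronglyMeasurable hD.measurableSet
  have sL : AEStronglyMeasurable (Δ H) (volume.restrict D) :=
    (continuousOn_laplacian hD hH.1).aestronglyMeasurable hD.measurableSet
  -- the four limits
  have l1 : Tendsto (fun k => ∫ x in D, ⟪Dφ x, f k x • ∇ H x⟫) atTop
      (𝓝 (∫ x in D, ⟪Dφ x, φ x • ∇ H x⟫)) :=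
    (l2Tendsto_const Dφ).integral_inner (hf.bdd_smul bH') (fun _ => mφ') mφ'
      (fun k => memLp_bdd_smul (mf k) bH' sH') (memLp_bdd_smul mφ bH' sH')
  have l1' : Tendsto (fun k => ∫ x in D, ⟪∇ (f k) x, f k x • ∇ H x⟫) atTop
      (𝓝 (∫ x in D, ⟪Dφ x, φ x • ∇ H x⟫)) :=
    hf'.integral_inner (hf.bdd_smul bH') mf' mφ'
      (fun k => memLp_bdd_smul (mf k) bH' sH') (memLp_bdd_smul mφ bH' sH')
  have l2 : Tendsto (fun k => ∫ x in D, ⟪Dφ x, H x • ∇ (f k) x⟫) atTop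
      (𝓝 (∫ x in D, ⟪Dφ x, H x • Dφ x⟫)) :=
    (l2Tendsto_const Dφ).integral_inner (hf'.smul_bdd bH) (fun _ => mφ') mφ'
      (fun k => memLp_smul_bdd (mf' k) bH sH) (memLp_smul_bdd mφ' bH sH)
  have l3 : Tendsto (fun k => ∫ x in D, φ x * (f k x • H x)) atTop
      (𝓝 (∫ x in D, φ x * (φ x • H x))) :=
    (l2Tendsto_const φ).integral_mul (hf.bdd_smul bH) (fun _ => mφ) mφ
      (fun k => memLp_bdd_smul (mf k) bH sH) (memLp_bdd_smul mφ bH sH)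
  have l4 : Tendsto (fun k => ∫ x in D, f k x * (f k x • Δ H x)) atTop
      (𝓝 (∫ x in D, φ x * (φ x • Δ H x))) :=
    hf.integral_mul (hf.bdd_smul bL) mf mφ
      (fun k => memLp_bdd_smul (mf k) bL sL) (memLp_bdd_smul mφ bL sL)
  -- the equation tested with `f k * H`
  have eq1 : ∀ k, (∫ x in D, ⟪Dφ x, f k x • ∇ H x⟫) + ∫ x in D, ⟪Dφ x, H x • ∇ (f k) x⟫ =
      μ * ∫ x in D, φ x * (f k x • H x) := by
    intro k
    have h1 := hφ.eigen _ _ (isH1Zero_of_contDiff_one hD hDb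
      (contDiff_mul_of_tsupport hD (f1' k) (f3 k) hH1)
      ((f2 k).of_isClosed_subset (isClosed_tsupport _) (tsupport_mul_subset_left' _ _))
      ((tsupport_mul_subset_left' _ _).trans (f3 k)))
    simp only [smul_eq_mul] at h1 ⊢
    rw [← h1, ← integral_add]
    · refine setIntegral_congr_fun hD.measurableSet fun x hx => ?_
      rw [gradient_mul ((f1' k).differentiable one_ne_zero x)
        ((hH1.contDiffAt (hD.mem_nhds hx)).differentiableAt one_ne_zero), inner_add_right]
    · exact integrable_inner_of_memLp mφ' (memLp_bdd_smul (mf k) bH' sH')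
    · exact integrable_inner_of_memLp mφ' (memLp_smul_bdd (mf' k) bH sH)
  -- Green's formula for `f k ^ 2` and `H`
  have eq2 : ∀ k, 2 * ∫ x in D, ⟪∇ (f k) x, f k x • ∇ H x⟫ =
      -∫ x in D, f k x * (f k x • Δ H x) := by
    intro k
    have h1 := integral_inner_gradient_eq hD ((f1' k).mul (f1' k)) ((f2 k).mul_left)
      ((tsupport_mul_subset_left' _ _).trans (f3 k)) hH.1
    have h2 : ∀ x, ⟪∇ (fun x => f k x * f k x) x, ∇ H x⟫ = 2 * ⟪∇ (f k) x, f k x • ∇ H x⟫ := by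
      intro x
      have := (f1' k).differentiable one_ne_zero x
      rw [gradient_mul this this, ← two_smul ℝ, inner_smul_left, inner_smul_left, inner_smul_right]
      simp
    rw [← integral_const_mul]
    simp only [← h2]
    refine h1.trans ?_
    simp only [smul_eq_mul, mul_assoc]
  have r1 := tendsto_nhds_unique ((l1.add l2).congr eq1) (l3.const_mul μ)
  have r2 := tendsto_nhds_unique ((l1'.const_mul 2).congr eq2) l4.neg
  have i1 : Integrable (fun x => H x * ‖Dφ x‖ ^ 2) (volume.restrict D) := by
    have := integrable_inner_of_memLp mφ' (memLp_smul_bdd mφ' bH sH)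
    simpa [inner_smul_right, real_inner_self_eq_norm_sq] using this
  have i2 : Integrable (fun x => φ x * (φ x • H x)) (volume.restrict D) :=
    integrable_smul_of_memLp mφ (memLp_bdd_smul mφ bH sH)
  have r3 : ∫ x in D, H x * (‖Dφ x‖ ^ 2 - μ * φ x ^ 2) =
      (∫ x in D, ⟪Dφ x, H x • Dφ x⟫) - μ * ∫ x in D, φ x * (φ x • H x) := by
    rw [← integral_const_mul, ← integral_sub _ (i2.const_mul μ)]
    · congr 1
      ext x
      simp only [inner_smul_right, real_inner_self_eq_norm_sq, smul_eq_mul]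
      ring
    · simpa [inner_smul_right, real_inner_self_eq_norm_sq] using i1
  have r4 : ∫ x in D, φ x ^ 2 * Δ H x = ∫ x in D, φ x * (φ x • Δ H x) := by
    congr 1
    ext x
    simp only [smul_eq_mul]
    ring
  rw [r3, r4]
  linarith

end Identity

/-! ### The first eigenfunction does not vanish on an open set -/

section Positivity

variable {F : Type*} [NormedAddCommGroup F] [InnerProductSpace ℝ F] [FiniteDimensional ℝ F]
  [CompleteSpace F] [MeasurableSpace F] [BorelSpace F]

/-- The Cauchy–Schwarz inequality for the form `∫ |∇f|² - μ ∫ f²`, if it is nonnegative on the test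
functions. -/
theorem IsTest.form_cauchy_schwarz {Ω S : Set F} {μ : ℝ}
    (hR : ∀ f, IsTest S f → μ * ∫ x in Ω, f x ^ 2 ≤ ∫ x in Ω, ‖∇ f x‖ ^ 2)
    {f g : F → ℝ} (hf : IsTest S f) (hg : IsTest S g) :
    ((∫ x in Ω, ⟪∇ f x, ∇ g x⟫) - μ * ∫ x in Ω, f x * g x) ^ 2 ≤
      ((∫ x in Ω, ‖∇ f x‖ ^ 2) - μ * ∫ x in Ω, f x ^ 2) *
        ((∫ x in Ω, ‖∇ g x‖ ^ 2) - μ * ∫ x in Ω, g x ^ 2) := by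
  have hsq : ∀ f (hf : IsTest S f), ‖(hf.memLp Ω).toLp f‖ ^ 2 = ∫ x in Ω, f x ^ 2 := by
    intro f hf
    rw [norm_sq_toLp]
    simp
  have h : ∀ v, μ * ‖zeroSpace.val Ω S v‖ ^ 2 ≤ ‖zeroSpace.grad Ω S v‖ ^ 2 := by
    intro v
    refine zeroSpace.induction
      (P := fun v => μ * ‖zeroSpace.val Ω S v‖ ^ 2 ≤ ‖zeroSpace.grad Ω S v‖ ^ 2)
      (isClosed_le (by fun_prop) (by fun_prop)) (fun f hf => ?_) v
    change μ * ‖(hf.memLp Ω).toLp f‖ ^ 2 ≤ ‖(hf.memLp_gradient Ω).toLp (∇ f)‖ ^ 2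
    rw [hsq f hf, norm_sq_toLp]
    exact hR f hf
  have key := MixedCylinder.form_cauchy_schwarz _ _ h
    ⟨toPair (hf.memLp Ω) (hf.memLp_gradient Ω), (toPair_mem_zeroSpace _ _).2 (hf.isH1Zero Ω)⟩
    ⟨toPair (hg.memLp Ω) (hg.memLp_gradient Ω), (toPair_mem_zeroSpace _ _).2 (hg.isH1Zero Ω)⟩
  change (⟪(hf.memLp_gradient Ω).toLp (∇ f), (hg.memLp_gradient Ω).toLp (∇ g)⟫ -
    μ * ⟪(hf.memLp Ω).toLp f, (hg.memLp Ω).toLp g⟫) ^ 2 ≤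
    (‖(hf.memLp_gradient Ω).toLp (∇ f)‖ ^ 2 - μ * ‖(hf.memLp Ω).toLp f‖ ^ 2) *
    (‖(hg.memLp_gradient Ω).toLp (∇ g)‖ ^ 2 - μ * ‖(hg.memLp Ω).toLp g‖ ^ 2) at key
  rw [hsq f hf, hsq g hg, norm_sq_toLp, norm_sq_toLp, inner_toLp, inner_toLp] at key
  simpa [mul_comm] using key

theorem abs_sqrt_sub_abs_le (a : ℝ) {ε : ℝ} (hε : 0 ≤ ε) :
    |√(a ^ 2 + ε ^ 2) - ε - abs a| ≤ ε := by
  have h1 : |a| ≤ √(a ^ 2 + ε ^ 2) := Real.abs_le_sqrt (by nlinarith)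
  have h2 : √(a ^ 2 + ε ^ 2) ≤ |a| + ε := by
    rw [Real.sqrt_le_left (by positivity)]
    nlinarith [sq_abs a, mul_nonneg (abs_nonneg a) hε]
  rw [abs_le]
  constructor <;> linarith

/-- A smooth substitute for `|f|`, with the same support and a smaller Dirichlet integral. -/
theorem contDiff_smoothAbs {f : F → ℝ} (hf : ContDiff ℝ ∞ f) {ε : ℝ} (hε : 0 < ε) :
    ContDiff ℝ ∞ (fun x => √(f x ^ 2 + ε ^ 2) - ε) ∧
      ∀ x, ‖∇ (fun x => √(f x ^ 2 + ε ^ 2) - ε) x‖ ≤ ‖∇ f x‖ := by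
  have hpos : ∀ x, 0 < f x ^ 2 + ε ^ 2 := fun x => by positivity
  refine ⟨?_, fun x => ?_⟩
  · exact ((hf.pow 2).add contDiff_const).sqrt (fun x => (hpos x).ne') |>.sub contDiff_const
  · rw [norm_gradient, norm_gradient]
    have h1 : HasFDerivAt f (fderiv ℝ f x) x :=
      (hf.differentiable (by simp) x).hasFDerivAt
    have h2 := ((h1.pow 2).add_const (ε ^ 2)).sqrt (hpos x).ne' |>.sub_const ε
    rw [h2.fderiv, ← smul_assoc, norm_smul]
    refine mul_le_of_le_one_left (norm_nonneg _) ?_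
    have h3 : |f x| ≤ √(f x ^ 2 + ε ^ 2) := Real.abs_le_sqrt (by nlinarith)
    have h4 : 0 < √(f x ^ 2 + ε ^ 2) := Real.sqrt_pos.2 (hpos x)
    simp only [Nat.add_one_sub_one, pow_one, smul_eq_mul, nsmul_eq_mul, Nat.cast_ofNat]
    rw [Real.norm_eq_abs, abs_mul, abs_of_pos (by positivity : 0 < 1 / (2 * √(f x ^ 2 + ε ^ 2))),
      abs_mul, abs_two]
    rw [div_mul_eq_mul_div, div_le_one (by positivity)]
    linarith

/-- `|φ|` solves the eigenvalue equation in the distributional sense: the functions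
`√(f² + ε²) - ε` with `f → φ`, `ε → 0` are a minimizing sequence for the Rayleigh quotient. -/
theorem IsFirstDirichletEigenpair.integral_abs_mul {D : Set F} (hD : IsOpen D)
    (hDb : Bornology.IsBounded D) {μ : ℝ} {φ : F → ℝ} {Dφ : F → F}
    (hφ : IsFirstDirichletEigenpair D μ φ Dφ) {ψ : F → ℝ} (hψ : ContDiff ℝ ∞ ψ)
    (hc : HasCompactSupport ψ) (hs : tsupport ψ ⊆ D) :
    ∫ x in D, |φ x| * (Δ ψ x + μ * ψ x) = 0 := by
  have hfin : IsFiniteMeasure (volume.restrict D) := ⟨by simpa using hDb.measure_lt_top⟩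
  obtain ⟨f, f1, f2, f3, hf, hf'⟩ := hφ.eigenpair.mem.exists_tendsto_tsupport hD
  have hψt := isTest_of_tsupport_subset hD hψ hc hs
  have hft := fun k => isTest_of_tsupport_subset hD (f1 k) (f2 k) (f3 k)
  have mφ := hφ.eigenpair.mem.memLp
  set ε : ℕ → ℝ := fun k => 1 / ((k : ℝ) + 1) with hε
  have hε0 : ∀ k, 0 < ε k := fun k => by positivity
  set v : ℕ → F → ℝ := fun k x => √(f k x ^ 2 + ε k ^ 2) - ε k with hv
  have v1 : ∀ k, ContDiff ℝ ∞ (v k) := fun k => (contDiff_smoothAbs (f1 k) (hε0 k)).1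
  have vs : ∀ k, tsupport (v k) ⊆ tsupport (f k) := by
    intro k
    refine closure_mono fun x hx => ?_
    simp only [Function.mem_support] at hx ⊢
    intro h
    apply hx
    simp [hv, h, Real.sqrt_sq (hε0 k).le]
  have v2 : ∀ k, HasCompactSupport (v k) := fun k =>
    (f2 k).of_isClosed_subset (isClosed_tsupport _) (vs k)
  have v3 : ∀ k, tsupport (v k) ⊆ D := fun k => (vs k).trans (f3 k)
  have hvt := fun k => isTest_of_tsupport_subset hD (v1 k) (v2 k) (v3 k)
  have hvL : L2Tendsto (volume.restrict D) v fun x => |φ x| := by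
    have h1 : L2Tendsto (volume.restrict D) (fun k x => |f k x|) (fun x => |φ x|) := by
      refine tendsto_of_tendsto_of_tendsto_of_le_of_le tendsto_const_nhds hf (fun _ => zero_le)
        fun k => eLpNorm_mono fun x => ?_
      simpa using abs_abs_sub_abs_le (f k x) (φ x)
    have h2 : L2Tendsto (volume.restrict D) (fun k x => v k x - |f k x|) (fun _ => 0) :=
      l2Tendsto_of_uniform tendsto_one_div_add_atTop_nhds_zero_nat fun k =>
        Eventually.of_forall fun x => by
          rw [sub_zero]
          exact abs_sqrt_sub_abs_le (f k x) (hε0 k).le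
    have h3 := h1.add h2 (fun k => ((hft k).memLp D).abs) mφ.abs
      (fun k => ((hvt k).memLp D).sub ((hft k).memLp D).abs) MemLp.zero'
    simpa using h3
  have hform : ∀ k, 0 ≤ (∫ x in D, ‖∇ (v k) x‖ ^ 2) - μ * ∫ x in D, v k x ^ 2 := fun k =>
    sub_nonneg.2 (hφ.rayleigh hD hDb (hvt k))
  have hform' : Tendsto (fun k => (∫ x in D, ‖∇ (v k) x‖ ^ 2) - μ * ∫ x in D, v k x ^ 2) atTop
      (𝓝 0) := by
    have l1 := hf'.integral_inner hf' (fun k => (hft k).memLp_gradient D)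
      hφ.eigenpair.mem.memLp_grad (fun k => (hft k).memLp_gradient D) hφ.eigenpair.mem.memLp_grad
    have l2 := hvL.integral_mul hvL (fun k => (hvt k).memLp D) mφ.abs
      (fun k => (hvt k).memLp D) mφ.abs
    simp only [real_inner_self_eq_norm_sq, ← sq, sq_abs] at l1 l2
    have l3 := l1.sub (l2.const_mul μ)
    rw [hφ.eigenpair.integral_grad_sq, sub_self] at l3
    refine squeeze_zero hform (fun k => ?_) l3
    gcongr ?_ - _
    refine integral_mono ((hvt k).memLp_gradient D).norm.integrable_sq
      ((hft k).memLp_gradient D).norm.integrable_sq fun x => ?_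
    dsimp only
    gcongr
    exact (contDiff_smoothAbs (f1 k) (hε0 k)).2 x
  have hb : ContDiffOn ℝ 2 ψ univ := (hψ.of_le (by norm_cast)).contDiffOn
  have hLc : Continuous (Δ ψ) := continuousOn_univ.1 (continuousOn_laplacian isOpen_univ hb)
  have hLs : HasCompactSupport (Δ ψ) := by
    refine hc.of_isClosed_subset (isClosed_tsupport _) (closure_minimal ?_ (isClosed_tsupport _))
    intro x hx
    by_contra h
    refine hx ?_
    have h0 : ψ =ᶠ[𝓝 x] 0 := notMem_tsupport_iff_eventuallyEq.1 h
    rw [(InnerProductSpace.laplacian_congr_nhds h0).eq_of_nhds]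
    exact congrFun (InnerProductSpace.laplacian_const (c := (0 : ℝ))) x
  have mL : MemLp (fun x => Δ ψ x + μ * ψ x) 2 (volume.restrict D) :=
    memLp_of_compactSupport (hLc.add (continuous_const.mul hψ.continuous))
      (hLs.add hc.mul_left) D
  have hlim := hvL.integral_mul (l2Tendsto_const _) (fun k => (hvt k).memLp D) mφ.abs
    (fun _ => mL) mL
  have hsq : Tendsto (fun k => (∫ x in D, v k x * (Δ ψ x + μ * ψ x)) ^ 2) atTop (𝓝 0) := by
    have := hform'.mul_const ((∫ x in D, ‖∇ ψ x‖ ^ 2) - μ * ∫ x in D, ψ x ^ 2)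
    rw [zero_mul] at this
    refine squeeze_zero (fun k => sq_nonneg _) (fun k => ?_) this
    refine le_trans (le_of_eq ?_) (IsTest.form_cauchy_schwarz
      (fun f hf => hφ.rayleigh hD hDb hf) (hvt k) hψt)
    rw [integral_inner_gradient_eq hD ((v1 k).of_le (by simp)) (v2 k) (v3 k)
      (hb.mono (subset_univ _)), ← integral_const_mul, ← neg_add', neg_sq, ← integral_add]
    · congr 2
      ext x
      ring
    · exact integrable_smul_of_memLp ((hvt k).memLp D) (memLp_of_compactSupport hLc hLs D)
    · exact (integrable_smul_of_memLp ((hvt k).memLp D) (hψt.memLp D)).const_mul μ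
  have := tendsto_nhds_unique (hlim.pow 2) hsq
  exact pow_eq_zero_iff two_ne_zero |>.1 this

/-- The Laplacian of a radial function. -/
theorem laplacian_radial {K K₁ K₂ : ℝ → ℝ} {U : Set ℝ} (hU : IsOpen U)
    (h1 : ∀ s ∈ U, HasDerivAt K (K₁ s) s) (h2 : ∀ s ∈ U, HasDerivAt K₁ (K₂ s) s) (x₀ : F)
    (hK : ContDiff ℝ 2 fun y : F => K (‖y - x₀‖ ^ 2)) {y : F} (hy : ‖y - x₀‖ ^ 2 ∈ U) :
    Δ (fun y : F => K (‖y - x₀‖ ^ 2)) y =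
      4 * ‖y - x₀‖ ^ 2 * K₂ (‖y - x₀‖ ^ 2) + 2 * Module.finrank ℝ F * K₁ (‖y - x₀‖ ^ 2) := by
  set b := stdOrthonormalBasis ℝ F
  have hq : ∀ z : F, HasFDerivAt (fun y : F => ‖y - x₀‖ ^ 2) (2 • innerSL ℝ (z - x₀)) z := by
    intro z
    have := ((hasFDerivAt_id z).sub_const x₀).norm_sq
    simpa using this
  have hU' : IsOpen {z : F | ‖z - x₀‖ ^ 2 ∈ U} := hU.preimage (by fun_prop)
  have hd1 : ∀ (w z : F), ‖z - x₀‖ ^ 2 ∈ U →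
      fderiv ℝ (fun y : F => K (‖y - x₀‖ ^ 2)) z w =
        K₁ (‖z - x₀‖ ^ 2) * (2 * ⟪z - x₀, w⟫) := by
    intro w z hz
    have h3 : HasFDerivAt (fun y : F => K (‖y - x₀‖ ^ 2)) _ z :=
      (h1 _ hz).comp_hasFDerivAt z (hq z)
    rw [h3.fderiv]
    simp [inner_sub_left]
  have hd2 : ∀ w : F, fderiv ℝ (fun z => fderiv ℝ (fun y : F => K (‖y - x₀‖ ^ 2)) z w) y w =
      K₂ (‖y - x₀‖ ^ 2) * (4 * ⟪y - x₀, w⟫ ^ 2) + K₁ (‖y - x₀‖ ^ 2) * (2 * ‖w‖ ^ 2) := by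
    intro w
    have he : (fun z => fderiv ℝ (fun y : F => K (‖y - x₀‖ ^ 2)) z w) =ᶠ[𝓝 y]
        fun z => K₁ (‖z - x₀‖ ^ 2) * (2 * ⟪z - x₀, w⟫) := by
      filter_upwards [hU'.mem_nhds hy] with z hz
      exact hd1 w z hz
    rw [he.fderiv_eq]
    have a1 : HasFDerivAt (fun y : F => K₁ (‖y - x₀‖ ^ 2)) _ y :=
      (h2 _ hy).comp_hasFDerivAt y (hq y)
    have a2 : HasFDerivAt (fun z : F => 2 * ⟪z - x₀, w⟫) ((2 : ℝ) • innerSL ℝ w) y := by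
      have : HasFDerivAt (fun z : F => innerSL ℝ w (z - x₀)) (innerSL ℝ w) y := by
        exact (innerSL ℝ w).hasFDerivAt.comp y ((hasFDerivAt_id y).sub_const x₀)
      have h3 := this.const_mul 2
      simpa [real_inner_comm] using h3
    rw [(a1.fun_mul a2).fderiv]
    simp [inner_sub_left]
    ring
  rw [InnerProductSpace.laplacian_eq_iteratedFDeriv_orthonormalBasis _ b]
  simp only [← fderiv_fderiv_apply isOpen_univ hK.contDiffOn (mem_univ _), hd2]
  rw [Finset.sum_add_distrib, ← Finset.mul_sum, ← Finset.mul_sum, ← Finset.mul_sum]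
  have e1 : ∑ i, ⟪y - x₀, b i⟫ ^ 2 = ‖y - x₀‖ ^ 2 := by
    have := b.sum_sq_norm_inner_left (y - x₀)
    simpa using this
  rw [e1]
  simp
  ring

/-- A barrier: a radial bump around `x₀`, strictly subharmonic away from the centre. It is
`exp (-1 / (a (R² - |y - x₀|²)))` inside the ball of radius `R`, with a small `a`. -/
theorem exists_barrier (x₀ : F) {r R : ℝ} (hr : 0 < r) (hrR : r < R) :
    ∃ ψ : F → ℝ, ContDiff ℝ ∞ ψ ∧ tsupport ψ ⊆ Metric.closedBall x₀ R ∧ (∀ y, 0 ≤ ψ y) ∧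
      ∀ y ∈ Metric.ball x₀ R, r ≤ ‖y - x₀‖ → 0 < Δ ψ y := by
  have hR : 0 < R := hr.trans hrR
  obtain ⟨n, hn⟩ : ∃ n : ℝ, n = Module.finrank ℝ F := ⟨_, rfl⟩
  have hn0 : 0 ≤ n := hn ▸ Nat.cast_nonneg _
  -- for this `a` the term of `Δψ` with the factor `1 / t ^ 4`, where `t = a (R² - |y - x₀|²)`,
  -- dominates the others when `r ≤ |y - x₀|`
  obtain ⟨a, ha, ha1, ha2⟩ : ∃ a : ℝ, 0 < a ∧ a * R ^ 2 ≤ 1 / 4 ∧ n * (a * R ^ 4) < r ^ 2 := by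
    refine ⟨min (1 / (4 * R ^ 2)) (r ^ 2 / ((n + 1) * R ^ 4)), by positivity, ?_, ?_⟩
    · calc _ ≤ 1 / (4 * R ^ 2) * R ^ 2 := by gcongr; exact min_le_left _ _
        _ = 1 / 4 := by field_simp
    · calc n * (min (1 / (4 * R ^ 2)) (r ^ 2 / ((n + 1) * R ^ 4)) * R ^ 4)
          ≤ n * (r ^ 2 / ((n + 1) * R ^ 4) * R ^ 4) := by gcongr; exact min_le_right _ _
        _ = n / (n + 1) * r ^ 2 := by field_simp
        _ < 1 * r ^ 2 := by
          gcongr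
          rw [div_lt_one (by positivity)]
          linarith
        _ = r ^ 2 := one_mul _
  set K : ℝ → ℝ := fun s => expNegInvGlue (a * (R ^ 2 - s)) with hK
  set e : ℝ → ℝ := fun s => Real.exp (-(a * (R ^ 2 - s))⁻¹) with he
  set K₁ : ℝ → ℝ := fun s => -a * e s / (a * (R ^ 2 - s)) ^ 2 with hK₁
  set K₂ : ℝ → ℝ := fun s => a ^ 2 * e s / (a * (R ^ 2 - s)) ^ 4 -
    2 * a ^ 2 * e s / (a * (R ^ 2 - s)) ^ 3 with hK₂
  have hlin : ∀ s, HasDerivAt (fun s => a * (R ^ 2 - s)) (-a) s := fun s => by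
    simpa using ((hasDerivAt_id s).const_sub (R ^ 2)).const_mul a
  have hpos : ∀ s ∈ Iio (R ^ 2), 0 < a * (R ^ 2 - s) := fun s hs =>
    mul_pos ha (sub_pos.2 hs)
  have hde : ∀ s ∈ Iio (R ^ 2), HasDerivAt e (K₁ s) s := by
    intro s hs
    have h : HasDerivAt e _ s := ((hlin s).inv (hpos s hs).ne').neg.exp
    refine h.congr_deriv ?_
    change e s * _ = _
    simp only [hK₁]
    ring
  have h1 : ∀ s ∈ Iio (R ^ 2), HasDerivAt K (K₁ s) s := by
    intro s hs
    refine (hde s hs).congr_of_eventuallyEq ?_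
    filter_upwards [isOpen_Iio.mem_nhds hs] with s' hs'
    simp [hK, he, expNegInvGlue, not_le.2 (hpos s' hs')]
  have h2 : ∀ s ∈ Iio (R ^ 2), HasDerivAt K₁ (K₂ s) s := by
    intro s hs
    have hne := (hpos s hs).ne'
    have h : HasDerivAt K₁ _ s :=
      ((hde s hs).const_mul (-a)).div ((hlin s).pow 2) (pow_ne_zero 2 hne)
    refine h.congr_deriv ?_
    change (-a * (-a * e s / (a * (R ^ 2 - s)) ^ 2) * (a * (R ^ 2 - s)) ^ 2 -
      (-a * e s) * (((2 : ℕ) : ℝ) * (a * (R ^ 2 - s)) ^ (2 - 1) * (-a))) /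
      ((a * (R ^ 2 - s)) ^ 2) ^ 2 = a ^ 2 * e s / (a * (R ^ 2 - s)) ^ 4 -
        2 * a ^ 2 * e s / (a * (R ^ 2 - s)) ^ 3
    push_cast
    generalize e s = E
    generalize a * (R ^ 2 - s) = t at hne
    field_simp
  have hψ : ContDiff ℝ ∞ fun y : F => K (‖y - x₀‖ ^ 2) := by
    have hg : ContDiff ℝ ∞ fun y : F => a * (R ^ 2 - ‖y - x₀‖ ^ 2) :=
      contDiff_const.mul (contDiff_const.sub ((contDiff_id.sub contDiff_const).norm_sq ℝ))
    exact expNegInvGlue.contDiff.comp hg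
  refine ⟨fun y => K (‖y - x₀‖ ^ 2), hψ, ?_, fun y => expNegInvGlue.nonneg _, fun y hy hry => ?_⟩
  · refine closure_minimal (fun y hy => ?_) Metric.isClosed_closedBall
    by_contra hcon
    rw [Metric.mem_closedBall, dist_eq_norm, not_le] at hcon
    refine hy (expNegInvGlue.zero_of_nonpos ?_)
    have : R ^ 2 < ‖y - x₀‖ ^ 2 := by gcongr
    nlinarith
  · rw [Metric.mem_ball, dist_eq_norm] at hy
    have hs : ‖y - x₀‖ ^ 2 ∈ Iio (R ^ 2) := by
      rw [mem_Iio]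
      gcongr
    have hrs : r ^ 2 ≤ ‖y - x₀‖ ^ 2 := by gcongr
    rw [laplacian_radial isOpen_Iio h1 h2 x₀ (hψ.of_le (by norm_cast)) hs, ← hn]
    have hE : 0 < e (‖y - x₀‖ ^ 2) := Real.exp_pos _
    have ht := hpos _ hs
    set s := ‖y - x₀‖ ^ 2
    simp only [hK₁, hK₂]
    set E := e s
    have ht1 : a * (R ^ 2 - s) ≤ a * R ^ 2 := by
      have : 0 ≤ s := sq_nonneg _
      nlinarith
    set t := a * (R ^ 2 - s)
    have key : 0 < 2 * s * a * (1 - 2 * t) - n * t ^ 2 := by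
      have k1 : s * a ≤ 2 * s * a * (1 - 2 * t) := by
        have : 0 ≤ s * a := mul_nonneg (sq_nonneg _) ha.le
        nlinarith
      have k2 : n * t ^ 2 ≤ n * (a * R ^ 4) * a := by
        have : t ^ 2 ≤ (a * R ^ 2) ^ 2 := by gcongr
        calc n * t ^ 2 ≤ n * (a * R ^ 2) ^ 2 := by gcongr
          _ = _ := by ring
      have k3 : n * (a * R ^ 4) * a < r ^ 2 * a := by gcongr
      have k4 : r ^ 2 * a ≤ s * a := by gcongr
      linarith
    have : 4 * s * (a ^ 2 * E / t ^ 4 - 2 * a ^ 2 * E / t ^ 3) + 2 * n * (-a * E / t ^ 2) =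
        2 * a * E / t ^ 4 * (2 * s * a * (1 - 2 * t) - n * t ^ 2) := by
      field_simp
      ring
    rw [this]
    positivity

theorem IsEigenpair.nonneg {Ω S : Set F} {μ : ℝ} {φ : F → ℝ} {Dφ : F → F}
    (h : IsEigenpair Ω S μ φ Dφ) : 0 ≤ μ := by
  have h1 := h.integral_grad_sq
  have h2 : 0 ≤ ∫ x in Ω, ‖Dφ x‖ ^ 2 := integral_nonneg fun x => sq_nonneg _
  have h3 : 0 < ∫ x in Ω, φ x ^ 2 := by
    refine (integral_nonneg fun x => sq_nonneg _).lt_of_ne' fun h0 => h.ne_zero ?_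
    rw [integral_eq_zero_iff_of_nonneg (fun x => sq_nonneg _) h.mem.memLp.integrable_sq] at h0
    filter_upwards [h0] with x hx
    simpa using hx
  by_contra! hμ
  nlinarith

/-- If the first eigenfunction vanishes near the centre of a ball in `D`, it vanishes in the
ball: test the equation of `|φ|` with a barrier. -/
theorem IsFirstDirichletEigenpair.ae_eq_zero_of_ball {D : Set F} (hD : IsOpen D)
    (hDb : Bornology.IsBounded D) {μ : ℝ} {φ : F → ℝ} {Dφ : F → F}
    (hφ : IsFirstDirichletEigenpair D μ φ Dφ) {x₀ : F} {r R : ℝ} (hr : 0 < r) (hrR : r < R)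
    (hball : Metric.closedBall x₀ R ⊆ D) (h0 : ∀ᵐ x, x ∈ Metric.ball x₀ r → φ x = 0) :
    ∀ᵐ x, x ∈ Metric.ball x₀ R → φ x = 0 := by
  rcases subsingleton_or_nontrivial F with hF | hF
  · filter_upwards [h0] with x hx _
    exact hx (by rw [Subsingleton.elim x x₀]; exact Metric.mem_ball_self hr)
  obtain ⟨ψ, ψ1, ψ2, ψ3, ψ4⟩ := exists_barrier x₀ hr hrR
  have ψc : HasCompactSupport ψ :=
    (isCompact_closedBall x₀ R).of_isClosed_subset (isClosed_tsupport _) ψ2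
  have key := hφ.integral_abs_mul hD hDb ψ1 ψc (ψ2.trans hball)
  have hμ := hφ.eigenpair.nonneg
  have hb : ContDiffOn ℝ 2 ψ univ := (ψ1.of_le (by norm_cast)).contDiffOn
  have hLc : Continuous (Δ ψ) := continuousOn_univ.1 (continuousOn_laplacian isOpen_univ hb)
  have hLz : ∀ x, x ∉ tsupport ψ → Δ ψ x = 0 := by
    intro x hx
    have h0 : ψ =ᶠ[𝓝 x] 0 := notMem_tsupport_iff_eventuallyEq.1 hx
    rw [(InnerProductSpace.laplacian_congr_nhds h0).eq_of_nhds]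
    exact congrFun (InnerProductSpace.laplacian_const (c := (0 : ℝ))) x
  have hLs : HasCompactSupport (Δ ψ) :=
    ψc.of_isClosed_subset (isClosed_tsupport _) (closure_minimal
      (fun x hx => by_contra fun h => hx (hLz x h)) (isClosed_tsupport _))
  have mL : MemLp (fun x => Δ ψ x + μ * ψ x) 2 (volume.restrict D) :=
    memLp_of_compactSupport (hLc.add (continuous_const.mul ψ1.continuous))
      (hLs.add ψc.mul_left) D
  have hint : Integrable (fun x => |φ x| * (Δ ψ x + μ * ψ x)) (volume.restrict D) :=
    integrable_smul_of_memLp hφ.eigenpair.mem.memLp.abs mL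
  have hsph : ∀ᵐ x : F, x ∉ Metric.sphere x₀ R :=
    measure_eq_zero_iff_ae_notMem.1 (Measure.addHaar_sphere volume x₀ R)
  have hnn : 0 ≤ᵐ[volume.restrict D] fun x => |φ x| * (Δ ψ x + μ * ψ x) := by
    filter_upwards [ae_restrict_of_ae h0, ae_restrict_of_ae hsph] with x hx hx'
    change 0 ≤ |φ x| * (Δ ψ x + μ * ψ x)
    by_cases h1 : x ∈ Metric.ball x₀ r
    · simp [hx h1]
    by_cases h2 : x ∈ Metric.ball x₀ R
    · have h3 := ψ4 x h2 (by simpa [dist_eq_norm] using h1)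
      have := ψ3 x
      positivity
    · have h3 : x ∉ tsupport ψ := fun h => by
        rcases (Metric.mem_closedBall.1 (ψ2 h)).lt_or_eq with h4 | h4
        · exact h2 h4
        · exact hx' h4
      rw [hLz x h3, image_eq_zero_of_notMem_tsupport h3]
      simp
  have hz := (setIntegral_eq_zero_iff_of_nonneg_ae hnn hint).1 key
  have hz' := (ae_restrict_iff' hD.measurableSet).1 hz
  filter_upwards [hz', h0] with x hx hx0 hxR
  by_cases h1 : x ∈ Metric.ball x₀ r
  · exact hx0 h1
  have h2 := hx (hball (Metric.ball_subset_closedBall hxR))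
  have h3 := ψ4 x hxR (by simpa [dist_eq_norm] using h1)
  have h4 : 0 < Δ ψ x + μ * ψ x := add_pos_of_pos_of_nonneg h3 (mul_nonneg hμ (ψ3 x))
  simpa [h4.ne'] using h2

/-- The first eigenfunction of a connected set does not vanish almost everywhere on a ball. -/
theorem IsFirstDirichletEigenpair.not_ae_eq_zero_ball {D : Set F} (hD : IsOpen D)
    (hDc : IsPreconnected D) (hDb : Bornology.IsBounded D) {μ : ℝ} {φ : F → ℝ} {Dφ : F → F}
    (hφ : IsFirstDirichletEigenpair D μ φ Dφ) {x₀ : F} (hx₀ : x₀ ∈ D) {r : ℝ} (hr : 0 < r) :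
    ¬ ∀ᵐ x, x ∈ Metric.ball x₀ r → φ x = 0 := by
  intro h0
  set A : Set F := {x | ∃ r > 0, ∀ᵐ y, y ∈ Metric.ball x r → φ y = 0} with hA
  have hAo : IsOpen A := by
    rw [Metric.isOpen_iff]
    rintro x ⟨r, hr, hx⟩
    refine ⟨r / 2, by positivity, fun z hz => ⟨r / 2, by positivity, ?_⟩⟩
    filter_upwards [hx] with y hy hyz
    refine hy ?_
    rw [Metric.mem_ball] at hz hyz ⊢
    linarith [dist_triangle y z x]
  -- `A` is relatively closed in `D`: a point close to `x` is the centre of a ball that contains `x`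
  have hsub : D ⊆ A := by
    refine hDc.subset_of_closure_inter_subset hAo ⟨x₀, hx₀, r, hr, h0⟩ ?_
    rintro x ⟨hxA, hxD⟩
    obtain ⟨ρ, hρ, hball⟩ := Metric.isOpen_iff.1 hD x hxD
    obtain ⟨z, ⟨s, hs, hz⟩, hxz⟩ := Metric.mem_closure_iff.1 hxA (ρ / 4) (by positivity)
    have hmin : 0 < min s (ρ / 4) := by positivity
    have h1 := hφ.ae_eq_zero_of_ball hD hDb (x₀ := z) (R := ρ / 2) hmin
      (lt_of_le_of_lt (min_le_right _ _) (by linarith)) (fun y hy => hball ?_) ?_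
    · refine ⟨ρ / 4, by positivity, ?_⟩
      filter_upwards [h1] with y hy hyx
      refine hy ?_
      rw [Metric.mem_ball] at hyx ⊢
      linarith [dist_triangle y x z]
    · rw [Metric.mem_closedBall] at hy
      rw [Metric.mem_ball]
      linarith [dist_triangle y z x, dist_comm x z]
    · filter_upwards [hz] with y hy hyz
      exact hy (Metric.ball_subset_ball (min_le_left _ _) hyz)
  refine hφ.eigenpair.ne_zero ?_
  rw [Filter.EventuallyEq, ae_restrict_iff' hD.measurableSet, ae_iff]
  refine measure_null_of_locally_null _ fun x hx => ?_
  rw [mem_ofPred_eq, Classical.not_imp] at hx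
  obtain ⟨s, hs, hxs⟩ := hsub hx.1
  refine ⟨_, inter_mem_nhdsWithin _ (Metric.ball_mem_nhds x hs), ?_⟩
  refine measure_mono_null ?_ (ae_iff.1 hxs)
  rintro y ⟨hy1, hy2⟩
  rw [mem_ofPred_eq, Classical.not_imp] at hy1 ⊢
  exact ⟨hy2, hy1.2⟩

/-- If `H` is superharmonic and not harmonic, the integral of `φ² ΔH` is negative: otherwise `φ`
would vanish on a ball where `ΔH ≠ 0`. -/
theorem IsFirstDirichletEigenpair.integral_sq_mul_laplacian_neg {D : Set F} (hD : IsOpen D)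
    (hDc : IsPreconnected D) (hDb : Bornology.IsBounded D) {μ : ℝ} {φ : F → ℝ} {Dφ : F → F}
    (hφ : IsFirstDirichletEigenpair D μ φ Dφ) {H : F → ℝ} (hH : IsC2Closure D H)
    (hle : ∀ x ∈ D, Δ H x ≤ 0) (hne : ∃ x ∈ D, Δ H x ≠ 0) :
    ∫ x in D, φ x ^ 2 * Δ H x < 0 := by
  obtain ⟨C, -, hC⟩ := hH.exists_bound hDb
  have hcont := continuousOn_laplacian hD hH.1
  have mφ := hφ.eigenpair.mem.memLp
  have hint : Integrable (fun x => -(φ x ^ 2 * Δ H x)) (volume.restrict D) := by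
    have h1 := memLp_bdd_smul mφ ((ae_restrict_mem hD.measurableSet).mono fun x hx => (hC x hx).2.2)
      (hcont.aestronglyMeasurable hD.measurableSet)
    have := (integrable_smul_of_memLp mφ h1).neg
    refine this.congr (Eventually.of_forall fun x => ?_)
    simp only [Pi.neg_apply, smul_eq_mul]
    ring
  have hnn : 0 ≤ᵐ[volume.restrict D] fun x => -(φ x ^ 2 * Δ H x) := by
    filter_upwards [ae_restrict_mem hD.measurableSet] with x hx
    have := mul_nonneg (sq_nonneg (φ x)) (neg_nonneg.2 (hle x hx))
    change 0 ≤ -(φ x ^ 2 * Δ H x)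
    linarith
  rw [← neg_pos, ← integral_neg]
  refine (integral_nonneg_of_ae hnn).lt_of_ne' fun hz => ?_
  have hz' := (ae_restrict_iff' hD.measurableSet).1
    ((integral_eq_zero_iff_of_nonneg_ae hnn hint).1 hz)
  obtain ⟨x₀, hx₀, hne⟩ := hne
  have hev : ∀ᶠ x in 𝓝 x₀, x ∈ D ∧ Δ H x ≠ 0 :=
    (hD.eventually_mem hx₀).and ((hcont.continuousAt (hD.mem_nhds hx₀)).eventually_ne hne)
  obtain ⟨r, hr, hball⟩ := Metric.eventually_nhds_iff_ball.1 hev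
  refine hφ.not_ae_eq_zero_ball hD hDc hDb hx₀ hr ?_
  filter_upwards [hz'] with x hx hxr
  have h1 := hx (hball x hxr).1
  simpa [(hball x hxr).2] using h1

end Positivity

/-! ### Geometry of the cylinder -/

section Geometry

variable {d : ℕ} {D : Set (EuclideanSpace ℝ (Fin d))} {H : EuclideanSpace ℝ (Fin d) → ℝ}

/-- The point `(η, ζ)` of the space `ℝᵈ × ℝ`. -/
abbrev Cyl.mk (η : EuclideanSpace ℝ (Fin d)) (ζ : ℝ) : Cyl d := WithLp.toLp 2 (η, ζ)

theorem contDiff_cylFst {n : WithTop ℕ∞} : ContDiff ℝ n fun ξ : Cyl d => ξ.fst :=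
  (WithLp.fstL 2 ℝ (EuclideanSpace ℝ (Fin d)) ℝ).contDiff

theorem contDiff_cylSnd {n : WithTop ℕ∞} : ContDiff ℝ n fun ξ : Cyl d => ξ.snd :=
  (WithLp.sndL 2 ℝ (EuclideanSpace ℝ (Fin d)) ℝ).contDiff

/-- The linear isomorphism between the plain product and the Euclidean product. -/
noncomputable def Cyl.mkL : EuclideanSpace ℝ (Fin d) × ℝ →L[ℝ] Cyl d :=
  (WithLp.prodContinuousLinearEquiv 2 ℝ (EuclideanSpace ℝ (Fin d)) ℝ).symm.toContinuousLinearMap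

theorem Cyl.norm_fst_le (ξ : Cyl d) : ‖ξ.fst‖ ≤ ‖ξ‖ := by
  have := WithLp.prod_norm_sq_eq_of_L2 ξ
  nlinarith [norm_nonneg ξ, norm_nonneg ξ.fst, sq_nonneg ‖ξ.snd‖]

theorem Cyl.norm_snd_le (ξ : Cyl d) : ‖ξ.snd‖ ≤ ‖ξ‖ := by
  have := WithLp.prod_norm_sq_eq_of_L2 ξ
  nlinarith [norm_nonneg ξ, norm_nonneg ξ.snd, sq_nonneg ‖ξ.fst‖]

theorem Cyl.norm_mk_le (η : EuclideanSpace ℝ (Fin d)) (ζ : ℝ) :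
    ‖Cyl.mk η ζ‖ ≤ ‖η‖ + ‖ζ‖ := by
  have h := WithLp.prod_norm_sq_eq_of_L2 (Cyl.mk η ζ)
  change ‖Cyl.mk η ζ‖ ^ 2 = ‖η‖ ^ 2 + ‖ζ‖ ^ 2 at h
  nlinarith [norm_nonneg (Cyl.mk η ζ), norm_nonneg η, norm_nonneg ζ,
    mul_nonneg (norm_nonneg η) (norm_nonneg ζ)]

theorem isOpen_semiCylinder (hD : IsOpen D) (hH : ContinuousOn H D) :
    IsOpen (semiCylinder D H) := by
  have h1 : IsOpen {ξ : Cyl d | ξ.fst ∈ D} := hD.preimage (by fun_prop)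
  have h2 : ContinuousOn (fun ξ : Cyl d => ξ.snd + H ξ.fst) {ξ : Cyl d | ξ.fst ∈ D} :=
    (Continuous.continuousOn (by fun_prop)).add
      (hH.comp (Continuous.continuousOn (by fun_prop)) fun ξ hξ => hξ)
  have h3 := h2.isOpen_inter_preimage h1 isOpen_Ioi (t := Ioi 0)
  convert h3 using 1
  ext ξ
  simp only [semiCylinder, mem_ofPred_eq, mem_inter_iff, mem_preimage, mem_Ioi]
  constructor <;> rintro ⟨h4, h5⟩ <;> exact ⟨h4, by linarith⟩

/-- The lateral side lies over the boundary of the cross-section. -/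
theorem closure_lateralSide_subset (hD : IsOpen D) (hH : ContinuousOn H D) :
    closure (lateralSide D H) ⊆ {ξ | ξ.fst ∈ frontier D} := by
  refine closure_minimal ?_ (isClosed_frontier.preimage (by fun_prop))
  rintro ξ ⟨h1, h2⟩
  rw [(isOpen_semiCylinder hD hH).frontier_eq] at h1
  rw [mem_ofPred_eq, hD.frontier_eq]
  refine ⟨?_, fun hξ => ?_⟩
  · have : closure (semiCylinder D H) ⊆ {ξ | ξ.fst ∈ closure D} :=
      closure_minimal (fun x hx => subset_closure hx.1) (isClosed_closure.preimage (by fun_prop))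
    exact this h1.1
  · have hle : ξ.snd ≤ -H ξ.fst := by
      by_contra! h
      exact h1.2 ⟨hξ, h⟩
    rcases hle.lt_or_eq with h3 | h3
    · -- a point below the curved end has a neighbourhood free of points of the cylinder
      have h4 : ∀ᶠ x : Cyl d in 𝓝 ξ, x.fst ∈ D ∧ x.snd < -H x.fst := by
        have c1 : ContinuousAt (fun x : Cyl d => x.snd + H x.fst) ξ := by
          refine ContinuousAt.add (Continuous.continuousAt (by fun_prop)) ?_
          exact ContinuousAt.comp (f := fun x : Cyl d => x.fst)
            (hH.continuousAt (hD.mem_nhds hξ)) (Continuous.continuousAt (by fun_prop))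
        have c2 : ∀ᶠ x : Cyl d in 𝓝 ξ, x.snd + H x.fst < 0 :=
          c1.eventually_lt continuousAt_const (by linarith)
        have c3 : ∀ᶠ x : Cyl d in 𝓝 ξ, x.fst ∈ D :=
          (hD.preimage (f := fun x : Cyl d => x.fst) (by fun_prop)).eventually_mem hξ
        filter_upwards [c2, c3] with x hx hx'
        exact ⟨hx', by linarith⟩
      obtain ⟨x, hx, hx'⟩ := mem_closure_iff_frequently.1 h1.1 |>.and_eventually h4 |>.exists
      exact absurd hx.2 (not_lt.2 hx'.2.le)
    · exact h2 (subset_closure ⟨hξ, h3⟩)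

/-- The points above the curved end and over the boundary of the cross-section belong to the
lateral side. Here `g` is the continuous extension of `H` to `closure D`, and it is needed because
`H` has no meaning on the boundary. -/
theorem mem_lateralSide (hD : IsOpen D) {g : EuclideanSpace ℝ (Fin d) → ℝ}
    (hg : ContinuousOn g (closure D)) (hHg : EqOn H g D) {η : EuclideanSpace ℝ (Fin d)}
    (hη : η ∈ frontier D) {ζ : ℝ} (hζ : -g η < ζ) : Cyl.mk η ζ ∈ lateralSide D H := by
  have hηc : η ∈ closure D := frontier_subset_closure hη
  have hηn : η ∉ D := fun h => (hD.frontier_eq ▸ hη).2 h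
  refine ⟨⟨?_, fun h => hηn (interior_subset h).1⟩, fun h => ?_⟩
  · have : (𝓝[D] η).NeBot := mem_closure_iff_nhdsWithin_neBot.1 hηc
    have h1 : Tendsto (fun η' => Cyl.mk η' ζ) (𝓝[D] η) (𝓝 (Cyl.mk η ζ)) := by
      have : Continuous fun η' : EuclideanSpace ℝ (Fin d) => Cyl.mk η' ζ := by fun_prop
      exact (this.tendsto η).mono_left nhdsWithin_le_nhds
    refine mem_closure_of_tendsto h1 ?_
    have h2 : Tendsto g (𝓝[D] η) (𝓝 (g η)) := (hg η hηc).mono subset_closure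
    filter_upwards [h2.eventually (lt_mem_nhds (by linarith : -ζ < g η)),
      self_mem_nhdsWithin] with η' h3 h4
    refine ⟨h4, ?_⟩
    change -H η' < ζ
    rw [hHg h4]
    linarith
  · have hc : IsClosed ({ξ : Cyl d | ξ.fst ∈ closure D} ∩
        (fun ξ : Cyl d => ξ.snd + g ξ.fst) ⁻¹' {0}) := by
      refine ContinuousOn.preimage_isClosed_of_isClosed ?_
        (isClosed_closure.preimage (by fun_prop)) isClosed_singleton
      exact (Continuous.continuousOn (by fun_prop)).add
        (hg.comp (Continuous.continuousOn (by fun_prop)) fun ξ hξ => hξ)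
    have hcurve : curvedEnd D H ⊆ {ξ : Cyl d | ξ.fst ∈ closure D} ∩
        (fun ξ : Cyl d => ξ.snd + g ξ.fst) ⁻¹' {0} := by
      intro ξ hξ
      have h1 : ξ.snd = -H ξ.fst := hξ.2
      exact ⟨subset_closure hξ.1, by simp [h1, hHg hξ.1]⟩
    have h2 : ζ + g η = 0 := (closure_minimal hcurve hc h).2
    linarith

/-! ### Integration over the cylinder -/

/-- The shear `(η, ζ) ↦ (η, ζ + h η)`. -/
noncomputable def shear (h : EuclideanSpace ℝ (Fin d) → ℝ) (ξ : Cyl d) : Cyl d :=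
  Cyl.mk ξ.fst (ξ.snd + h ξ.fst)

theorem shear_neg_shear (h : EuclideanSpace ℝ (Fin d) → ℝ) (ξ : Cyl d) :
    shear (fun η => -h η) (shear h ξ) = ξ := by
  change Cyl.mk ξ.fst (ξ.snd + h ξ.fst + -h ξ.fst) = ξ
  rw [add_neg_cancel_right]
  rfl

theorem measurable_shear {h : EuclideanSpace ℝ (Fin d) → ℝ} (hh : Measurable h) :
    Measurable (shear h) := by
  have h1 : Measurable fun ξ : Cyl d => (ξ.fst, ξ.snd + h ξ.fst) :=
    (by fun_prop : Measurable fun ξ : Cyl d => ξ.fst).prodMk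
      ((by fun_prop : Measurable fun ξ : Cyl d => ξ.snd).add
        (hh.comp (by fun_prop : Measurable fun ξ : Cyl d => ξ.fst)))
  exact (MeasurableEquiv.toLp 2 (EuclideanSpace ℝ (Fin d) × ℝ)).measurable.comp h1

theorem measurePreserving_shear {h : EuclideanSpace ℝ (Fin d) → ℝ} (hh : Measurable h) :
    MeasurePreserving (shear h) := by
  have h1 : MeasurePreserving (fun p : EuclideanSpace ℝ (Fin d) × ℝ => (p.1, p.2 + h p.1))
      volume volume := by
    refine (MeasurePreserving.id volume).skew_product (g := fun η ζ => ζ + h η) ?_ ?_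
    · exact measurable_snd.add (hh.comp measurable_fst)
    · exact Eventually.of_forall fun η => (measurePreserving_add_right volume (h η)).map_eq
  exact (WithLp.volume_preserving_toLp (EuclideanSpace ℝ (Fin d)) ℝ).comp
    (h1.comp (WithLp.volume_preserving_ofLp (EuclideanSpace ℝ (Fin d)) ℝ))

theorem measurableEmbedding_shear {h : EuclideanSpace ℝ (Fin d) → ℝ} (hh : Measurable h) :
    MeasurableEmbedding (shear h) := by
  let e : Cyl d ≃ᵐ Cyl d :=
    { toFun := shear h
      invFun := shear fun η => -h η
      left_inv := shear_neg_shear h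
      right_inv := fun ξ => by simpa using shear_neg_shear (fun η => -h η) ξ
      measurable_toFun := measurable_shear hh
      measurable_invFun := measurable_shear hh.neg }
  exact e.measurableEmbedding

/-- Fubini's theorem in the cylinder, the inner integral being over the generators. -/
theorem integral_semiCylinder (hD : IsOpen D) (hH : ContinuousOn H D) {k : Cyl d → ℝ}
    (hk : IntegrableOn k (semiCylinder D H)) :
    ∫ ξ in semiCylinder D H, k ξ = ∫ η in D, ∫ ζ in Ioi (-H η), k (Cyl.mk η ζ) := by
  have hm : MeasurableSet (semiCylinder D H) := (isOpen_semiCylinder hD hH).measurableSet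
  have hi := hk.integrable_indicator hm
  have hp := WithLp.volume_preserving_toLp (EuclideanSpace ℝ (Fin d)) ℝ
  have he : MeasurableEmbedding (WithLp.toLp 2 : EuclideanSpace ℝ (Fin d) × ℝ → Cyl d) :=
    (MeasurableEquiv.toLp 2 (EuclideanSpace ℝ (Fin d) × ℝ)).measurableEmbedding
  rw [← integral_indicator hm, ← hp.integral_comp he]
  have hi' := (hp.integrable_comp_emb he).2 hi
  rw [Measure.volume_eq_prod] at hi' ⊢
  refine (integral_prod _ hi').trans ?_
  rw [← integral_indicator hD.measurableSet]
  refine integral_congr_ae (Eventually.of_forall fun η => ?_)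
  dsimp only [Function.comp_apply]
  by_cases hη : η ∈ D
  · rw [indicator_of_mem hη, ← integral_indicator measurableSet_Ioi]
    congr 1
    ext ζ
    by_cases hζ : -H η < ζ
    · have h1 : Cyl.mk η ζ ∈ semiCylinder D H := ⟨hη, hζ⟩
      rw [indicator_of_mem h1, indicator_of_mem (mem_Ioi.2 hζ)]
    · have h1 : Cyl.mk η ζ ∉ semiCylinder D H := fun h => hζ h.2
      rw [indicator_of_notMem h1, indicator_of_notMem (fun h => hζ (mem_Ioi.1 h))]
  · rw [indicator_of_notMem hη]
    have : ∀ ζ, (semiCylinder D H).indicator k (Cyl.mk η ζ) = 0 := fun ζ =>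
      indicator_of_notMem (fun h => hη h.1) _
    simp only [this, integral_zero]

/-- Fubini's theorem in a half-cylinder with a flat end, the inner integral being over the
cross-sections. -/
theorem integral_flatCylinder (D : Set (EuclideanSpace ℝ (Fin d))) (R : ℝ) {k : Cyl d → ℝ}
    (hk : IntegrableOn k {ξ | ξ.fst ∈ D ∧ R < ξ.snd}) :
    IntegrableOn (fun ζ => ∫ η in D, k (Cyl.mk η ζ)) (Ioi R) ∧
    ∫ ξ in {ξ : Cyl d | ξ.fst ∈ D ∧ R < ξ.snd}, k ξ =
      ∫ ζ in Ioi R, ∫ η in D, k (Cyl.mk η ζ) := by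
  have hp := WithLp.volume_preserving_toLp (EuclideanSpace ℝ (Fin d)) ℝ
  have he : MeasurableEmbedding (WithLp.toLp 2 : EuclideanSpace ℝ (Fin d) × ℝ → Cyl d) :=
    (MeasurableEquiv.toLp 2 (EuclideanSpace ℝ (Fin d) × ℝ)).measurableEmbedding
  have hpre : (WithLp.toLp 2 : EuclideanSpace ℝ (Fin d) × ℝ → Cyl d) ⁻¹'
      {ξ : Cyl d | ξ.fst ∈ D ∧ R < ξ.snd} = D ×ˢ Ioi R := by
    ext p
    rfl
  have hi := (hp.integrableOn_comp_preimage he).2 hk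
  rw [hpre, IntegrableOn, Measure.volume_eq_prod, ← Measure.prod_restrict] at hi
  refine ⟨hi.integral_prod_right, ?_⟩
  rw [← hp.setIntegral_preimage_emb he, hpre, Measure.volume_eq_prod, ← Measure.prod_restrict]
  exact integral_prod_symm _ hi

end Geometry

/-! ### Test functions on cross-sections and in the straightened cylinder -/

section Straighten

variable {d : ℕ} {D : Set (EuclideanSpace ℝ (Fin d))} {H : EuclideanSpace ℝ (Fin d) → ℝ}

/-- Above the curved end, the slices of a test function are test functions for the Dirichlet
problem in the cross-section. -/
theorem IsTest.slice (hD : IsOpen D) {g : EuclideanSpace ℝ (Fin d) → ℝ}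
    (hg : ContinuousOn g (closure D)) (hHg : EqOn H g D) {R : ℝ} (hR : ∀ η ∈ closure D, -g η ≤ R)
    {f : Cyl d → ℝ} (hf : IsTest (lateralSide D H) f) {ζ : ℝ} (hζ : R < ζ) :
    IsTest (frontier D) fun η => f (Cyl.mk η ζ) := by
  have hc : Continuous fun η : EuclideanSpace ℝ (Fin d) => Cyl.mk η ζ := by fun_prop
  have hsub : tsupport (fun η => f (Cyl.mk η ζ)) ⊆ {η | Cyl.mk η ζ ∈ tsupport f} :=
    closure_minimal (fun η hη => subset_tsupport f hη) ((isClosed_tsupport f).preimage hc)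
  refine ⟨?_, ?_, ?_⟩
  · have : ContDiff ℝ ∞ fun η : EuclideanSpace ℝ (Fin d) => Cyl.mk η ζ :=
      Cyl.mkL.contDiff.comp (contDiff_id.prodMk contDiff_const)
    exact hf.contDiff.comp this
  · have hcpt : IsCompact ((fun ξ : Cyl d => ξ.fst) '' tsupport f) :=
      hf.compact.isCompact.image (by fun_prop)
    exact hcpt.of_isClosed_subset (isClosed_tsupport _) fun η hη => ⟨_, hsub hη, rfl⟩
  · rw [isClosed_frontier.closure_eq]
    refine disjoint_left.2 fun η hη hη' => disjoint_left.1 hf.disj (hsub hη) (subset_closure ?_)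
    exact mem_lateralSide hD hg hHg hη'
      ((hR η (frontier_subset_closure hη')).trans_lt hζ)

theorem norm_gradient_slice_le {f : Cyl d → ℝ} (hf : Differentiable ℝ f)
    (η : EuclideanSpace ℝ (Fin d)) (ζ : ℝ) :
    ‖∇ (fun η => f (Cyl.mk η ζ)) η‖ ≤ ‖∇ f (Cyl.mk η ζ)‖ := by
  have h1 : HasFDerivAt (fun η : EuclideanSpace ℝ (Fin d) => Cyl.mk η ζ)
      (Cyl.mkL.comp (ContinuousLinearMap.inl ℝ (EuclideanSpace ℝ (Fin d)) ℝ)) η := by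
    have := (Cyl.mkL (d := d)).hasFDerivAt.comp η (hasFDerivAt_prodMk_left η ζ)
    exact this
  have h2 := (hf (Cyl.mk η ζ)).hasFDerivAt.comp η h1
  have h3 : HasFDerivAt (fun η => f (Cyl.mk η ζ)) _ η := h2
  rw [norm_gradient, norm_gradient, h3.fderiv]
  refine (ContinuousLinearMap.opNorm_comp_le _ _).trans
    (mul_le_of_le_one_right (norm_nonneg _) ?_)
  refine ContinuousLinearMap.opNorm_le_bound _ zero_le_one fun v => ?_
  rw [one_mul]
  exact (WithLp.norm_toLp_fst 2 (EuclideanSpace ℝ (Fin d)) ℝ v).le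

/-- In the flat part of the cylinder the Rayleigh quotient is at least the first eigenvalue of the
cross-section. -/
theorem rayleigh_flatCylinder (hD : IsOpen D) (hDb : Bornology.IsBounded D)
    {g : EuclideanSpace ℝ (Fin d) → ℝ}
    (hg : ContinuousOn g (closure D)) (hHg : EqOn H g D) {R : ℝ} (hR : ∀ η ∈ closure D, -g η ≤ R)
    {μ : ℝ} {φ : EuclideanSpace ℝ (Fin d) → ℝ}
    {Dφ : EuclideanSpace ℝ (Fin d) → EuclideanSpace ℝ (Fin d)}
    (hφ : IsFirstDirichletEigenpair D μ φ Dφ)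
    {f : Cyl d → ℝ} (hf : IsTest (lateralSide D H) f) :
    μ * ∫ ξ in {ξ : Cyl d | ξ.fst ∈ D ∧ R < ξ.snd}, f ξ ^ 2 ≤
      ∫ ξ in {ξ : Cyl d | ξ.fst ∈ D ∧ R < ξ.snd}, ‖∇ f ξ‖ ^ 2 := by
  obtain ⟨i1, e1⟩ := integral_flatCylinder D R (k := fun ξ => f ξ ^ 2)
    (hf.memLp {ξ : Cyl d | ξ.fst ∈ D ∧ R < ξ.snd}).integrable_sq
  obtain ⟨i2, e2⟩ := integral_flatCylinder D R (k := fun ξ => ‖∇ f ξ‖ ^ 2)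
    (hf.memLp_gradient {ξ : Cyl d | ξ.fst ∈ D ∧ R < ξ.snd}).norm.integrable_sq
  rw [e1, e2, ← integral_const_mul]
  refine setIntegral_mono_on (i1.const_mul μ) i2 measurableSet_Ioi fun ζ hζ => ?_
  have hs := hf.slice hD hg hHg hR hζ
  have hc : Continuous fun η : EuclideanSpace ℝ (Fin d) => Cyl.mk η ζ := by fun_prop
  refine (hφ.rayleigh hD hDb hs).trans ?_
  refine integral_mono_of_nonneg (Eventually.of_forall fun η => sq_nonneg _) ?_
    (Eventually.of_forall fun η => ?_)
  · have hcs : HasCompactSupport fun η => ∇ f (Cyl.mk η ζ) := by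
      have hcpt : IsCompact ((fun ξ : Cyl d => ξ.fst) '' tsupport (∇ f)) :=
        (hasCompactSupport_gradient hf.compact).isCompact.image (by fun_prop)
      exact HasCompactSupport.of_support_subset_isCompact hcpt
        fun η hη => ⟨_, subset_tsupport _ hη, rfl⟩
    exact (memLp_of_compactSupport (hf.continuous_gradient.comp hc) hcs D).norm.integrable_sq
  · dsimp only
    gcongr
    exact norm_gradient_slice_le hf.differentiable η ζ

/-- The change of variables `(η, t) ↦ (η, t - H η)` from the straight cylinder onto the curved
one. Over the complement of `D`, where `H` is arbitrary, it is the identity, and so it is a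
measure-preserving bijection of the whole space. -/
noncomputable def straighten (D : Set (EuclideanSpace ℝ (Fin d)))
    (H : EuclideanSpace ℝ (Fin d) → ℝ) : Cyl d → Cyl d :=
  shear fun η => -D.indicator H η

theorem measurable_indicator_of_continuousOn (hD : IsOpen D) (hH : ContinuousOn H D) :
    Measurable (D.indicator H) := by
  classical
  have := hH.measurable_piecewise (continuousOn_const (c := (0 : ℝ)) (s := Dᶜ)) hD.measurableSet
  exact piecewise_eq_indicator (s := D) (f := H) ▸ this

theorem straighten_eq {ξ : Cyl d} (hξ : ξ.fst ∈ D) :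
    straighten D H ξ = Cyl.mk ξ.fst (ξ.snd - H ξ.fst) := by
  simp [straighten, shear, hξ, sub_eq_add_neg]

theorem straighten_preimage :
    straighten D H ⁻¹' semiCylinder D H = {ξ | ξ.fst ∈ D ∧ 0 < ξ.snd} := by
  ext ξ
  simp only [mem_preimage, mem_ofPred_eq]
  constructor
  · rintro ⟨h1, h2⟩
    have h1' : ξ.fst ∈ D := h1
    rw [straighten_eq h1'] at h2
    change -H ξ.fst < ξ.snd - H ξ.fst at h2
    exact ⟨h1', by linarith⟩
  · rintro ⟨h1, h2⟩
    rw [straighten_eq h1]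
    refine ⟨h1, ?_⟩
    change -H ξ.fst < ξ.snd - H ξ.fst
    linarith

/-- A function on the curved cylinder, in the straightened coordinates, extended by zero. -/
noncomputable def pullback (D : Set (EuclideanSpace ℝ (Fin d)))
    (H : EuclideanSpace ℝ (Fin d) → ℝ) (f : Cyl d → ℝ) : Cyl d → ℝ :=
  {ξ : Cyl d | ξ.fst ∈ D}.indicator (f ∘ straighten D H)

/-- In the upper half-space the pull-back of a test function vanishes near the points that are not
over `D`: the points over `frontier D` correspond to points of the lateral side. -/
theorem pullback_eventually_zero (hD : IsOpen D) {g : EuclideanSpace ℝ (Fin d) → ℝ}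
    (hg : ContinuousOn g (closure D)) (hHg : EqOn H g D)
    {f : Cyl d → ℝ} (hf : IsTest (lateralSide D H) f) {ξ : Cyl d} (hξ : ξ.fst ∉ D)
    (hpos : 0 < ξ.snd) : pullback D H f =ᶠ[𝓝 ξ] 0 := by
  by_cases hcl : ξ.fst ∈ closure D
  · have hfr : ξ.fst ∈ frontier D := by
      rw [hD.frontier_eq]; exact ⟨hcl, hξ⟩
    have hp : Cyl.mk ξ.fst (ξ.snd - g ξ.fst) ∉ tsupport f := fun h =>
      disjoint_left.1 hf.disj h (subset_closure (mem_lateralSide hD hg hHg hfr (by linarith)))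
    have h1 : f =ᶠ[𝓝 (Cyl.mk ξ.fst (ξ.snd - g ξ.fst))] 0 := notMem_tsupport_iff_eventuallyEq.1 hp
    have hgt : Tendsto (fun x : Cyl d => g x.fst) (𝓝[{x : Cyl d | x.fst ∈ D}] ξ)
        (𝓝 (g ξ.fst)) := by
      have h2 : Tendsto (fun x : Cyl d => x.fst) (𝓝[{x : Cyl d | x.fst ∈ D}] ξ)
          (𝓝[closure D] ξ.fst) := by
        refine tendsto_nhdsWithin_iff.2 ⟨?_, ?_⟩
        · exact ((by fun_prop : Continuous fun x : Cyl d => x.fst).tendsto ξ).mono_left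
            nhdsWithin_le_nhds
        · filter_upwards [self_mem_nhdsWithin] with x hx using subset_closure hx
      exact (hg _ hcl).tendsto.comp h2
    have hfs : Tendsto (fun x : Cyl d => x.fst) (𝓝[{x : Cyl d | x.fst ∈ D}] ξ) (𝓝 ξ.fst) :=
      ((by fun_prop : Continuous fun x : Cyl d => x.fst).tendsto ξ).mono_left nhdsWithin_le_nhds
    have hsn : Tendsto (fun x : Cyl d => x.snd) (𝓝[{x : Cyl d | x.fst ∈ D}] ξ) (𝓝 ξ.snd) :=
      ((by fun_prop : Continuous fun x : Cyl d => x.snd).tendsto ξ).mono_left nhdsWithin_le_nhds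
    have h3 : Tendsto (fun x : Cyl d => Cyl.mk x.fst (x.snd - g x.fst))
        (𝓝[{x : Cyl d | x.fst ∈ D}] ξ) (𝓝 (Cyl.mk ξ.fst (ξ.snd - g ξ.fst))) :=
      ((WithLp.prod_continuous_toLp 2 _ _).tendsto _).comp (hfs.prodMk_nhds (hsn.sub hgt))
    have h4 := eventually_nhdsWithin_iff.1 (h3.eventually h1)
    filter_upwards [h4] with x hx
    by_cases hxD : x.fst ∈ D
    · have hxD' : x ∈ {ξ : Cyl d | ξ.fst ∈ D} := hxD
      rw [pullback, indicator_of_mem hxD', Function.comp_apply, straighten_eq hxD, hHg hxD]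
      exact hx hxD
    · have hxD' : x ∉ {ξ : Cyl d | ξ.fst ∈ D} := hxD
      rw [pullback, indicator_of_notMem hxD']
      rfl
  · have h1 : ∀ᶠ x : Cyl d in 𝓝 ξ, x.fst ∈ (closure D)ᶜ :=
      (isClosed_closure.isOpen_compl.preimage
        (by fun_prop : Continuous fun x : Cyl d => x.fst)).eventually_mem hcl
    filter_upwards [h1] with x hx
    have hxD : x ∉ {ξ : Cyl d | ξ.fst ∈ D} := fun h => hx (subset_closure h)
    rw [pullback, indicator_of_notMem hxD]
    rfl

theorem pullback_eventuallyEq (hD : IsOpen D) (f : Cyl d → ℝ) {ξ : Cyl d} (hξ : ξ.fst ∈ D) :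
    pullback D H f =ᶠ[𝓝 ξ] fun x => f (Cyl.mk x.fst (x.snd - H x.fst)) := by
  have h1 : ∀ᶠ x : Cyl d in 𝓝 ξ, x.fst ∈ D :=
    (hD.preimage (by fun_prop : Continuous fun x : Cyl d => x.fst)).eventually_mem hξ
  filter_upwards [h1] with x hx
  have hx' : x ∈ {ξ : Cyl d | ξ.fst ∈ D} := hx
  rw [pullback, indicator_of_mem hx', Function.comp_apply, straighten_eq hx]

/-- The pull-back of a test function is of class `C¹` in the open half-space. -/
theorem contDiffAt_pullback (hD : IsOpen D) {g : EuclideanSpace ℝ (Fin d) → ℝ}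
    (hg : ContinuousOn g (closure D)) (hHg : EqOn H g D) (hH : ContDiffOn ℝ 1 H D)
    {f : Cyl d → ℝ} (hf : IsTest (lateralSide D H) f) {ξ : Cyl d} (hpos : 0 < ξ.snd) :
    ContDiffAt ℝ 1 (pullback D H f) ξ := by
  by_cases hξ : ξ.fst ∈ D
  · refine ContDiffAt.congr_of_eventuallyEq ?_ (pullback_eventuallyEq hD f hξ)
    have h1 : ContDiffAt ℝ 1 (fun x : Cyl d => H x.fst) ξ :=
      ContDiffAt.comp (g := H) (f := fun x : Cyl d => x.fst) ξ
        (hH.contDiffAt (hD.mem_nhds hξ)) contDiff_cylFst.contDiffAt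
    have h2 : ContDiffAt ℝ 1 (fun x : Cyl d => Cyl.mk x.fst (x.snd - H x.fst)) ξ :=
      Cyl.mkL.contDiff.contDiffAt.comp ξ
        (contDiff_cylFst.contDiffAt.prodMk (contDiff_cylSnd.contDiffAt.sub h1))
    exact ContDiffAt.comp (f := fun x : Cyl d => Cyl.mk x.fst (x.snd - H x.fst)) ξ
      (hf.contDiff.of_le (by simp)).contDiffAt h2
  · exact contDiffAt_const.congr_of_eventuallyEq (pullback_eventually_zero hD hg hHg hf hξ hpos)

theorem norm_fderiv_comp_le {E F : Type*} [NormedAddCommGroup E] [NormedSpace ℝ E]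
    [NormedAddCommGroup F] [NormedSpace ℝ F] {f : F → ℝ} {s : E → F} {L : E →L[ℝ] F} {x : E}
    (hf : DifferentiableAt ℝ f (s x)) (hs : HasFDerivAt s L x) :
    ‖fderiv ℝ (fun y => f (s y)) x‖ ≤ ‖L‖ * ‖fderiv ℝ f (s x)‖ := by
  have h : HasFDerivAt (fun y => f (s y)) _ x := hf.hasFDerivAt.comp x hs
  rw [h.fderiv, mul_comm]
  exact ContinuousLinearMap.opNorm_comp_le _ _

/-- A bound for the derivative of the change of variables. -/
theorem norm_le_of_apply_eq_mk {C : ℝ} (hC0 : 0 ≤ C) (A : EuclideanSpace ℝ (Fin d) →L[ℝ] ℝ)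
    (hA : ‖A‖ ≤ C) (L : Cyl d →L[ℝ] Cyl d) (hL : ∀ v, L v = Cyl.mk v.fst (v.snd - A v.fst)) :
    ‖L‖ ≤ 2 + C := by
  refine ContinuousLinearMap.opNorm_le_bound _ (by positivity) fun v => ?_
  rw [hL]
  refine (Cyl.norm_mk_le _ _).trans ?_
  have h1 : ‖A v.fst‖ ≤ C * ‖v‖ :=
    (A.le_opNorm _).trans (mul_le_mul hA (Cyl.norm_fst_le v) (norm_nonneg _) hC0)
  have h2 := norm_sub_le v.snd (A v.fst)
  have h3 := Cyl.norm_fst_le v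
  have h4 := Cyl.norm_snd_le v
  linarith

theorem norm_fderiv_pullback_le (hD : IsOpen D) (hH : ContDiffOn ℝ 1 H D) {C : ℝ}
    (hC : ∀ η ∈ D, ‖∇ H η‖ ≤ C) {f : Cyl d → ℝ} (hf : Differentiable ℝ f)
    {ξ : Cyl d} (hξ : ξ.fst ∈ D) :
    ‖fderiv ℝ (pullback D H f) ξ‖ ≤ (2 + C) * ‖∇ f (straighten D H ξ)‖ := by
  have hd1 : HasFDerivAt (fun x : Cyl d => x.fst)
      (WithLp.fstL 2 ℝ (EuclideanSpace ℝ (Fin d)) ℝ) ξ :=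
    (WithLp.fstL 2 ℝ (EuclideanSpace ℝ (Fin d)) ℝ).hasFDerivAt
  have hd2 : HasFDerivAt (fun x : Cyl d => x.snd)
      (WithLp.sndL 2 ℝ (EuclideanSpace ℝ (Fin d)) ℝ) ξ :=
    (WithLp.sndL 2 ℝ (EuclideanSpace ℝ (Fin d)) ℝ).hasFDerivAt
  have hdH : HasFDerivAt H (fderiv ℝ H ξ.fst) ξ.fst :=
    ((hH.contDiffAt (hD.mem_nhds hξ)).differentiableAt one_ne_zero).hasFDerivAt
  have hdH' : HasFDerivAt (fun x : Cyl d => H x.fst) _ ξ :=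
    HasFDerivAt.comp (f := fun x : Cyl d => x.fst) ξ hdH hd1
  have hC' := hC _ hξ
  rw [norm_gradient] at hC'
  obtain ⟨L, hL, hLn⟩ : ∃ L : Cyl d →L[ℝ] Cyl d,
      HasFDerivAt (fun x : Cyl d => Cyl.mk x.fst (x.snd - H x.fst)) L ξ ∧ ‖L‖ ≤ 2 + C :=
    ⟨_, Cyl.mkL.hasFDerivAt.comp ξ (hd1.prodMk (hd2.sub hdH')),
      norm_le_of_apply_eq_mk ((norm_nonneg _).trans hC') _ hC' _ fun v => rfl⟩
  rw [(pullback_eventuallyEq hD f hξ).fderiv_eq, norm_gradient, straighten_eq hξ]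
  exact (norm_fderiv_comp_le (hf _) hL).trans (mul_le_mul_of_nonneg_right hLn (norm_nonneg _))

/-- The Dirichlet integral in the straightened coordinates is bounded by the one in the curved
cylinder. -/
theorem lintegral_fderiv_pullback_le (hD : IsOpen D) {g : EuclideanSpace ℝ (Fin d) → ℝ}
    (hg : ContinuousOn g (closure D)) (hHg : EqOn H g D) (hH : ContDiffOn ℝ 1 H D) {C : ℝ}
    (hC0 : 0 ≤ C) (hC : ∀ η ∈ D, ‖∇ H η‖ ≤ C) {f : Cyl d → ℝ} (hf : IsTest (lateralSide D H) f) :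
    ∫⁻ ξ in {ξ : Cyl d | 0 < ξ.snd}, ‖fderiv ℝ (pullback D H f) ξ‖ₑ ^ 2 ≤
      ENNReal.ofReal ((2 + C) ^ 2 * ∫ ξ in semiCylinder D H, ‖∇ f ξ‖ ^ 2) := by
  have hm : Measurable fun η => -D.indicator H η :=
    (measurable_indicator_of_continuousOn hD hH.continuousOn).neg
  have hmD : MeasurableSet {ξ : Cyl d | ξ.fst ∈ D} :=
    (hD.preimage (by fun_prop : Continuous fun x : Cyl d => x.fst)).measurableSet
  have hms : MeasurableSet {ξ : Cyl d | 0 < ξ.snd} :=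
    (isOpen_Ioi.preimage (by fun_prop : Continuous fun x : Cyl d => x.snd)).measurableSet
  calc ∫⁻ ξ in {ξ : Cyl d | 0 < ξ.snd}, ‖fderiv ℝ (pullback D H f) ξ‖ₑ ^ 2
      ≤ ∫⁻ ξ in {ξ : Cyl d | 0 < ξ.snd}, {ξ : Cyl d | ξ.fst ∈ D}.indicator
          (fun ξ => ENNReal.ofReal ((2 + C) ^ 2) * ‖∇ f (straighten D H ξ)‖ₑ ^ 2) ξ := by
        refine setLIntegral_mono' hms fun ξ hξ => ?_
        by_cases h : ξ.fst ∈ D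
        · have h' : ξ ∈ {ξ : Cyl d | ξ.fst ∈ D} := h
          rw [indicator_of_mem h', enorm_sq_eq_ofReal, enorm_sq_eq_ofReal,
            ← ENNReal.ofReal_mul (by positivity), ← mul_pow]
          gcongr
          exact norm_fderiv_pullback_le hD hH hC hf.differentiable h
        · have h0 : fderiv ℝ (pullback D H f) ξ = 0 :=
            (pullback_eventually_zero hD hg hHg hf h hξ).fderiv_eq.trans (by simp)
          have h1 : ‖fderiv ℝ (pullback D H f) ξ‖ₑ = 0 := by
            rw [← ofReal_norm, norm_eq_zero.2 h0, ENNReal.ofReal_zero]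
          simp [h1]
    _ = ∫⁻ ξ in straighten D H ⁻¹' semiCylinder D H,
          ENNReal.ofReal ((2 + C) ^ 2) * ‖∇ f (straighten D H ξ)‖ₑ ^ 2 := by
        rw [setLIntegral_indicator hmD, straighten_preimage]
        rfl
    _ = ∫⁻ ξ in semiCylinder D H, ENNReal.ofReal ((2 + C) ^ 2) * ‖∇ f ξ‖ₑ ^ 2 :=
        (measurePreserving_shear hm).setLIntegral_comp_preimage_emb
          (measurableEmbedding_shear hm)
          (fun ξ => ENNReal.ofReal ((2 + C) ^ 2) * ‖∇ f ξ‖ₑ ^ 2) _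
    _ = _ := by
        rw [lintegral_const_mul _ (hf.continuous_gradient.measurable.enorm.pow_const 2),
          lintegral_enorm_sq (hf.memLp_gradient _), ENNReal.ofReal_mul (by positivity)]

theorem pullback_apply_of_mem {f : Cyl d → ℝ} {A : Set (Cyl d)} (hA : A ⊆ semiCylinder D H)
    {ξ : Cyl d} (hξ : ξ ∈ straighten D H ⁻¹' A) : pullback D H f ξ = f (straighten D H ξ) := by
  have h1 : (straighten D H ξ).fst ∈ D := (hA hξ).1
  have h2 : ξ ∈ {ξ : Cyl d | ξ.fst ∈ D} := h1
  rw [pullback, indicator_of_mem h2, Function.comp_apply]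

theorem measurableSet_straighten_preimage (hD : IsOpen D) (hH : ContinuousOn H D)
    {A : Set (Cyl d)} (hA : MeasurableSet A) : MeasurableSet (straighten D H ⁻¹' A) :=
  measurable_shear (measurable_indicator_of_continuousOn hD hH).neg hA

theorem lintegral_pullback_subset (hD : IsOpen D) (hH : ContinuousOn H D) (f : Cyl d → ℝ)
    {A : Set (Cyl d)} (hA : A ⊆ semiCylinder D H) (hAm : MeasurableSet A) :
    ∫⁻ ξ in A, ‖f ξ‖ₑ ^ 2 =
      ∫⁻ ξ in straighten D H ⁻¹' A, ‖pullback D H f ξ‖ₑ ^ 2 := by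
  have hm : Measurable fun η => -D.indicator H η :=
    (measurable_indicator_of_continuousOn hD hH).neg
  rw [← (measurePreserving_shear hm).setLIntegral_comp_preimage_emb
    (measurableEmbedding_shear hm) (fun ξ => ‖f ξ‖ₑ ^ 2) A]
  refine setLIntegral_congr_fun (measurableSet_straighten_preimage hD hH hAm) fun ξ hξ => ?_
  simp only [pullback_apply_of_mem hA hξ]
  rfl

/-- The integral of the pull-back over a subset of the upper half-space is an integral over a
subset of the curved cylinder. -/
theorem setIntegral_pullback (hD : IsOpen D) (hH : ContinuousOn H D) (f : Cyl d → ℝ)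
    {B : Set (Cyl d)} (hB : B ⊆ {ξ | 0 < ξ.snd}) (hBm : MeasurableSet B) :
    ∫ ξ in B, pullback D H f ξ =
      ∫ ξ in semiCylinder D H,
        (shear (D.indicator H) ⁻¹' B).indicator (fun _ => (1 : ℝ)) ξ * f ξ := by
  have hm' := measurable_indicator_of_continuousOn hD hH
  have hm : Measurable fun η => -D.indicator H η := hm'.neg
  have hmD : MeasurableSet {ξ : Cyl d | ξ.fst ∈ D} :=
    (hD.preimage (by fun_prop : Continuous fun x : Cyl d => x.fst)).measurableSet
  rw [← (measurePreserving_shear hm).setIntegral_preimage_emb (measurableEmbedding_shear hm)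
    (fun ξ => (shear (D.indicator H) ⁻¹' B).indicator (fun _ => (1 : ℝ)) ξ * f ξ)]
  change _ = ∫ ξ in straighten D H ⁻¹' semiCylinder D H, _
  rw [← integral_indicator hBm, ← integral_indicator
    (measurableSet_straighten_preimage hD hH (isOpen_semiCylinder hD hH).measurableSet),
    straighten_preimage]
  classical
  congr 1
  ext ξ
  have hinv : shear (D.indicator H) (shear (fun η => -D.indicator H η) ξ) = ξ := by
    simpa using shear_neg_shear (fun η => -D.indicator H η) ξ
  by_cases hξ : ξ.fst ∈ D
  · have hξ' : ξ ∈ {ξ : Cyl d | ξ.fst ∈ D} := hξ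
    by_cases hb : ξ ∈ B
    · have h1 : ξ ∈ {ξ : Cyl d | ξ.fst ∈ D ∧ 0 < ξ.snd} := ⟨hξ, hB hb⟩
      have h2 : shear (fun η => -D.indicator H η) ξ ∈ shear (D.indicator H) ⁻¹' B := by
        rw [mem_preimage, hinv]; exact hb
      rw [indicator_of_mem hb, indicator_of_mem h1, indicator_of_mem h2, one_mul, pullback,
        indicator_of_mem hξ']
      rfl
    · have h2 : shear (fun η => -D.indicator H η) ξ ∉ shear (D.indicator H) ⁻¹' B := by
        rw [mem_preimage, hinv]; exact hb
      rw [indicator_of_notMem hb, indicator_apply, indicator_of_notMem h2, zero_mul, ite_self]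
  · have hξ' : ξ ∉ {ξ : Cyl d | ξ.fst ∈ D} := hξ
    have h1 : ξ ∉ {ξ : Cyl d | ξ.fst ∈ D ∧ 0 < ξ.snd} := fun h => hξ h.1
    rw [indicator_of_notMem h1, indicator_apply, pullback, indicator_of_notMem hξ', ite_self]

theorem measurable_pullback (hD : IsOpen D) (hH : ContinuousOn H D) {f : Cyl d → ℝ}
    (hf : Continuous f) : Measurable (pullback D H f) :=
  (hf.measurable.comp
    (measurable_shear (measurable_indicator_of_continuousOn hD hH).neg)).indicator
    (hD.preimage (by fun_prop : Continuous fun x : Cyl d => x.fst)).measurableSet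

theorem memLp_pullback (hD : IsOpen D) (hH : ContinuousOn H D) {f : Cyl d → ℝ}
    (hf : MemLp f 2) : MemLp (pullback D H f) 2 :=
  (hf.comp_measurePreserving
    (measurePreserving_shear (measurable_indicator_of_continuousOn hD hH).neg)).indicator
    (hD.preimage (by fun_prop : Continuous fun x : Cyl d => x.fst)).measurableSet

end Straighten

/-! ### The spectrum of the mixed problem below the first Dirichlet eigenvalue -/

section Cylinder

variable {d : ℕ} {D : Set (EuclideanSpace ℝ (Fin d))} {H : EuclideanSpace ℝ (Fin d) → ℝ}

theorem measurableSet_upper : MeasurableSet {ξ : Cyl d | 0 < ξ.snd} :=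
  (isOpen_Ioi.preimage (by fun_prop : Continuous fun x : Cyl d => x.snd)).measurableSet

/-- The Friedrichs inequality in the cylinder. It is the inequality for differences along a
translation that moves the straightened cylinder off itself. -/
theorem exists_friedrichs (hd : 1 ≤ d) (hD : IsOpen D) (hDb : Bornology.IsBounded D)
    (hH : IsC2Closure D H) :
    ∃ c : ℝ, ∀ f, IsTest (lateralSide D H) f →
      ∫ ξ in semiCylinder D H, f ξ ^ 2 ≤ c * ∫ ξ in semiCylinder D H, ‖∇ f ξ‖ ^ 2 := by
  obtain ⟨g, hg, hHg⟩ := hH.exists_extension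
  obtain ⟨C, hC0, hC⟩ := hH.exists_bound hDb
  obtain ⟨ρ, hρ0, hρ⟩ := hDb.exists_pos_norm_le
  have hH1 : ContDiffOn ℝ 1 H D := hH.1.of_le (by norm_num)
  -- a horizontal vector longer than the diameter of `D`
  set z : Cyl d := Cyl.mk (EuclideanSpace.single (⟨0, hd⟩ : Fin d) (2 * ρ + 1)) 0 with hz
  refine ⟨‖z‖ ^ 2 * (2 + C) ^ 2, fun f hf => ?_⟩
  have hzs : ∀ (ξ : Cyl d) (s : ℝ), (ξ + s • z).snd = ξ.snd := fun ξ s => by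
    change ξ.snd + s • (0 : ℝ) = ξ.snd
    simp
  have hzf : ∀ ξ : Cyl d, ξ.fst ∈ D → pullback D H f (ξ + z) = 0 := fun ξ hξ => by
    have h1 : ξ + z ∉ {ξ : Cyl d | ξ.fst ∈ D} := fun h => by
      have h2 : ‖ξ.fst + EuclideanSpace.single (⟨0, hd⟩ : Fin d) (2 * ρ + 1)‖ ≤ ρ := hρ _ h
      have h3 := hρ _ hξ
      have h4 : ‖EuclideanSpace.single (⟨0, hd⟩ : Fin d) (2 * ρ + 1)‖ = 2 * ρ + 1 := by
        rw [PiLp.norm_single, Real.norm_of_nonneg (by linarith)]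
      have h5 := norm_sub_le (ξ.fst + EuclideanSpace.single (⟨0, hd⟩ : Fin d) (2 * ρ + 1)) ξ.fst
      rw [add_sub_cancel_left, h4] at h5
      linarith
    rw [pullback, indicator_of_notMem h1]
  have key := lintegral_translate_sub_sq_le (Ω := {ξ : Cyl d | 0 < ξ.snd}) (z := z)
    (f := pullback D H f) measurableSet_upper
    (fun ξ hξ s _ => by
      change 0 < (ξ + s • z).snd
      rw [hzs]; exact hξ)
    (fun ξ hξ => contDiffAt_pullback hD hg hHg hH1 hf hξ)
  have h1 : ∫⁻ ξ in semiCylinder D H, ‖f ξ‖ₑ ^ 2 ≤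
      ∫⁻ ξ in {ξ : Cyl d | 0 < ξ.snd}, ‖pullback D H f (ξ + z) - pullback D H f ξ‖ₑ ^ 2 := by
    rw [lintegral_pullback_subset hD hH1.continuousOn f subset_rfl
      (isOpen_semiCylinder hD hH1.continuousOn).measurableSet]
    refine (setLIntegral_congr_fun (measurableSet_straighten_preimage hD hH1.continuousOn
      (isOpen_semiCylinder hD hH1.continuousOn).measurableSet) fun ξ hξ => ?_).trans_le
      (lintegral_mono_set (f := fun ξ => ‖pullback D H f (ξ + z) - pullback D H f ξ‖ₑ ^ 2)
        fun ξ hξ => ?_)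
    · rw [straighten_preimage] at hξ
      simp only [hzf ξ hξ.1, zero_sub, enorm_neg]
    · rw [straighten_preimage] at hξ
      exact hξ.2
  have h2 := (h1.trans key).trans (mul_le_mul_right
    (lintegral_fderiv_pullback_le hD hg hHg hH1 hC0.le (fun η hη => (hC η hη).2.1) hf) _)
  rw [lintegral_enorm_sq_real (hf.memLp _), enorm_sq_eq_ofReal,
    ← ENNReal.ofReal_mul (by positivity), ← mul_assoc] at h2
  exact (ENNReal.ofReal_le_ofReal_iff
    (mul_nonneg (by positivity) (integral_nonneg fun ξ => sq_nonneg _))).1 h2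

/-- In the part of the cylinder below a given level, the `L²` norm is controlled by a small
multiple of the Dirichlet integral and finitely many linear functionals. -/
theorem nearEnd_finite_rank (hD : IsOpen D) (hDb : Bornology.IsBounded D)
    (hH : IsC2Closure D H) (R : ℝ) {M : ℝ} (hM : 0 ≤ M) :
    ∃ (K : Finset (Fin d ⊕ Unit → ℤ)) (w : K → Cyl d → ℝ),
      (∀ i, MemLp (w i) 2 (volume.restrict (semiCylinder D H))) ∧
      ∀ f, IsTest (lateralSide D H) f →
        M * ∫ ξ in {ξ : Cyl d | ξ ∈ semiCylinder D H ∧ ξ.snd ≤ R}, f ξ ^ 2 ≤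
          (∫ ξ in semiCylinder D H, ‖∇ f ξ‖ ^ 2) +
            ∑ i, (∫ ξ in semiCylinder D H, w i ξ * f ξ) ^ 2 := by
  obtain ⟨g, hg, hHg⟩ := hH.exists_extension
  obtain ⟨C, hC0, hC⟩ := hH.exists_bound hDb
  have hH1 : ContDiffOn ℝ 1 H D := hH.1.of_le (by norm_num)
  have hHc := hH1.continuousOn
  set b : OrthonormalBasis (Fin d ⊕ Unit) ℝ (Cyl d) :=
    (EuclideanSpace.basisFun (Fin d) ℝ).prod (OrthonormalBasis.singleton Unit ℝ) with hb
  have hbs : ∀ ξ : Cyl d, ⟪b (Sum.inr ()), ξ⟫ = ξ.snd := fun ξ => by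
    rw [hb, OrthonormalBasis.prod_apply]
    simp [WithLp.prod_inner_apply]
  set n := Fintype.card (Fin d ⊕ Unit) with hn
  -- the factor `(2 + C) ^ 2` compensates the distortion of the gradient by the straightening
  obtain ⟨h, hh, -, hmesh⟩ := exists_mesh n (M * (2 + C) ^ 2)
  have hQ : Bornology.IsBounded {ξ : Cyl d | ξ.fst ∈ D ∧ 0 < ξ.snd ∧ ξ.snd ≤ R + C} := by
    obtain ⟨ρ, hρ⟩ := hDb.exists_norm_le
    refine isBounded_iff_forall_norm_le.2 ⟨ρ + (R + C), fun ξ hξ => ?_⟩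
    refine (Cyl.norm_mk_le ξ.fst ξ.snd).trans (add_le_add (hρ _ hξ.1) ?_)
    rw [Real.norm_of_nonneg hξ.2.1.le]
    exact hξ.2.2
  obtain ⟨K₀, hK₀⟩ := exists_finset_gridCube b h hQ
  -- the cubes that lie in the upper half-space
  set K := K₀.filter fun k => 1 ≤ k (Sum.inr ()) with hK
  have hup : ∀ k ∈ K, gridCube b h k ⊆ {ξ : Cyl d | 0 < ξ.snd} := fun k hk ξ hξ => by
    have h1 : 1 ≤ k (Sum.inr ()) := (Finset.mem_filter.1 hk).2
    rw [← hξ (Sum.inr ()), hbs, Int.one_le_ceil_iff] at h1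
    exact (div_pos_iff_of_pos_right hh).1 h1
  set A : Set (Cyl d) := {ξ | ξ ∈ semiCylinder D H ∧ ξ.snd ≤ R} with hA
  have hAs : A ⊆ semiCylinder D H := fun ξ hξ => hξ.1
  have hAm : MeasurableSet A :=
    (isOpen_semiCylinder hD hHc).measurableSet.inter
      (isClosed_Iic.preimage (by fun_prop : Continuous fun x : Cyl d => x.snd)).measurableSet
  have hcov : straighten D H ⁻¹' A ⊆ ⋃ k ∈ K, gridCube b h k := fun ξ hξ => by
    have h0 : ξ ∈ straighten D H ⁻¹' semiCylinder D H := hξ.1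
    rw [straighten_preimage] at h0
    have h1 : (straighten D H ξ).snd ≤ R := hξ.2
    rw [straighten_eq h0.1] at h1
    change ξ.snd - H ξ.fst ≤ R at h1
    have h2 := (abs_le.1 (hC _ h0.1).1).2
    refine mem_iUnion₂.2 ⟨_, Finset.mem_filter.2 ⟨hK₀ ξ ⟨h0.1, h0.2, by linarith⟩, ?_⟩,
      fun i => rfl⟩
    rw [hbs, Int.one_le_ceil_iff]
    exact div_pos h0.2 hh
  have hvol : ∀ k, volume (gridCube b h k) ≠ ⊤ := fun k => by
    rw [volume_gridCube b hh k]; exact ENNReal.ofReal_ne_top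
  set s : ℝ := √(M / h ^ n) with hs
  have hmI := measurable_indicator_of_continuousOn hD hHc
  refine ⟨K, fun k => (shear (D.indicator H) ⁻¹' gridCube b h k.1).indicator fun _ => s,
    fun k => ?_, fun f hf => ?_⟩
  · have hmp := measurePreserving_shear hmI
    refine memLp_indicator_const 2 (hmp.measurable (measurableSet_gridCube b h _)) s (Or.inr ?_)
    refine ((Measure.restrict_le_self _).trans_lt ?_).ne
    rw [hmp.measure_preimage (measurableSet_gridCube b h _).nullMeasurableSet]
    exact (hvol _).lt_top
  have key := lintegral_sq_le_gridCube b hh K (Ω := {ξ : Cyl d | 0 < ξ.snd})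
    (C := {ξ : Cyl d | 0 ≤ ξ.snd}) hup measurableSet_upper
    (isClosed_Ici.preimage (by fun_prop : Continuous fun x : Cyl d => x.snd)).measurableSet
    (fun z => by
      change 0 ≤ z.snd ∨ 0 ≤ -z.snd
      rcases le_total 0 z.snd with h1 | h1
      · exact Or.inl h1
      · exact Or.inr (by linarith))
    (fun z hz x hx s hs => by
      change 0 < x.snd + s * z.snd
      have h1 : 0 ≤ s * z.snd := mul_nonneg hs.1 hz
      have h2 : 0 < x.snd := hx
      linarith)
    (measurable_pullback hD hHc hf.contDiff.continuous)
    (fun ξ hξ => contDiffAt_pullback hD hg hHg hH1 hf hξ)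
    (fun k _ => (memLp_pullback hD hHc (by simpa using hf.memLp univ)).restrict _)
  have e1 := (lintegral_mono_set (μ := volume)
    (f := fun ξ => ‖pullback D H f ξ‖ₑ ^ 2) hcov).trans key
  rw [← lintegral_pullback_subset hD hHc f hAs hAm, lintegral_enorm_sq_real (hf.memLp _),
    ← hn] at e1
  have hnn : 0 ≤ ∫ ξ in semiCylinder D H, ‖∇ f ξ‖ ^ 2 := integral_nonneg fun x => sq_nonneg _
  have e2 := e1.trans (add_le_add le_rfl (mul_le_mul_right
    (lintegral_fderiv_pullback_le hD hg hHg hH1 hC0.le (fun η hη => (hC η hη).2.1) hf) _))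
  rw [← ENNReal.ofReal_mul (by positivity),
    ← ENNReal.ofReal_sum_of_nonneg (fun k _ => by positivity),
    ← ENNReal.ofReal_add (Finset.sum_nonneg fun k _ => by positivity) (by positivity)] at e2
  have e3 := (ENNReal.ofReal_le_ofReal_iff
    (add_nonneg (Finset.sum_nonneg fun k _ => by positivity) (by positivity))).1 e2
  have e4 : ∀ k : K, (∫ ξ in semiCylinder D H,
      (shear (D.indicator H) ⁻¹' gridCube b h k.1).indicator (fun _ => s) ξ * f ξ) ^ 2 =
      M * ((∫ ξ in gridCube b h k.1, pullback D H f ξ) ^ 2 / h ^ n) := by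
    intro k
    have : ∫ ξ in semiCylinder D H,
        (shear (D.indicator H) ⁻¹' gridCube b h k.1).indicator (fun _ => s) ξ * f ξ =
        s * ∫ ξ in gridCube b h k.1, pullback D H f ξ := by
      rw [setIntegral_pullback hD hHc f (hup _ k.2) (measurableSet_gridCube b h _),
        ← integral_const_mul]
      congr 1
      ext ξ
      by_cases h1 : ξ ∈ shear (D.indicator H) ⁻¹' gridCube b h k.1
      · rw [indicator_of_mem h1, indicator_of_mem h1, one_mul]
      · rw [indicator_of_notMem h1, indicator_of_notMem h1, zero_mul, mul_zero]
    rw [this, mul_pow, hs, Real.sq_sqrt (by positivity)]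
    ring
  rw [Finset.sum_congr rfl fun k _ => e4 k, ← Finset.mul_sum,
    Finset.sum_coe_sort K fun k => (∫ ξ in gridCube b h k, pullback D H f ξ) ^ 2 / h ^ n]
  have h6 := mul_le_mul_of_nonneg_left e3 hM
  have h7 := mul_le_mul_of_nonneg_right hmesh hnn
  linarith

/-- Below the first Dirichlet eigenvalue of the cross-section, the Dirichlet form of the cylinder
is nonnegative up to a form of finite rank. -/
theorem cylinder_finite_rank (hD : IsOpen D) (hDb : Bornology.IsBounded D)
    (hH : IsC2Closure D H) {μ : ℝ} {φ : EuclideanSpace ℝ (Fin d) → ℝ}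
    {Dφ : EuclideanSpace ℝ (Fin d) → EuclideanSpace ℝ (Fin d)}
    (hφ : IsFirstDirichletEigenpair D μ φ Dφ) {c : ℝ} (hc0 : 0 ≤ c) (hc : c < μ) :
    ∃ (K : Finset (Fin d ⊕ Unit → ℤ)) (w : K → Cyl d → ℝ),
      (∀ i, MemLp (w i) 2 (volume.restrict (semiCylinder D H))) ∧
      ∀ f, IsTest (lateralSide D H) f →
        c * ∫ ξ in semiCylinder D H, f ξ ^ 2 ≤
          (∫ ξ in semiCylinder D H, ‖∇ f ξ‖ ^ 2) +
            ∑ i, (∫ ξ in semiCylinder D H, w i ξ * f ξ) ^ 2 := by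
  obtain ⟨g, hg, hHg⟩ := hH.exists_extension
  obtain ⟨R, -, hR⟩ := hH.exists_bound hDb
  have hgR : ∀ η ∈ closure D, -g η ≤ R := by
    have h1 : g '' closure D ⊆ Ici (-R) := by
      refine hg.image_closure.trans (closure_minimal ?_ isClosed_Ici)
      rintro - ⟨η, hη, rfl⟩
      rw [← hHg hη]
      exact (abs_le.1 (hR η hη).1).1
    intro η hη
    have h2 : -R ≤ g η := h1 ⟨η, hη, rfl⟩
    linarith
  have hμ : 0 < μ := hc0.trans_lt hc
  -- the Dirichlet integral is split with the weight `c / μ` for the flat part and the weight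
  -- `1 - c / μ` for the part near the end
  set t := c / μ with ht
  have ht0 : 0 ≤ t := by positivity
  have ht1 : 0 < 1 - t := sub_pos.2 ((div_lt_one hμ).2 hc)
  obtain ⟨K, w, hw, hn⟩ := nearEnd_finite_rank hD hDb hH R (M := c / (1 - t)) (by positivity)
  refine ⟨K, w, hw, fun f hf => ?_⟩
  have h1 := hn f hf
  have h2 := rayleigh_flatCylinder hD hDb hg hHg hgR hφ hf
  set A : Set (Cyl d) := {ξ | ξ ∈ semiCylinder D H ∧ ξ.snd ≤ R} with hA
  set B : Set (Cyl d) := {ξ | ξ.fst ∈ D ∧ R < ξ.snd} with hB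
  have hBs : B ⊆ semiCylinder D H := fun ξ hξ => by
    have h3 := (abs_le.1 (hR _ hξ.1).1).1
    exact ⟨hξ.1, by linarith [hξ.2]⟩
  have hAB : semiCylinder D H = A ∪ B := by
    refine Subset.antisymm (fun ξ hξ => ?_) (union_subset (fun ξ hξ => hξ.1) hBs)
    rcases le_or_gt ξ.snd R with h | h
    · exact Or.inl ⟨hξ, h⟩
    · exact Or.inr ⟨hξ.1, h⟩
  have hBm : MeasurableSet B :=
    ((hD.preimage (by fun_prop : Continuous fun x : Cyl d => x.fst)).inter
      (isOpen_Ioi.preimage (by fun_prop : Continuous fun x : Cyl d => x.snd))).measurableSet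
  have hdis : Disjoint A B := disjoint_left.2 fun ξ hξ hξ' => not_lt.2 hξ.2 hξ'.2
  have h3 : ∫ ξ in semiCylinder D H, f ξ ^ 2 = (∫ ξ in A, f ξ ^ 2) + ∫ ξ in B, f ξ ^ 2 := by
    rw [hAB]
    exact setIntegral_union hdis hBm (hf.memLp A).integrable_sq (hf.memLp B).integrable_sq
  have h4 : ∫ ξ in B, ‖∇ f ξ‖ ^ 2 ≤ ∫ ξ in semiCylinder D H, ‖∇ f ξ‖ ^ 2 :=
    setIntegral_mono_set (hf.memLp_gradient _).norm.integrable_sq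
      (Eventually.of_forall fun ξ => sq_nonneg _) hBs.eventuallyLE
  have h5 : 0 ≤ ∑ i, (∫ ξ in semiCylinder D H, w i ξ * f ξ) ^ 2 :=
    Finset.sum_nonneg fun i _ => sq_nonneg _
  have h6 := mul_le_mul_of_nonneg_left (h2.trans h4) ht0
  have h7 := mul_le_mul_of_nonneg_left h1 ht1.le
  have h8 : t * (μ * ∫ ξ in B, f ξ ^ 2) = c * ∫ ξ in B, f ξ ^ 2 := by
    rw [← mul_assoc, ht, div_mul_cancel₀ _ hμ.ne']
  have h9 : (1 - t) * (c / (1 - t) * ∫ ξ in A, f ξ ^ 2) = c * ∫ ξ in A, f ξ ^ 2 := by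
    rw [← mul_assoc, mul_div_cancel₀ _ ht1.ne']
  rw [h8] at h6
  rw [h9] at h7
  have h10 := mul_nonneg ht0 h5
  rw [h3, mul_add]
  linarith

end Cylinder

/-! ### A trial function for the cylinder -/

section Trial

/-- Plateau functions with an arbitrarily small Dirichlet integral: dilations of one bump function. -/
theorem exists_plateau (C : ℝ) {δ : ℝ} (hδ : 0 < δ) :
    ∃ q : ℝ → ℝ, ContDiff ℝ ∞ q ∧ HasCompactSupport q ∧ (∀ ζ, |ζ| ≤ C → q ζ = 1) ∧
      ∫ ζ, deriv q ζ ^ 2 ≤ δ := by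
  let p : ContDiffBump (0 : ℝ) := ⟨1, 2, one_pos, one_lt_two⟩
  set c := ∫ ζ, deriv p ζ ^ 2 with hc
  have hc0 : 0 ≤ c := integral_nonneg fun ζ => sq_nonneg _
  obtain ⟨ε, hε, hεC, hεc⟩ : ∃ ε : ℝ, 0 < ε ∧ ε * |C| ≤ 1 ∧ ε * c ≤ δ := by
    have h1 : 0 < |C| + 1 := by positivity
    have h2 : 0 < c + 1 := by positivity
    refine ⟨min (|C| + 1)⁻¹ (δ / (c + 1)), by positivity, ?_, ?_⟩
    · calc min (|C| + 1)⁻¹ (δ / (c + 1)) * |C| ≤ (|C| + 1)⁻¹ * (|C| + 1) := by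
            gcongr
            · exact min_le_left _ _
            · linarith
        _ = 1 := inv_mul_cancel₀ h1.ne'
    · calc min (|C| + 1)⁻¹ (δ / (c + 1)) * c ≤ δ / (c + 1) * (c + 1) := by
            gcongr
            · exact min_le_right _ _
            · linarith
        _ = δ := div_mul_cancel₀ _ h2.ne'
  refine ⟨fun ζ => p (ε * ζ), p.contDiff.comp (by fun_prop), ?_, fun ζ hζ => ?_, ?_⟩
  · exact p.hasCompactSupport.comp_homeomorph (Homeomorph.mulLeft₀ ε hε.ne')
  · refine p.one_of_mem_closedBall (mem_closedBall_zero_iff.2 ?_)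
    rw [Real.norm_eq_abs, abs_mul, abs_of_pos hε]
    exact (mul_le_mul_of_nonneg_left (hζ.trans (le_abs_self C)) hε.le).trans hεC
  · have h1 : ∀ ζ, deriv (fun ζ => p (ε * ζ)) ζ = ε * deriv p (ε * ζ) := fun ζ => by
      simpa using deriv_comp_mul_left ε p ζ
    simp only [h1, mul_pow]
    rw [integral_const_mul, Measure.integral_comp_mul_left (fun ζ => deriv p ζ ^ 2),
      abs_of_pos (inv_pos.2 hε), smul_eq_mul, ← hc]
    calc ε ^ 2 * (ε⁻¹ * c) = ε * c := by field_simp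
      _ ≤ δ := hεc

/-- The integral of the square of a plateau function over a half-line is affine in the end point,
as long as the end point stays on the plateau. -/
theorem integral_Ioi_plateau {q : ℝ → ℝ} (hq : Continuous q) (hqc : HasCompactSupport q) {C : ℝ}
    (hC : ∀ ζ, |ζ| ≤ C → q ζ = 1) {x : ℝ} (hx : |x| ≤ C) :
    ∫ ζ in Ioi (-x), q ζ ^ 2 = (∫ ζ in Ioi 0, q ζ ^ 2) + x := by
  have hi : Integrable fun ζ => q ζ ^ 2 := by
    have := (hq.memLp_of_hasCompactSupport (p := 2) (μ := volume) hqc).integrable_sq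
    exact this
  rw [← intervalIntegral.integral_interval_add_Ioi (a := -x) (b := 0) hi.integrableOn
    hi.integrableOn]
  have h1 : ∫ ζ in (-x)..0, q ζ ^ 2 = ∫ ζ in (-x)..0, (1 : ℝ) := by
    refine intervalIntegral.integral_congr fun ζ hζ => ?_
    have h2 : |ζ| ≤ C := by
      have h3 := abs_le.1 hx
      rw [abs_le]
      rcases mem_uIcc.1 hζ with h | h <;> constructor <;> linarith
    simp only [hC ζ h2, one_pow]
  rw [h1, intervalIntegral.integral_const]
  simp [add_comm]

theorem inner_gradient_comp {E F : Type*} [NormedAddCommGroup E] [InnerProductSpace ℝ E]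
    [CompleteSpace E] [NormedAddCommGroup F] [InnerProductSpace ℝ F] [CompleteSpace F]
    (A : E →L[ℝ] F) {u : F → ℝ} {x : E} (hu : DifferentiableAt ℝ u (A x)) (v : E) :
    ⟪∇ (fun y => u (A y)) x, v⟫ = ⟪∇ u (A x), A v⟫ := by
  have h : HasFDerivAt (fun y => u (A y)) ((fderiv ℝ u (A x)).comp A) x :=
    hu.hasFDerivAt.comp x A.hasFDerivAt
  simp [gradient, h.fderiv]

variable {d : ℕ} {D : Set (EuclideanSpace ℝ (Fin d))} {H : EuclideanSpace ℝ (Fin d) → ℝ}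

/-- The gradient of `u(η) q(ζ)` has the orthogonal components `q ∇u` and `u q'`. -/
theorem norm_gradient_separated {u : EuclideanSpace ℝ (Fin d) → ℝ} {q : ℝ → ℝ}
    (hu : Differentiable ℝ u) (hq : Differentiable ℝ q) (ξ : Cyl d) :
    ‖∇ (fun ξ : Cyl d => u ξ.fst * q ξ.snd) ξ‖ ^ 2 =
      ‖∇ u ξ.fst‖ ^ 2 * q ξ.snd ^ 2 + u ξ.fst ^ 2 * deriv q ξ.snd ^ 2 := by
  have h1 : ∇ (fun x : Cyl d => u x.fst) ξ = Cyl.mk (∇ u ξ.fst) 0 := by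
    refine ext_inner_right ℝ fun v => ?_
    refine (inner_gradient_comp (WithLp.fstL 2 ℝ (EuclideanSpace ℝ (Fin d)) ℝ)
      (hu ξ.fst) v).trans ?_
    rw [WithLp.prod_inner_apply]
    change ⟪∇ u ξ.fst, v.fst⟫ = ⟪∇ u ξ.fst, v.fst⟫ + ⟪(0 : ℝ), v.snd⟫
    rw [inner_zero_left, add_zero]
  have h2 : ∇ (fun x : Cyl d => q x.snd) ξ = Cyl.mk 0 (deriv q ξ.snd) := by
    refine ext_inner_right ℝ fun v => ?_
    refine (inner_gradient_comp (WithLp.sndL 2 ℝ (EuclideanSpace ℝ (Fin d)) ℝ)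
      (hq ξ.snd) v).trans ?_
    rw [WithLp.prod_inner_apply]
    change ⟪∇ q ξ.snd, v.snd⟫ = ⟪(0 : EuclideanSpace ℝ (Fin d)), v.fst⟫ +
      ⟪deriv q ξ.snd, v.snd⟫
    rw [inner_zero_left, zero_add, gradient_eq_deriv']
  have hd1 : DifferentiableAt ℝ (fun x : Cyl d => u x.fst) ξ :=
    (hu.comp (contDiff_cylFst.differentiable one_ne_zero)) ξ
  have hd2 : DifferentiableAt ℝ (fun x : Cyl d => q x.snd) ξ :=
    (hq.comp (contDiff_cylSnd.differentiable one_ne_zero)) ξ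
  rw [gradient_mul hd1 hd2, h1, h2,
    WithLp.prod_norm_sq_eq_of_L2]
  change ‖u ξ.fst • (0 : EuclideanSpace ℝ (Fin d)) + q ξ.snd • ∇ u ξ.fst‖ ^ 2 +
    ‖u ξ.fst • deriv q ξ.snd + q ξ.snd • (0 : ℝ)‖ ^ 2 = _
  simp only [smul_zero, zero_add, add_zero, norm_smul, mul_pow, Real.norm_eq_abs, sq_abs]
  ring

/-- Products of a test function of the cross-section and a function of the axial variable are
test functions of the cylinder. -/
theorem isTest_separated (hD : IsOpen D) (hH : ContinuousOn H D)
    {u : EuclideanSpace ℝ (Fin d) → ℝ} {q : ℝ → ℝ} (hu : ContDiff ℝ ∞ u)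
    (huc : HasCompactSupport u) (huD : tsupport u ⊆ D) (hq : ContDiff ℝ ∞ q)
    (hqc : HasCompactSupport q) :
    IsTest (lateralSide D H) fun ξ => u ξ.fst * q ξ.snd := by
  have hsub : tsupport (fun ξ : Cyl d => u ξ.fst * q ξ.snd) ⊆
      {ξ | ξ.fst ∈ tsupport u ∧ ξ.snd ∈ tsupport q} := by
    refine closure_minimal (fun ξ hξ => ?_) ?_
    · exact ⟨subset_tsupport u (left_ne_zero_of_mul hξ),
        subset_tsupport q (right_ne_zero_of_mul hξ)⟩
    · exact ((isClosed_tsupport u).preimage (by fun_prop)).inter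
        ((isClosed_tsupport q).preimage (by fun_prop))
  refine ⟨(hu.comp contDiff_cylFst).mul (hq.comp contDiff_cylSnd), ?_, ?_⟩
  · have hK : IsCompact (WithLp.toLp 2 '' (tsupport u ×ˢ tsupport q) : Set (Cyl d)) :=
      (huc.isCompact.prod hqc.isCompact).image (WithLp.prod_continuous_toLp 2 _ _)
    refine hK.of_isClosed_subset (isClosed_tsupport _) fun ξ hξ => ?_
    exact ⟨(ξ.fst, ξ.snd), hsub hξ, rfl⟩
  · refine disjoint_left.2 fun ξ hξ hξ' => ?_
    have h1 : ξ.fst ∈ frontier D := closure_lateralSide_subset hD hH hξ'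
    rw [hD.frontier_eq] at h1
    exact h1.2 (huD (hsub hξ).1)

/-- If the integral of `H (|∇φ|² - μ φ²)` is negative, then some test function of the cylinder has
a Rayleigh quotient below the first Dirichlet eigenvalue of the cross-section. -/
theorem exists_trial (hD : IsOpen D) (hDb : Bornology.IsBounded D) (hH : IsC2Closure D H) {μ : ℝ}
    {φ : EuclideanSpace ℝ (Fin d) → ℝ}
    {Dφ : EuclideanSpace ℝ (Fin d) → EuclideanSpace ℝ (Fin d)}
    (hφ : IsEigenpair D (frontier D) μ φ Dφ)
    (hneg : ∫ η in D, H η * (‖Dφ η‖ ^ 2 - μ * φ η ^ 2) < 0) :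
    ∃ f, IsTest (lateralSide D H) f ∧
      ∫ ξ in semiCylinder D H, ‖∇ f ξ‖ ^ 2 < μ * ∫ ξ in semiCylinder D H, f ξ ^ 2 := by
  obtain ⟨C, hC0, hC⟩ := hH.exists_bound hDb
  have hHc : ContinuousOn H D := hH.1.continuousOn
  have mφ := hφ.mem.memLp
  have mφ' := hφ.mem.memLp_grad
  set N := ∫ η in D, H η * (‖Dφ η‖ ^ 2 - μ * φ η ^ 2) with hN
  set m := ∫ η in D, φ η ^ 2 with hm
  have hm0 : 0 ≤ m := integral_nonneg fun η => sq_nonneg _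
  obtain ⟨δ, hδ, hδN⟩ : ∃ δ : ℝ, 0 < δ ∧ δ * m + N < 0 := by
    refine ⟨-N / (m + 1), div_pos (by linarith) (by linarith), ?_⟩
    have h1 : -N / (m + 1) * (m + 1) = -N := div_mul_cancel₀ _ (by linarith)
    have h2 : 0 < -N / (m + 1) := div_pos (by linarith) (by linarith)
    linarith
  obtain ⟨q, hq, hqc, hq1, hqδ⟩ := exists_plateau C hδ
  set a := ∫ ζ in Ioi 0, q ζ ^ 2 with ha
  have hqi : Integrable fun ζ => q ζ ^ 2 :=
    (hq.continuous.memLp_of_hasCompactSupport (p := 2) (μ := volume) hqc).integrable_sq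
  have hqi' : Integrable fun ζ => deriv q ζ ^ 2 :=
    ((hq.continuous_deriv (by simp)).memLp_of_hasCompactSupport (p := 2) (μ := volume)
      hqc.deriv).integrable_sq
  have hcol : ∀ η ∈ D, ∫ ζ in Ioi (-H η), q ζ ^ 2 = a + H η := fun η hη =>
    integral_Ioi_plateau hq.continuous hqc hq1 (hC η hη).1
  obtain ⟨u, u1, u2, u3, hu, hu'⟩ := hφ.mem.exists_tendsto_tsupport hD
  have mu : ∀ k, MemLp (u k) 2 (volume.restrict D) := fun k =>
    memLp_of_compactSupport (u1 k).continuous (u2 k) D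
  have u1' : ∀ k, ContDiff ℝ 1 (u k) := fun k => (u1 k).of_le (by simp)
  have mu' : ∀ k, MemLp (∇ (u k)) 2 (volume.restrict D) := fun k =>
    memLp_of_compactSupport (continuous_gradient (u1' k)) (hasCompactSupport_gradient (u2 k)) D
  -- the thickness `a + H` of the cylinder, measured by the plateau function
  set b : EuclideanSpace ℝ (Fin d) → ℝ := fun η => a + H η with hb
  have bb : ∀ᵐ η ∂(volume.restrict D), ‖b η‖ ≤ |a| + C :=
    (ae_restrict_mem hD.measurableSet).mono fun η hη =>
      (abs_add_le _ _).trans (by linarith [(hC η hη).1])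
  have sb : AEStronglyMeasurable b (volume.restrict D) :=
    (continuousOn_const.add hHc).aestronglyMeasurable hD.measurableSet
  have l1 := hu'.integral_inner (hu'.smul_bdd bb) mu' mφ' (fun k => memLp_smul_bdd (mu' k) bb sb)
    (memLp_smul_bdd mφ' bb sb)
  have l2 := hu.integral_mul (hu.smul_bdd bb) mu mφ (fun k => memLp_smul_bdd (mu k) bb sb)
    (memLp_smul_bdd mφ bb sb)
  have l3 := hu.integral_mul hu mu mφ mu mφ
  have i1 : ∀ {v : EuclideanSpace ℝ (Fin d) → EuclideanSpace ℝ (Fin d)},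
      MemLp v 2 (volume.restrict D) →
      Integrable (fun η => ⟪v η, b η • v η⟫) (volume.restrict D) := fun h =>
    integrable_inner_of_memLp h (memLp_smul_bdd h bb sb)
  have i2 : ∀ {v : EuclideanSpace ℝ (Fin d) → ℝ}, MemLp v 2 (volume.restrict D) →
      Integrable (fun η => v η * b η • v η) (volume.restrict D) := fun h =>
    integrable_smul_of_memLp h (memLp_smul_bdd h bb sb)
  have e1 : ∀ k, ∫ ξ in semiCylinder D H, (u k ξ.fst * q ξ.snd) ^ 2 =
      ∫ η in D, u k η * b η • u k η := fun k => by
    have ht := isTest_separated hD hHc (u1 k) (u2 k) (u3 k) hq hqc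
    rw [integral_semiCylinder hD hHc (ht.memLp _).integrable_sq]
    refine setIntegral_congr_fun hD.measurableSet fun η hη => ?_
    change ∫ ζ in Ioi (-H η), (u k η * q ζ) ^ 2 = _
    simp only [mul_pow]
    rw [integral_const_mul, hcol η hη, smul_eq_mul]
    ring
  have e2 : ∀ k, ∫ ξ in semiCylinder D H, ‖∇ (fun ξ : Cyl d => u k ξ.fst * q ξ.snd) ξ‖ ^ 2 ≤
      (∫ η in D, ⟪∇ (u k) η, b η • ∇ (u k) η⟫) + δ * ∫ η in D, u k η * u k η := fun k => by
    have ht := isTest_separated hD hHc (u1 k) (u2 k) (u3 k) hq hqc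
    have i3 : Integrable (fun η => u k η * u k η) (volume.restrict D) :=
      (mu k).integrable_mul (mu k)
    rw [integral_semiCylinder hD hHc (ht.memLp_gradient _).norm.integrable_sq,
      ← integral_const_mul, ← integral_add (i1 (mu' k)) (i3.const_mul δ)]
    refine integral_mono_of_nonneg (Eventually.of_forall fun η =>
      integral_nonneg fun ζ => sq_nonneg _) ((i1 (mu' k)).add (i3.const_mul δ))
      ((ae_restrict_mem hD.measurableSet).mono fun η hη => ?_)
    simp only [norm_gradient_separated ((u1' k).differentiable one_ne_zero)
      (hq.differentiable (by simp))]
    change ∫ ζ in Ioi (-H η), (‖∇ (u k) η‖ ^ 2 * q ζ ^ 2 + u k η ^ 2 * deriv q ζ ^ 2) ≤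
      ⟪∇ (u k) η, b η • ∇ (u k) η⟫ + δ * (u k η * u k η)
    rw [integral_add (hqi.integrableOn.const_mul _) (hqi'.integrableOn.const_mul _),
      integral_const_mul, integral_const_mul, hcol η hη, inner_smul_right,
      real_inner_self_eq_norm_sq]
    have h1 : ∫ ζ in Ioi (-H η), deriv q ζ ^ 2 ≤ δ :=
      (setIntegral_le_integral hqi' (Eventually.of_forall fun ζ => sq_nonneg _)).trans hqδ
    have h2 := mul_le_mul_of_nonneg_left h1 (sq_nonneg (u k η))
    simp only [hb]
    linarith
  -- the terms with the factor `a` cancel in the limit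
  have hlim : (∫ η in D, ⟪Dφ η, b η • Dφ η⟫) + δ * (∫ η in D, φ η * φ η) -
      μ * (∫ η in D, φ η * b η • φ η) = δ * m + N := by
    have j1 : Integrable (fun η => ‖Dφ η‖ ^ 2) (volume.restrict D) := mφ'.norm.integrable_sq
    have j2 : Integrable (fun η => φ η ^ 2) (volume.restrict D) := mφ.integrable_sq
    have h1 : N = (∫ η in D, ⟪Dφ η, b η • Dφ η⟫) - μ * (∫ η in D, φ η * b η • φ η) -
        a * ((∫ η in D, ‖Dφ η‖ ^ 2) - μ * ∫ η in D, φ η ^ 2) := by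
      have j3 := (i1 mφ').sub ((i2 mφ).const_mul μ)
      have j4 := (j1.sub (j2.const_mul μ)).const_mul a
      rw [hN, ← integral_const_mul, ← integral_const_mul, ← integral_sub (i1 mφ')
        ((i2 mφ).const_mul μ), ← integral_sub j1 (j2.const_mul μ), ← integral_const_mul]
      refine Eq.trans ?_ (integral_sub j3 j4)
      congr 1
      ext η
      simp only [inner_smul_right, real_inner_self_eq_norm_sq, smul_eq_mul, hb]
      ring
    rw [hφ.integral_grad_sq, sub_self, mul_zero, sub_zero] at h1
    have h2 : ∫ η in D, φ η * φ η = m := by simp only [hm, sq]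
    rw [h1, h2]
    ring
  have hlt := ((l1.add (l3.const_mul δ)).sub (l2.const_mul μ)).eventually_lt_const
    (hlim ▸ hδN)
  obtain ⟨k, hk⟩ := hlt.exists
  refine ⟨_, isTest_separated hD hHc (u1 k) (u2 k) (u3 k) hq hqc, ?_⟩
  rw [e1 k]
  linarith [e2 k]

/-- The condition on `H` in the form without derivatives is sufficient for a trapped mode. -/
theorem exists_trapped_mode (hd : 1 ≤ d) (hD : IsOpen D) (hDb : Bornology.IsBounded D)
    (hH : IsC2Closure D H) {μ : ℝ} {φ : EuclideanSpace ℝ (Fin d) → ℝ}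
    {Dφ : EuclideanSpace ℝ (Fin d) → EuclideanSpace ℝ (Fin d)}
    (hφ : IsFirstDirichletEigenpair D μ φ Dφ)
    (hneg : ∫ η in D, H η * (‖Dφ η‖ ^ 2 - μ * φ η ^ 2) < 0) :
    ∃ Λ : ℝ, 0 < Λ ∧ Λ < μ ∧ IsEigenvalue (semiCylinder D H) (lateralSide D H) Λ := by
  obtain ⟨f, hf, hlt⟩ := exists_trial hD hDb hH hφ.eigenpair hneg
  have hnn : 0 ≤ ∫ ξ in semiCylinder D H, ‖∇ f ξ‖ ^ 2 := integral_nonneg fun ξ => sq_nonneg _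
  have hf0 : 0 ≤ ∫ ξ in semiCylinder D H, f ξ ^ 2 := integral_nonneg fun ξ => sq_nonneg _
  have hfpos : 0 < ∫ ξ in semiCylinder D H, f ξ ^ 2 := by
    refine hf0.lt_of_ne fun h => ?_
    rw [← h, mul_zero] at hlt
    linarith
  -- a level strictly between the Rayleigh quotient of `f` and `μ`, as the form is nonnegative up to
  -- finite rank only strictly below `μ`
  obtain ⟨c, hc1, hc2⟩ := exists_between ((div_lt_iff₀ hfpos).2 hlt)
  have hc0 : 0 ≤ c := (div_nonneg hnn hf0).trans hc1.le
  obtain ⟨K, w, hw, hineq⟩ := cylinder_finite_rank hD hDb hH hφ hc0 hc2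
  obtain ⟨Λ, hΛ, U, G, hU⟩ := exists_eigenvalue_lt w hw hineq ⟨f, hf, (div_lt_iff₀ hfpos).1 hc1⟩
  refine ⟨Λ, ?_, hΛ.trans hc2, U, G, hU⟩
  -- the Friedrichs inequality passes to the eigenfunction
  obtain ⟨A, hA⟩ := exists_friedrichs hd hD hDb hH
  obtain ⟨v, hv, v1, v2⟩ := hU.mem.exists_tendsto
  have mU := hU.mem.memLp
  have mG := hU.mem.memLp_grad
  have l1 := v1.integral_mul v1 (fun k => (hv k).memLp _) mU (fun k => (hv k).memLp _) mU
  have l2 := v2.integral_inner v2 (fun k => (hv k).memLp_gradient _) mG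
    (fun k => (hv k).memLp_gradient _) mG
  have h1 : ∫ ξ in semiCylinder D H, U ξ * U ξ ≤
      A * ∫ ξ in semiCylinder D H, ⟪G ξ, G ξ⟫ := by
    refine le_of_tendsto_of_tendsto' l1 (l2.const_mul A) fun k => ?_
    simpa only [real_inner_self_eq_norm_sq, sq] using hA (v k) (hv k)
  have h2 : 0 ≤ ∫ ξ in semiCylinder D H, ⟪G ξ, G ξ⟫ :=
    integral_nonneg fun ξ => real_inner_self_nonneg
  have h3 := hU.eigen U G hU.mem
  have h4 : 0 ≤ ∫ ξ in semiCylinder D H, U ξ * U ξ := integral_nonneg fun ξ => mul_self_nonneg _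
  have h5 : 0 < ∫ ξ in semiCylinder D H, U ξ * U ξ := by
    refine h4.lt_of_ne fun h => hU.ne_zero ?_
    have h6 := (integral_eq_zero_iff_of_nonneg (fun ξ => mul_self_nonneg (U ξ))
      (mU.integrable_mul mU)).1 h.symm
    filter_upwards [h6] with ξ hξ
    exact mul_self_eq_zero.1 hξ
  by_contra! hΛ0
  have h6 := mul_nonpos_of_nonpos_of_nonneg hΛ0 h4
  have h7 : ∫ ξ in semiCylinder D H, ⟪G ξ, G ξ⟫ = 0 := le_antisymm (h3.trans_le h6) h2
  rw [h7, mul_zero] at h1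
  linarith

end Trial

end MixedCylinder

theorem theorem3p2 (d : ℕ) (hd : 1 ≤ d) (D : Set (EuclideanSpace ℝ (Fin d)))
    (hDo : IsOpen D) (hDc : IsConnected D) (hDb : Bornology.IsBounded D)
    (H : EuclideanSpace ℝ (Fin d) → ℝ) (hH : MixedCylinder.IsC2Closure D H)
    (μ₁ : ℝ) (φ₁ : EuclideanSpace ℝ (Fin d) → ℝ)
    (Dφ₁ : EuclideanSpace ℝ (Fin d) → EuclideanSpace ℝ (Fin d))
    (hφ : MixedCylinder.IsFirstDirichletEigenpair D μ₁ φ₁ Dφ₁) :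
    -- the sufficient condition for a trapped mode
    ((∫ η in D, φ₁ η ^ 2 * Δ H η) < 0 →
      ∃ Λ : ℝ, 0 < Λ ∧ Λ < μ₁ ∧
        MixedCylinder.IsEigenvalue (MixedCylinder.semiCylinder D H)
          (MixedCylinder.lateralSide D H) Λ) ∧
    -- its equivalent form without derivatives of `H`
    ((∫ η in D, φ₁ η ^ 2 * Δ H η) < 0 ↔
      (∫ η in D, H η * (‖Dφ₁ η‖ ^ 2 - μ₁ * φ₁ η ^ 2)) < 0) ∧
    -- it holds if `H` is superharmonic but not harmonic
    ((∀ η ∈ D, Δ H η ≤ 0) → (∃ η ∈ D, Δ H η ≠ 0) →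
      (∫ η in D, φ₁ η ^ 2 * Δ H η) < 0) := by
  have hid := hφ.eigenpair.integral_sq_mul_laplacian hDo hDb hH
  have hiff : (∫ η in D, φ₁ η ^ 2 * Δ H η) < 0 ↔
      (∫ η in D, H η * (‖Dφ₁ η‖ ^ 2 - μ₁ * φ₁ η ^ 2)) < 0 := by
    rw [hid]
    constructor <;> intro h <;> linarith
  exact ⟨fun h => MixedCylinder.exists_trapped_mode hd hDo hDb hH hφ (hiff.1 h), hiff,
    hφ.integral_sq_mul_laplacian_neg hDo hDc.isPreconnected hDb hH⟩
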